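/- All manifolds are finite-dimensional, smooth, Hausdorff, second countable and without boundary. Let $\Gamma$ be a strict Lie 2-group, given by a crossed module of Lie groups $(G,H,t,\alpha)$: a Lie group homomorphism $t:H\to G$ and a smooth action $\alpha$ of $G$ on $H$ by automorphisms with $\alpha(t(h),x)=hxh^{-1}$ and $t(\alpha(g,h))=gt(h)g^{-1}$. Its Lie groupoid has objects $G$ and morphisms $(h,g)\in H\times G$ from $g$ to $t(h)g$, with $(h_2,g_2)\circ(h_1,g_1)=(h_2h_1,g_1)$; morphisms are multiplied as in the semi-direct product $H\rtimes G$. A principal $\Gamma$-2-bundle over a manifold $M$ is a Lie groupoid $\mathcal P$ (objects $\mathcal P_0$, morphisms $\mathcal P_1$) with a surjective submersion $\pi:\mathcal P_0\to M$ satisfying $\pi\circ s=\pi\circ t$, and a smooth functor $R:\mathcal P\times\Gamma\to\mathcal P$ that is a strict right action preserving $\pi$, such that the smooth functor $(\mathrm{pr}_1,R):\mathcal P\times\Gamma\to\mathcal P\times_M\mathcal P$ into the full subgroupoid of $\mathcal P\times\mathcal P$ over $\mathcal P_0\times_M\mathcal P_0$ is a weak equivalence of Lie groupoids (smoothly essentially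 surjective and smoothly fully faithful). Let $t_*:\mathfrak h\to\mathfrak g$ be the differential of $t$, let $(\alpha_g)_*:\mathfrak h\to\mathfrak h$ be the differential of $\alpha_g$, let $(\tilde\alpha_h)_*:\mathfrak g\to\mathfrak h$ be the differential at $1$ of $g\mapsto h^{-1}\alpha(g,h)$, and let $\theta$ denote the left-invariant Maurer--Cartan forms of $G$ and $H$. A connection on $\mathcal P$ is a triple $\Omega=(\Omega^a,\Omega^b,\Omega^c)$ of smooth forms $\Omega^a\in\Omega^1(\mathcal P_0,\mathfrak g)$, $\Omega^b\in\Omega^1(\mathcal P_1,\mathfrak h)$, $\Omega^c\in\Omega^2(\mathcal P_0,\mathfrak h)$ such that $t^*\Omega^a-s^*\Omega^a=t_*(\Omega^b)$ on $\mathcal P_1$, such that $\mathrm{pr}_1^*\Omega^b-\circ^*\Omega^b+\mathrm{pr}_2^*\Omega^b=0$ on the manifold $\mathcal P_1\times_{s,t}\mathcal P_1$ of composable pairs, and such that $$R^*\Omega=\mathrm{Ad}_{\mathrm{pr}_\Gamma}^{-1}(\mathrm{pr}_{\mathcal P}^*\Omega)+\mathrm{pr}_\Gamma^*\Theta\quad\text{over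 }\mathcal P\times\Gamma,$$ that is, at $(p,g)\in\mathcal P_0\times G$ and $(\rho,(h,g))\in\mathcal P_1\times(H\times G)$, $$R^*\Omega^a=\mathrm{Ad}_g^{-1}(\Omega^a_p)+\theta_g,\qquad R^*\Omega^b=(\alpha_{g^{-1}})_*\big(\mathrm{Ad}_h^{-1}(\Omega^b_\rho)+(\tilde\alpha_h)_*((s^*\Omega^a)_\rho)+\theta_h\big),\qquad R^*\Omega^c=(\alpha_{g^{-1}})_*(\Omega^c_p).$$ Theorem. Let $\mathcal P$ be a principal $\Gamma$-2-bundle over $M$ for which the $G$-action $R:\mathcal P_0\times G\to\mathcal P_0$ on objects is free and proper (the map $\mathcal P_0\times G\to\mathcal P_0\times\mathcal P_0$, $(p,g)\mapsto(p,R(p,g))$, is proper). Then there exists a connection on $\mathcal P$. -/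

import Mathlib

open scoped Manifold ContDiff Topology

noncomputable section

namespace TwoBundle

/-! ### Smooth maps on embedded submanifolds

Fibre products of manifolds are treated as subsets of products of manifolds. A map defined on such
an embedded submanifold is smooth iff it is `ContMDiffOn` that subset. -/

section Subsets

variable {E E' H H' X Y : Type*}
  [NormedAddCommGroup E] [NormedSpace ℝ E] [TopologicalSpace H] (I : ModelWithCorners ℝ E H)
  [NormedAddCommGroup E'] [NormedSpace ℝ E'] [TopologicalSpace H'] (J : ModelWithCorners ℝ E' H')
  [TopologicalSpace X] [ChartedSpace H X] [TopologicalSpace Y] [ChartedSpace H' Y]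

/-- `f` restricts to a surjective submersion from the submanifold `A` onto the submanifold `B`:
it is smooth on `A`, maps `A` onto `B`, and has a local smooth section through every point
of `A` (equivalently, its derivative `T_a A → T_{f a} B` is onto for every `a`). -/
structure IsSurjectiveSubmersionOn (f : X → Y) (A : Set X) (B : Set Y) : Prop where
  smooth : ContMDiffOn I J ∞ f A
  image_eq : f '' A = B
  exists_section : ∀ a ∈ A, ∃ U ∈ 𝓝 (f a), ∃ σ : Y → X,
    ContMDiffOn J I ∞ σ (U ∩ B) ∧ σ (f a) = a ∧ ∀ y ∈ U ∩ B, σ y ∈ A ∧ f (σ y) = y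

/-- `f` is a diffeomorphism from the manifold `X` onto the submanifold `B` of `Y`. -/
structure IsDiffeomorphOnto (f : X → Y) (B : Set Y) : Prop where
  smooth : ContMDiff I J ∞ f
  range_eq : Set.range f = B
  exists_inverse : ∃ g : Y → X, ContMDiffOn J I ∞ g B ∧ ∀ x, g (f x) = x

end Subsets

/-! ### Vector valued differential forms on manifolds -/

section Forms

variable {E E' H H' X Y : Type*}
  [NormedAddCommGroup E] [NormedSpace ℝ E] [TopologicalSpace H] (I : ModelWithCorners ℝ E H)
  [NormedAddCommGroup E'] [NormedSpace ℝ E'] [TopologicalSpace H'] (J : ModelWithCorners ℝ E' H')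
  [TopologicalSpace X] [ChartedSpace H X] [TopologicalSpace Y] [ChartedSpace H' Y]

variable (X) in
/-- Not necessarily smooth `k`-forms on `X` with values in `V`. -/
abbrev Form (V : Type*) [NormedAddCommGroup V] [NormedSpace ℝ V] (k : ℕ) : Type _ :=
  ∀ x : X, TangentSpace I x [⋀^Fin k]→L[ℝ] V

variable {V W : Type*} [NormedAddCommGroup V] [NormedSpace ℝ V]
  [NormedAddCommGroup W] [NormedSpace ℝ W] {k : ℕ}

variable {I J}

/-- The coordinate expression of a form in the preferred chart at `x₀`, that is, its pullback
along the inverse of that chart. -/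
def Form.inChart (φ : Form X I V k) (x₀ : X) (y : E) : E [⋀^Fin k]→L[ℝ] V :=
  (φ ((extChartAt I x₀).symm y)).compContinuousLinearMap
    (mfderivWithin 𝓘(ℝ, E) I (extChartAt I x₀).symm (Set.range I) y)

/-- A form is smooth if all its coordinate expressions are smooth. -/
def Form.IsSmooth (φ : Form X I V k) : Prop :=
  ∀ x₀ : X, ContDiffOn ℝ ∞ (φ.inChart x₀) (extChartAt I x₀).target

variable (I J) in
/-- The pullback `f^* φ`. -/
def Form.pullback (f : X → Y) (φ : Form Y J V k) : Form X I V k :=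
  fun x => (φ (f x)).compContinuousLinearMap (mfderiv I J f x)

/-- Application of a family of linear maps, indexed by the points of `X`, to the values of
a form. -/
def Form.mapValues (A : X → V →L[ℝ] W) (φ : Form X I V k) : Form X I W k :=
  fun x => (A x).compContinuousAlternatingMap (φ x)

end Forms

/-! ### Lie groupoids -/

/-- The structure maps of a groupoid with objects `X₀` and morphisms `X₁`. The composition
`comp a b = a ∘ b` only has a meaning if `src a = tgt b`. -/
structure GroupoidData (X₀ X₁ : Type*) where
  src : X₁ → X₀
  tgt : X₁ → X₀
  ident : X₀ → X₁
  inv : X₁ → X₁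
  comp : X₁ → X₁ → X₁

namespace GroupoidData

variable {X₀ X₁ Y₀ Y₁ : Type*}

/-- The set of composable pairs of morphisms. -/
def composable (X : GroupoidData X₀ X₁) : Set (X₁ × X₁) := {c | X.src c.1 = X.tgt c.2}

/-- The composition on (composable) pairs of morphisms. -/
def compPair (X : GroupoidData X₀ X₁) (c : X₁ × X₁) : X₁ := X.comp c.1 c.2

/-- The product groupoid. -/
def prod (X : GroupoidData X₀ X₁) (Y : GroupoidData Y₀ Y₁) :
    GroupoidData (X₀ × Y₀) (X₁ × Y₁) where
  src ξ := (X.src ξ.1, Y.src ξ.2)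
  tgt ξ := (X.tgt ξ.1, Y.tgt ξ.2)
  ident x := (X.ident x.1, Y.ident x.2)
  inv ξ := (X.inv ξ.1, Y.inv ξ.2)
  comp ξ η := (X.comp ξ.1 η.1, Y.comp ξ.2 η.2)

/-- The groupoid with objects `M` and only identity morphisms. -/
def discrete (M : Type*) : GroupoidData M M where
  src x := x
  tgt x := x
  ident x := x
  inv x := x
  comp x _ := x

variable {E₀ E₁ F₀ F₁ H₀ H₁ K₀ K₁ : Type*}
  [NormedAddCommGroup E₀] [NormedSpace ℝ E₀] [TopologicalSpace H₀] (I₀ : ModelWithCorners ℝ E₀ H₀)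
  [NormedAddCommGroup E₁] [NormedSpace ℝ E₁] [TopologicalSpace H₁] (I₁ : ModelWithCorners ℝ E₁ H₁)
  [NormedAddCommGroup F₀] [NormedSpace ℝ F₀] [TopologicalSpace K₀] (J₀ : ModelWithCorners ℝ F₀ K₀)
  [NormedAddCommGroup F₁] [NormedSpace ℝ F₁] [TopologicalSpace K₁] (J₁ : ModelWithCorners ℝ F₁ K₁)
  [TopologicalSpace X₀] [ChartedSpace H₀ X₀] [TopologicalSpace X₁] [ChartedSpace H₁ X₁]
  [TopologicalSpace Y₀] [ChartedSpace K₀ Y₀] [TopologicalSpace Y₁] [ChartedSpace K₁ Y₁]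

/-- The structure maps form a Lie groupoid. -/
structure IsLieGroupoid (X : GroupoidData X₀ X₁) : Prop where
  src_comp : ∀ a b, X.src a = X.tgt b → X.src (X.comp a b) = X.src b
  tgt_comp : ∀ a b, X.src a = X.tgt b → X.tgt (X.comp a b) = X.tgt a
  comp_assoc : ∀ a b c, X.src a = X.tgt b → X.src b = X.tgt c →
    X.comp (X.comp a b) c = X.comp a (X.comp b c)
  src_ident : ∀ x, X.src (X.ident x) = x
  tgt_ident : ∀ x, X.tgt (X.ident x) = x
  ident_comp : ∀ a, X.comp (X.ident (X.tgt a)) a = a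
  comp_ident : ∀ a, X.comp a (X.ident (X.src a)) = a
  src_inv : ∀ a, X.src (X.inv a) = X.tgt a
  tgt_inv : ∀ a, X.tgt (X.inv a) = X.src a
  inv_comp : ∀ a, X.comp (X.inv a) a = X.ident (X.src a)
  comp_inv : ∀ a, X.comp a (X.inv a) = X.ident (X.tgt a)
  submersion_src : Manifold.IsSubmersion I₁ I₀ ∞ X.src
  submersion_tgt : Manifold.IsSubmersion I₁ I₀ ∞ X.tgt
  smooth_ident : ContMDiff I₀ I₁ ∞ X.ident
  smooth_inv : ContMDiff I₁ I₁ ∞ X.inv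
  smooth_comp : ContMDiffOn (I₁.prod I₁) I₁ ∞ X.compPair X.composable

/-- `f₀` on objects and `f₁` on morphisms form a smooth functor. -/
structure IsSmoothFunctor (X : GroupoidData X₀ X₁) (Y : GroupoidData Y₀ Y₁)
    (f₀ : X₀ → Y₀) (f₁ : X₁ → Y₁) : Prop where
  smooth_obj : ContMDiff I₀ J₀ ∞ f₀
  smooth_mor : ContMDiff I₁ J₁ ∞ f₁
  map_src : ∀ a, Y.src (f₁ a) = f₀ (X.src a)
  map_tgt : ∀ a, Y.tgt (f₁ a) = f₀ (X.tgt a)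
  map_ident : ∀ x, f₁ (X.ident x) = Y.ident (f₀ x)
  map_comp : ∀ a b, X.src a = X.tgt b → f₁ (X.comp a b) = Y.comp (f₁ a) (f₁ b)

/-- The smooth functor `(f₀, f₁)` from `X` to the full subgroupoid of `Y` over the submanifold
`S` of the objects of `Y` is a weak equivalence, i.e. smoothly essentially surjective
(`s ∘ pr₂ : X₀ ×_{Y₀} Y₁ → S` is a surjective submersion) and smoothly fully faithful
(`X₁` is, via `(s, t, f₁)`, the fibre product of `f₀ × f₀` and `(s, t)`). -/
structure IsWeakEquivalence (X : GroupoidData X₀ X₁) (Y : GroupoidData Y₀ Y₁) (S : Set Y₀)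
    (f₀ : X₀ → Y₀) (f₁ : X₁ → Y₁) : Prop where
  smooth_functor : IsSmoothFunctor I₀ I₁ J₀ J₁ X Y f₀ f₁
  mem : ∀ x, f₀ x ∈ S
  essentially_surjective : IsSurjectiveSubmersionOn (I₀.prod J₁) J₀ (fun z => Y.src z.2)
    {z : X₀ × Y₁ | f₀ z.1 = Y.tgt z.2 ∧ Y.src z.2 ∈ S} S
  fully_faithful : IsDiffeomorphOnto I₁ ((I₀.prod I₀).prod J₁)
    (fun a => ((X.src a, X.tgt a), f₁ a))
    {z : (X₀ × X₀) × Y₁ | Y.src z.2 = f₀ z.1.1 ∧ Y.tgt z.2 = f₀ z.1.2}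

end GroupoidData

/-! ### Lie 2-groups -/

section CrossedModules

variable {EG EH G H : Type*}
  [NormedAddCommGroup EG] [NormedSpace ℝ EG] [NormedAddCommGroup EH] [NormedSpace ℝ EH]
  [TopologicalSpace G] [ChartedSpace EG G] [Group G]
  [TopologicalSpace H] [ChartedSpace EH H] [Group H]

variable (EG EH G H) in
/-- A strict Lie 2-group, presented by its crossed module of Lie groups. -/
structure CrossedModule where
  t : H →* G
  α : G →* MulAut H
  smooth_t : ContMDiff 𝓘(ℝ, EH) 𝓘(ℝ, EG) ∞ t
  smooth_α : ContMDiff (𝓘(ℝ, EG).prod 𝓘(ℝ, EH)) 𝓘(ℝ, EH) ∞ (fun x : G × H => α x.1 x.2)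
  α_t : ∀ h x : H, α (t h) x = h * x * h⁻¹
  t_α : ∀ (g : G) (h : H), t (α g h) = g * t h * g⁻¹

variable (EG) in
/-- The adjoint action of a Lie group on its Lie algebra `T_1 G`; recall that every tangent space
of `G` is, as a type, the model space of `G`. -/
def Ad (g : G) : EG →L[ℝ] EG := mfderiv 𝓘(ℝ, EG) 𝓘(ℝ, EG) (fun x : G => g * x * g⁻¹) 1

variable (EG G) in
/-- The left-invariant Maurer-Cartan form of a Lie group. -/
def maurerCartan : Form G 𝓘(ℝ, EG) EG 1 := fun g =>
  ContinuousAlternatingMap.ofSubsingleton ℝ (TangentSpace 𝓘(ℝ, EG) g) EG (0 : Fin 1)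
    (mfderiv 𝓘(ℝ, EG) 𝓘(ℝ, EG) (fun x : G => g⁻¹ * x) g : TangentSpace 𝓘(ℝ, EG) g →L[ℝ] EG)

namespace CrossedModule

variable (Γ : CrossedModule EG EH G H)

/-- The underlying Lie groupoid: objects `G`, morphisms `(h, g) : g → t(h)g`. -/
def groupoid : GroupoidData G (H × G) where
  src γ := γ.2
  tgt γ := Γ.t γ.1 * γ.2
  ident g := (1, g)
  inv γ := (γ.1⁻¹, Γ.t γ.1 * γ.2)
  comp γ δ := (γ.1 * δ.1, δ.2)

/-- Multiplication of morphisms: the semi-direct product `H ⋊ G`. -/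
def mulMor (γ δ : H × G) : H × G := (γ.1 * Γ.α γ.2 δ.1, γ.2 * δ.2)

/-- Inversion of morphisms in the semi-direct product `H ⋊ G`. -/
def invMor (γ : H × G) : H × G := (Γ.α γ.2⁻¹ γ.1⁻¹, γ.2⁻¹)

/-- The differential `t_* : 𝔥 → 𝔤`. -/
def tStar : EH →L[ℝ] EG := mfderiv 𝓘(ℝ, EH) 𝓘(ℝ, EG) Γ.t 1

/-- The differential `(α_g)_* : 𝔥 → 𝔥`. -/
def αStar (g : G) : EH →L[ℝ] EH := mfderiv 𝓘(ℝ, EH) 𝓘(ℝ, EH) (fun h : H => Γ.α g h) 1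

/-- The differential at `1` of `G → H`, `g ↦ h⁻¹ α(g, h)`. -/
def αTildeStar (h : H) : EG →L[ℝ] EH :=
  mfderiv 𝓘(ℝ, EG) 𝓘(ℝ, EH) (fun g : G => h⁻¹ * Γ.α g h) 1

end CrossedModule

end CrossedModules

/-! ### Lie 2-algebra valued forms on Lie groupoids -/

section GammaForms

variable {EG EH G H : Type*}
  [NormedAddCommGroup EG] [NormedSpace ℝ EG] [NormedAddCommGroup EH] [NormedSpace ℝ EH]
  [TopologicalSpace G] [ChartedSpace EG G] [Group G]
  [TopologicalSpace H] [ChartedSpace EH H] [Group H]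
  {X₀ X₁ Y₀ Y₁ E₀ E₁ F₀ F₁ H₀ H₁ K₀ K₁ : Type*}
  [NormedAddCommGroup E₀] [NormedSpace ℝ E₀] [TopologicalSpace H₀] (I₀ : ModelWithCorners ℝ E₀ H₀)
  [NormedAddCommGroup E₁] [NormedSpace ℝ E₁] [TopologicalSpace H₁] (I₁ : ModelWithCorners ℝ E₁ H₁)
  [NormedAddCommGroup F₀] [NormedSpace ℝ F₀] [TopologicalSpace K₀] (J₀ : ModelWithCorners ℝ F₀ K₀)
  [NormedAddCommGroup F₁] [NormedSpace ℝ F₁] [TopologicalSpace K₁] (J₁ : ModelWithCorners ℝ F₁ K₁)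
  [TopologicalSpace X₀] [ChartedSpace H₀ X₀] [TopologicalSpace X₁] [ChartedSpace H₁ X₁]
  [TopologicalSpace Y₀] [ChartedSpace K₀ Y₀] [TopologicalSpace Y₁] [ChartedSpace K₁ Y₁]
  {p : ℕ}

variable (X₀ X₁ EG EH p) in
/-- The components of a `p`-form on a groupoid with values in the Lie 2-algebra `𝔥 → 𝔤`, without
any condition on them; see `IsGammaForm` for the conditions. -/
@[ext]
structure GammaForm where
  a : Form X₀ I₀ EG p
  b : Form X₁ I₁ EH p
  c : Form X₀ I₀ EH (p + 1)

variable {I₀ I₁ J₀ J₁}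

/-- The conditions on the components of a `γ`-valued `p`-form on the Lie groupoid `X`: they are
smooth, `Δ a = t_* b`, and `Δ b = 0` over the manifold of composable pairs of morphisms. Tangent
vectors of the latter at `(ξ, η)` are pairs `(v, w)` with `ds(v) = dt(w)`. -/
structure IsGammaForm (Γ : CrossedModule EG EH G H) (X : GroupoidData X₀ X₁)
    (Ψ : GammaForm EG EH X₀ X₁ I₀ I₁ p) : Prop where
  smooth_a : Ψ.a.IsSmooth
  smooth_b : Ψ.b.IsSmooth
  smooth_c : Ψ.c.IsSmooth
  delta_a : Form.pullback I₁ I₀ X.tgt Ψ.a - Form.pullback I₁ I₀ X.src Ψ.a =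
    Ψ.b.mapValues (fun _ => Γ.tStar)
  delta_b : ∀ ξ η : X₁, X.src ξ = X.tgt η →
    ∀ (v : Fin p → TangentSpace I₁ ξ) (w : Fin p → TangentSpace I₁ η),
      (∀ i, (mfderiv I₁ I₀ X.src ξ (v i) : E₀) = mfderiv I₁ I₀ X.tgt η (w i)) →
      Ψ.b ξ v - Ψ.b (X.comp ξ η) (fun i =>
        mfderivWithin (I₁.prod I₁) I₁ X.compPair X.composable (ξ, η) (v i, w i)) + Ψ.b η w = 0

namespace GammaForm

instance : Add (GammaForm EG EH X₀ X₁ I₀ I₁ p) where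
  add Ψ Φ := ⟨Ψ.a + Φ.a, Ψ.b + Φ.b, Ψ.c + Φ.c⟩

variable (I₀ I₁) in
/-- The component-wise pullback along a smooth functor `(f₀, f₁)`. -/
def pullback (f₀ : X₀ → Y₀) (f₁ : X₁ → Y₁) (Ψ : GammaForm EG EH Y₀ Y₁ J₀ J₁ p) :
    GammaForm EG EH X₀ X₁ I₀ I₁ p where
  a := Form.pullback I₀ J₀ f₀ Ψ.a
  b := Form.pullback I₁ J₁ f₁ Ψ.b
  c := Form.pullback I₀ J₀ f₀ Ψ.c

/-- The adjoint action `Ad_F` of a smooth functor `F = (F₀, F₁) : X → Γ`. -/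
def adjoint (Γ : CrossedModule EG EH G H) (X : GroupoidData X₀ X₁)
    (F₀ : X₀ → G) (F₁ : X₁ → H × G) (Ψ : GammaForm EG EH X₀ X₁ I₀ I₁ p) :
    GammaForm EG EH X₀ X₁ I₀ I₁ p where
  a := Ψ.a.mapValues (fun x => Ad EG (F₀ x))
  b := Ψ.b.mapValues (fun ξ => Ad EH (F₁ ξ).1 ∘L Γ.αStar (F₁ ξ).2) +
    (Form.pullback I₁ I₀ X.src Ψ.a).mapValues
      (fun ξ => Γ.αTildeStar (F₁ ξ).1⁻¹ ∘L Ad EG (F₁ ξ).2)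
  c := Ψ.c.mapValues (fun x => Γ.αStar (F₀ x))

/-- `Ad_F⁻¹`, the adjoint action of the pointwise inverse functor `F⁻¹ : X → Γ`. -/
def adjointInv (Γ : CrossedModule EG EH G H) (X : GroupoidData X₀ X₁)
    (F₀ : X₀ → G) (F₁ : X₁ → H × G) (Ψ : GammaForm EG EH X₀ X₁ I₀ I₁ p) :
    GammaForm EG EH X₀ X₁ I₀ I₁ p :=
  adjoint Γ X (fun x => (F₀ x)⁻¹) (fun ξ => Γ.invMor (F₁ ξ)) Ψ

end GammaForm

/-- The Maurer-Cartan form `Θ` of a Lie 2-group. -/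
def CrossedModule.maurerCartan (Γ : CrossedModule EG EH G H) :
    GammaForm EG EH G (H × G) 𝓘(ℝ, EG) (𝓘(ℝ, EH).prod 𝓘(ℝ, EG)) 1 where
  a := TwoBundle.maurerCartan EG G
  b := (Form.pullback (𝓘(ℝ, EH).prod 𝓘(ℝ, EG)) 𝓘(ℝ, EH) Prod.fst
    (TwoBundle.maurerCartan EH H)).mapValues (fun γ => Γ.αStar γ.2⁻¹)
  c := 0

end GammaForms

/-! ### Principal 2-bundles and connections -/

section Bundles

variable {EG EH G H EM E₀ E₁ M P₀ P₁ : Type*}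
  [NormedAddCommGroup EG] [NormedSpace ℝ EG] [NormedAddCommGroup EH] [NormedSpace ℝ EH]
  [TopologicalSpace G] [ChartedSpace EG G] [Group G]
  [TopologicalSpace H] [ChartedSpace EH H] [Group H]
  [NormedAddCommGroup EM] [NormedSpace ℝ EM] [TopologicalSpace M] [ChartedSpace EM M]
  [NormedAddCommGroup E₀] [NormedSpace ℝ E₀] [TopologicalSpace P₀] [ChartedSpace E₀ P₀]
  [NormedAddCommGroup E₁] [NormedSpace ℝ E₁] [TopologicalSpace P₁] [ChartedSpace E₁ P₁]

/-- A smooth right action `(R₀, R₁)` of the Lie 2-group `Γ` on the Lie groupoid `P`. -/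
structure IsSmoothRightAction (Γ : CrossedModule EG EH G H) (P : GroupoidData P₀ P₁)
    (R₀ : P₀ × G → P₀) (R₁ : P₁ × (H × G) → P₁) : Prop where
  smooth_functor : GroupoidData.IsSmoothFunctor
    (𝓘(ℝ, E₀).prod 𝓘(ℝ, EG)) (𝓘(ℝ, E₁).prod (𝓘(ℝ, EH).prod 𝓘(ℝ, EG))) 𝓘(ℝ, E₀) 𝓘(ℝ, E₁)
    (P.prod Γ.groupoid) P R₀ R₁
  obj_one : ∀ x, R₀ (x, 1) = x
  mor_one : ∀ ρ, R₁ (ρ, (1, 1)) = ρ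
  obj_mul : ∀ x g g', R₀ (R₀ (x, g), g') = R₀ (x, g * g')
  mor_mul : ∀ ρ γ γ', R₁ (R₁ (ρ, γ), γ') = R₁ (ρ, Γ.mulMor γ γ')

variable (M P₀ P₁ EM E₀ E₁) in
/-- A principal `Γ`-2-bundle over `M` whose total space groupoid has objects `P₀` and
morphisms `P₁`. -/
structure PrincipalTwoBundle (Γ : CrossedModule EG EH G H) where
  /-- the total space -/
  P : GroupoidData P₀ P₁
  isLieGroupoid : P.IsLieGroupoid 𝓘(ℝ, E₀) 𝓘(ℝ, E₁)
  /-- the bundle projection, on objects -/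
  π : P₀ → M
  π_functor : GroupoidData.IsSmoothFunctor 𝓘(ℝ, E₀) 𝓘(ℝ, E₁) 𝓘(ℝ, EM) 𝓘(ℝ, EM)
    P (GroupoidData.discrete M) π (fun ρ => π (P.src ρ))
  π_surjective : Function.Surjective π
  π_submersion : Manifold.IsSubmersion 𝓘(ℝ, E₀) 𝓘(ℝ, EM) ∞ π
  /-- the action on objects -/
  R₀ : P₀ × G → P₀
  /-- the action on morphisms -/
  R₁ : P₁ × (H × G) → P₁
  action : IsSmoothRightAction (E₀ := E₀) (E₁ := E₁) Γ P R₀ R₁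
  π_action : ∀ x g, π (R₀ (x, g)) = π x
  /-- `(pr₁, R) : P × Γ → P ×_M P` is a weak equivalence; here `P ×_M P` is the full subgroupoid
  of `P × P` over `P₀ ×_M P₀`. -/
  weak_equivalence : GroupoidData.IsWeakEquivalence
    (𝓘(ℝ, E₀).prod 𝓘(ℝ, EG)) (𝓘(ℝ, E₁).prod (𝓘(ℝ, EH).prod 𝓘(ℝ, EG)))
    (𝓘(ℝ, E₀).prod 𝓘(ℝ, E₀)) (𝓘(ℝ, E₁).prod 𝓘(ℝ, E₁))
    (P.prod Γ.groupoid) (P.prod P) {z : P₀ × P₀ | π z.1 = π z.2}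
    (fun z => (z.1, R₀ z)) (fun z => (z.1, R₁ z))

/-- A connection on a principal `Γ`-2-bundle: a `γ`-valued 1-form `Ω` on the total space with
`R^* Ω = Ad_{pr_Γ}⁻¹ (pr_P^* Ω) + pr_Γ^* Θ` over `P × Γ`. -/
structure IsConnection {Γ : CrossedModule EG EH G H}
    (B : PrincipalTwoBundle EM E₀ E₁ M P₀ P₁ Γ)
    (Ω : GammaForm EG EH P₀ P₁ 𝓘(ℝ, E₀) 𝓘(ℝ, E₁) 1) : Prop where
  isGammaForm : IsGammaForm Γ B.P Ω
  equivariance :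
    GammaForm.pullback (𝓘(ℝ, E₀).prod 𝓘(ℝ, EG)) (𝓘(ℝ, E₁).prod (𝓘(ℝ, EH).prod 𝓘(ℝ, EG)))
      B.R₀ B.R₁ Ω =
    GammaForm.adjointInv Γ (B.P.prod Γ.groupoid) Prod.snd Prod.snd
      (GammaForm.pullback (𝓘(ℝ, E₀).prod 𝓘(ℝ, EG)) (𝓘(ℝ, E₁).prod (𝓘(ℝ, EH).prod 𝓘(ℝ, EG)))
        Prod.fst Prod.fst Ω) +
    GammaForm.pullback (𝓘(ℝ, E₀).prod 𝓘(ℝ, EG)) (𝓘(ℝ, E₁).prod (𝓘(ℝ, EH).prod 𝓘(ℝ, EG)))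
      Prod.snd Prod.snd Γ.maurerCartan

end Bundles

end TwoBundle

end

/-! Locally over `M` a section of `π` trivialises the 2-bundle up to weak equivalence, and the
trivialisation carries Maurer-Cartan forms. Globally the conditions on a connection are affine in Ω,
so they survive averages with total weight one.

Let σ be a section of `π` over an open set U. Essential surjectivity supplies, near any object p
over U, a morphism q(p) from p to σ(π p)·g(p) (`exists_local_lift`). A free and proper action has
slices (`exists_slice`): orbit maps are immersions, the implicit function theorem produces a local
transversal, and properness prevents an orbit from returning to a small transversal. Transport along
a slice makes g and q equivariant under G on an invariant open set (`exists_lift`).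

For two such lifts and a morphism ρ from p to p', the composite q'(p') ∘ ρ ∘ q(p)⁻¹ joins two
translates of the same point σ(π p). Full faithfulness writes it as the action of a unique (h, g(p))
on the identity of that point. The transition function h is smooth, satisfies t(h(ρ))g(p) = g'(p'),
is multiplicative under composition (`transition_comp`) and equivariant (`transition_R`).

The forms g^*θ and (α_{g⁻¹})_* h^*θ therefore satisfy the identities of a connection, except that
different lifts occur at source and target (`tStar_formB`, `formB_comp`, `formA_R`, `formB_R`). Each
identity is the derivative of an identity between group-valued functions equal to 1 at the base
point, where products differentiate to sums (`der_mul`).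

Countably many lifts, weighted by a G-invariant partition of unity χ on the preimage of U
(`exists_slice_bump`, `exists_weights`), are averaged in `isConnectionOver_sum`. The weights need
not be constant along morphisms, so the form on morphisms is a double sum with weights χ_n(s)χ_m(t).
A partition of unity on `M` then glues the local solutions (`exists_isConnectionOver_univ`). The
form Ω^c can be zero because the conditions on it are linear and homogeneous. -/

open scoped Manifold ContDiff Topology

noncomputable section

namespace TwoBundle

/-! ### Derivatives of maps between manifolds, as maps between the model spaces -/

section Derivative

variable {E E' E'' F H H' H'' K X Y Z W : Type*}
  [NormedAddCommGroup E] [NormedSpace ℝ E] [TopologicalSpace H] (I : ModelWithCorners ℝ E H)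
  [NormedAddCommGroup E'] [NormedSpace ℝ E'] [TopologicalSpace H'] (J : ModelWithCorners ℝ E' H')
  [NormedAddCommGroup E''] [NormedSpace ℝ E''] [TopologicalSpace H'']
  (J' : ModelWithCorners ℝ E'' H'')
  [NormedAddCommGroup F] [NormedSpace ℝ F] [TopologicalSpace K] (L : ModelWithCorners ℝ F K)
  [TopologicalSpace X] [ChartedSpace H X] [TopologicalSpace Y] [ChartedSpace H' Y]
  [TopologicalSpace Z] [ChartedSpace H'' Z] [TopologicalSpace W] [ChartedSpace K W]

/-- The derivative `mfderiv I J f x`, regarded as a map between the model spaces. -/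
def der (f : X → Y) (x : X) : E →L[ℝ] E' := mfderiv I J f x

variable {I J J' L}

theorem der_congr {f f' : X → Y} {x : X} (h : f =ᶠ[𝓝 x] f') : der I J f x = der I J f' x :=
  h.mfderiv_eq

theorem der_comp {f : X → Y} {g : Y → Z} {x : X} (hg : MDifferentiableAt J J' g (f x))
    (hf : MDifferentiableAt I J f x) :
    der I J' (fun x => g (f x)) x = (der J J' g (f x)).comp (der I J f x) :=
  mfderiv_comp x hg hf

theorem der_comp_of_eq {f : X → Y} {g : Y → Z} {x : X} {y : Y} (hg : MDifferentiableAt J J' g y)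
    (hf : MDifferentiableAt I J f x) (hy : f x = y) :
    der I J' (fun x => g (f x)) x = (der J J' g y).comp (der I J f x) := by
  subst hy; exact der_comp hg hf

theorem der_const (c : Y) (x : X) : der I J (fun _ : X => c) x = 0 := mfderiv_const

theorem der_id (x : X) : der I I (fun x : X => x) x = ContinuousLinearMap.id ℝ E := mfderiv_id

theorem der_fst (x : X × Y) :
    der (I.prod J) I (Prod.fst : X × Y → X) x = ContinuousLinearMap.fst ℝ E E' := mfderiv_fst

theorem der_snd (x : X × Y) :
    der (I.prod J) J (Prod.snd : X × Y → Y) x = ContinuousLinearMap.snd ℝ E E' := mfderiv_snd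

theorem der_prodMk {f : X → Y} {g : X → Z} {x : X} (hf : MDifferentiableAt I J f x)
    (hg : MDifferentiableAt I J' g x) :
    der I (J.prod J') (fun x => (f x, g x)) x = (der I J f x).prod (der I J' g x) :=
  mfderiv_prodMk hf hg

theorem der_prod_apply {μ : Y × Z → W} {p : Y × Z}
    (hμ : MDifferentiableAt (J.prod J') L μ p) (v : E' × E'') :
    der (J.prod J') L μ p v =
      der J L (fun y => μ (y, p.2)) p.1 v.1 + der J' L (fun z => μ (p.1, z)) p.2 v.2 :=
  mfderiv_prod_eq_add_apply (v := v) hμ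

/-- The Leibniz rule for a map in two variables. -/
theorem der_two {μ : Y × Z → W} {f : X → Y} {g : X → Z} {x : X} {y : Y} {z : Z}
    (hy : f x = y) (hz : g x = z)
    (hμ : MDifferentiableAt (J.prod J') L μ (y, z)) (hf : MDifferentiableAt I J f x)
    (hg : MDifferentiableAt I J' g x) :
    der I L (fun x => μ (f x, g x)) x =
      (der J L (fun y => μ (y, z)) y).comp (der I J f x) +
        (der J' L (fun z => μ (y, z)) z).comp (der I J' g x) := by
  subst hy hz
  ext v
  have h := der_comp (J := J.prod J') (f := fun x => (f x, g x)) (g := μ) hμ (hf.prodMk hg)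
  have h' := congrArg (fun A : E →L[ℝ] F => A v) h
  simp only [ContinuousLinearMap.comp_apply] at h'
  rw [h', der_prodMk hf hg, der_prod_apply hμ]
  rfl

theorem mdiffAt {f : X → Y} {x : X} (hf : ContMDiffAt I J ∞ f x) : MDifferentiableAt I J f x :=
  hf.mdifferentiableAt (by simp)

end Derivative

/-! ### Group valued maps near the unit -/

section LieGroups

variable {E EG EH K X G H : Type*}
  [NormedAddCommGroup E] [NormedSpace ℝ E] [TopologicalSpace K] {I : ModelWithCorners ℝ E K}
  [TopologicalSpace X] [ChartedSpace K X]
  [NormedAddCommGroup EG] [NormedSpace ℝ EG]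
  [TopologicalSpace G] [ChartedSpace EG G] [Group G] [LieGroup 𝓘(ℝ, EG) ∞ G]
  [NormedAddCommGroup EH] [NormedSpace ℝ EH]
  [TopologicalSpace H] [ChartedSpace EH H] [Group H] [LieGroup 𝓘(ℝ, EH) ∞ H]

/-- At the unit both partial derivatives of the multiplication are identities, so no translation
terms remain in the Leibniz rule. This is the reason for normalising all group-valued functions
below to take the value 1 at the base point. -/
theorem der_mul {u v : X → G} {x : X} (hu : MDifferentiableAt I 𝓘(ℝ, EG) u x)
    (hv : MDifferentiableAt I 𝓘(ℝ, EG) v x) (hux : u x = 1) (hvx : v x = 1) :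
    der I 𝓘(ℝ, EG) (fun x => u x * v x) x = der I 𝓘(ℝ, EG) u x + der I 𝓘(ℝ, EG) v x := by
  have h := der_two (L := 𝓘(ℝ, EG)) (μ := fun z : G × G => z.1 * z.2) hux hvx
    (mdiffAt (contMDiff_mul 𝓘(ℝ, EG) ∞).contMDiffAt) hu hv
  simpa [der_id] using h

theorem der_inv {u : X → G} {x : X} (hu : MDifferentiableAt I 𝓘(ℝ, EG) u x) (hux : u x = 1) :
    der I 𝓘(ℝ, EG) (fun x => (u x)⁻¹) x = -der I 𝓘(ℝ, EG) u x := by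
  have hinv : MDifferentiableAt I 𝓘(ℝ, EG) (fun x => (u x)⁻¹) x :=
    (mdiffAt (contMDiff_inv 𝓘(ℝ, EG) ∞).contMDiffAt).comp x hu
  have h := der_mul hinv hu (by simp [hux]) hux
  simp only [inv_mul_cancel] at h
  rw [der_const] at h
  exact eq_neg_of_add_eq_zero_left h.symm

end LieGroups

/-! ### Smoothness of one-forms -/

section OneForms

variable {E X V : Type*}
  [NormedAddCommGroup E] [NormedSpace ℝ E] [TopologicalSpace X] [ChartedSpace E X]
  [NormedAddCommGroup V] [NormedSpace ℝ V]

/-- The one-form on `X`, in the sense of `Form`, given by a family of linear maps. -/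
def toForm (φ : X → E →L[ℝ] V) : Form X 𝓘(ℝ, E) V 1 := fun x =>
  ContinuousAlternatingMap.ofSubsingleton ℝ (TangentSpace 𝓘(ℝ, E) x) V (0 : Fin 1) (φ x)

/-- All coordinate expressions of the one-form `φ` are smooth at `x`. -/
def SmoothFormAt (φ : X → E →L[ℝ] V) (x : X) : Prop :=
  ∀ x₀ : X, x ∈ (extChartAt 𝓘(ℝ, E) x₀).source →
    ContDiffAt ℝ ∞ (fun y => (φ ((extChartAt 𝓘(ℝ, E) x₀).symm y)).comp
      (der 𝓘(ℝ, E) 𝓘(ℝ, E) (extChartAt 𝓘(ℝ, E) x₀).symm y)) (extChartAt 𝓘(ℝ, E) x₀ x)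

theorem isSmooth_toForm {φ : X → E →L[ℝ] V} (h : ∀ x, SmoothFormAt φ x) :
    (toForm φ).IsSmooth := by
  intro x₀ y hy
  have h1 := h _ x₀ ((extChartAt 𝓘(ℝ, E) x₀).map_target hy)
  rw [(extChartAt 𝓘(ℝ, E) x₀).right_inv hy] at h1
  have h2 := (ContinuousAlternatingMap.ofSubsingletonLIE (𝕜 := ℝ) (E := E) (F := V)
    (0 : Fin 1)).toContinuousLinearEquiv.contDiff.contDiffAt.comp y h1
  refine h2.contDiffWithinAt.congr_of_eventuallyEq ?_ ?_
  · refine Filter.Eventually.of_forall fun z => ?_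
    ext v
    simp only [Form.inChart, modelWithCornersSelf_coe, Set.range_id, mfderivWithin_univ]
    rfl
  · ext v
    simp only [Form.inChart, modelWithCornersSelf_coe, Set.range_id, mfderivWithin_univ]
    rfl

theorem continuousAt_extChartAt_symm_of_mem {x x₀ : X}
    (hx : x ∈ (extChartAt 𝓘(ℝ, E) x₀).source) :
    Filter.Tendsto (extChartAt 𝓘(ℝ, E) x₀).symm (𝓝 (extChartAt 𝓘(ℝ, E) x₀ x)) (𝓝 x) := by
  have h := (continuousAt_extChartAt_symm' (I := 𝓘(ℝ, E)) hx).tendsto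
  rwa [(extChartAt 𝓘(ℝ, E) x₀).left_inv hx] at h

theorem SmoothFormAt.congr {φ ψ : X → E →L[ℝ] V} {x : X} (h : SmoothFormAt φ x)
    (hφψ : ∀ᶠ y in 𝓝 x, ψ y = φ y) : SmoothFormAt ψ x := by
  intro x₀ hx
  refine (h x₀ hx).congr_of_eventuallyEq ?_
  filter_upwards [(continuousAt_extChartAt_symm_of_mem hx).eventually hφψ] with y hy
  rw [hy]

theorem smoothFormAt_zero (x : X) : SmoothFormAt (fun _ : X => (0 : E →L[ℝ] V)) x := by
  intro x₀ _
  simpa using contDiffAt_const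

theorem SmoothFormAt.add {φ ψ : X → E →L[ℝ] V} {x : X} (h : SmoothFormAt φ x)
    (h' : SmoothFormAt ψ x) : SmoothFormAt (fun y => φ y + ψ y) x := by
  intro x₀ hx
  simpa only [ContinuousLinearMap.add_comp] using (h x₀ hx).add (h' x₀ hx)

theorem SmoothFormAt.sum {ι : Type*} (s : Finset ι) {φ : ι → X → E →L[ℝ] V} {x : X}
    (h : ∀ i ∈ s, SmoothFormAt (φ i) x) : SmoothFormAt (fun y => ∑ i ∈ s, φ i y) x := by
  classical
  induction s using Finset.induction_on with
  | empty => simpa using smoothFormAt_zero x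
  | insert i s hi ih =>
    simp only [Finset.sum_insert hi]
    exact (h i (by simp)).add (ih fun j hj => h j (by simp [hj]))

variable [IsManifold 𝓘(ℝ, E) ∞ X]

theorem contMDiffAt_symm {x x₀ : X} (hx : x ∈ (extChartAt 𝓘(ℝ, E) x₀).source) :
    ContMDiffAt 𝓘(ℝ, E) 𝓘(ℝ, E) ∞ (extChartAt 𝓘(ℝ, E) x₀).symm (extChartAt 𝓘(ℝ, E) x₀ x) :=
  (contMDiffOn_extChartAt_symm x₀).contMDiffAt
    (extChartAt_target_mem_nhds' (PartialEquiv.map_source _ hx))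

theorem SmoothFormAt.smul {φ : X → E →L[ℝ] V} {f : X → ℝ} {x : X} (h : SmoothFormAt φ x)
    (hf : ContMDiffAt 𝓘(ℝ, E) 𝓘(ℝ, ℝ) ∞ f x) : SmoothFormAt (fun y => f y • φ y) x := by
  intro x₀ hx
  have h1 : ContMDiffAt 𝓘(ℝ, E) 𝓘(ℝ, ℝ) ∞ (fun y => f ((extChartAt 𝓘(ℝ, E) x₀).symm y))
      (extChartAt 𝓘(ℝ, E) x₀ x) := by
    refine ContMDiffAt.comp _ ?_ (contMDiffAt_symm hx)
    rwa [(extChartAt 𝓘(ℝ, E) x₀).left_inv hx]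
  simp only [ContinuousLinearMap.smul_comp]
  exact h1.contDiffAt.smul (h x₀ hx)

/-- A locally finite combination of one-forms is smooth, if every form is smooth where its
coefficient does not vanish. -/
theorem SmoothFormAt.finsum {ι : Type*} {φ : ι → X → E →L[ℝ] V} {f : ι → X → ℝ} {x : X}
    (s : Finset ι) (hs : ∀ᶠ y in 𝓝 x, ∀ i ∉ s, f i y = 0)
    (hf : ∀ i, ContMDiffAt 𝓘(ℝ, E) 𝓘(ℝ, ℝ) ∞ (f i) x)
    (hφ : ∀ i, SmoothFormAt (φ i) x ∨ ∀ᶠ y in 𝓝 x, f i y = 0) :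
    SmoothFormAt (fun y => ∑ᶠ i, f i y • φ i y) x := by
  have h : SmoothFormAt (fun y => ∑ i ∈ s, f i y • φ i y) x := by
    refine SmoothFormAt.sum s fun i _ => ?_
    rcases hφ i with hi | hi
    · exact hi.smul (hf i)
    · refine (smoothFormAt_zero x).congr ?_
      filter_upwards [hi] with y hy
      simp [hy]
  refine h.congr ?_
  filter_upwards [hs] with y hy
  refine finsum_eq_sum_of_support_subset _ fun i hi => ?_
  by_contra hi'
  exact hi (by simp [hy i hi'])

variable {EG G : Type*} [NormedAddCommGroup EG] [NormedSpace ℝ EG]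
  [TopologicalSpace G] [ChartedSpace EG G] [IsManifold 𝓘(ℝ, EG) ∞ G]

/-- The derivative in the second variable, along the diagonal, of a smooth map which is constant
on the diagonal, is a smooth one-form. -/
theorem smoothFormAt_der_snd {C : X → X → G} {e : G} {x : X}
    (hC : ContMDiffAt (𝓘(ℝ, E).prod 𝓘(ℝ, E)) 𝓘(ℝ, EG) ∞ (fun z : X × X => C z.1 z.2) (x, x))
    (he : ∀ᶠ y in 𝓝 x, C y y = e) :
    SmoothFormAt (fun y => der 𝓘(ℝ, E) 𝓘(ℝ, EG) (C y) y) x := by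
  intro x₀ hx
  set c := (extChartAt 𝓘(ℝ, E) x₀).symm with hc
  set y₀ := extChartAt 𝓘(ℝ, E) x₀ x with hy₀
  have hcy : c y₀ = x := (extChartAt 𝓘(ℝ, E) x₀).left_inv hx
  have hcs : ContMDiffAt 𝓘(ℝ, E) 𝓘(ℝ, E) ∞ c y₀ := contMDiffAt_symm hx
  have hC' : ContMDiffAt 𝓘(ℝ, E × E) 𝓘(ℝ, EG) ∞ (fun z : E × E => C (c z.1) (c z.2)) (y₀, y₀) := by
    have h1 : ContMDiffAt 𝓘(ℝ, E × E) (𝓘(ℝ, E).prod 𝓘(ℝ, E)) ∞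
        (fun z : E × E => (c z.1, c z.2)) (y₀, y₀) :=
      (ContMDiffAt.comp (y₀, y₀) (g := c) (f := Prod.fst) hcs contDiff_fst.contDiffAt.contMDiffAt).prodMk
        (ContMDiffAt.comp (y₀, y₀) (g := c) (f := Prod.snd) hcs contDiff_snd.contDiffAt.contMDiffAt)
    exact ContMDiffAt.comp_of_eq (g := fun z : X × X => C z.1 z.2) hC h1 (by simp [hcy])
  have hee : C x x = e := he.self_of_nhds
  -- Near `x` the map takes the value `e` along the diagonal, so the single chart of `G` at `e`
  -- computes all the derivatives involved. Joint smoothness in that chart then gives smooth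
  -- dependence on the base point.
  have hF : ContDiffAt ℝ ∞ (Function.uncurry fun y z : E => extChartAt 𝓘(ℝ, EG) e (C (c y) (c z)))
      (y₀, y₀) := by
    rw [← contMDiffAt_iff_contDiffAt]
    refine ContMDiffAt.comp_of_eq (g := extChartAt 𝓘(ℝ, EG) e) (y := e)
      contMDiffAt_extChartAt hC' ?_
    simp [hcy, hee]
  have hD : ContDiffAt ℝ ∞ (fun y => fderiv ℝ
      (fun z : E => extChartAt 𝓘(ℝ, EG) e (C (c y) (c z))) y) y₀ :=
    hF.fderiv contDiffAt_id (by simp)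
  refine hD.congr_of_eventuallyEq ?_
  have htend : Filter.Tendsto c (𝓝 y₀) (𝓝 x) := continuousAt_extChartAt_symm_of_mem hx
  have hev : ∀ᶠ z in 𝓝 (x, x), MDifferentiableAt (𝓘(ℝ, E).prod 𝓘(ℝ, E)) 𝓘(ℝ, EG)
      (fun z : X × X => C z.1 z.2) z := by
    have := (contMDiffAt_iff_contMDiffAt_nhds (by simp)).1
      (hC.of_le (m := 1) (by exact_mod_cast le_top))
    filter_upwards [this] with z hz using hz.mdifferentiableAt (by simp)
  have hev1 : ∀ᶠ y in 𝓝 x, MDifferentiableAt (𝓘(ℝ, E).prod 𝓘(ℝ, E)) 𝓘(ℝ, EG)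
      (fun z : X × X => C z.1 z.2) (y, y) :=
    (Continuous.tendsto' (by fun_prop : Continuous fun y : X => (y, y)) x (x, x) rfl).eventually hev
  have hev2 : ∀ᶠ y in 𝓝 y₀, MDifferentiableAt 𝓘(ℝ, E) 𝓘(ℝ, E) c y := by
    have := (contMDiffAt_iff_contMDiffAt_nhds (by simp)).1
      (hcs.of_le (m := 1) (by exact_mod_cast le_top))
    filter_upwards [this] with z hz using hz.mdifferentiableAt (by simp)
  filter_upwards [htend.eventually he, htend.eventually hev1, hev2] with y h1 h2 h3
  have h4 : MDifferentiableAt 𝓘(ℝ, E) 𝓘(ℝ, EG) (C (c y)) (c y) :=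
    h2.comp (c y) (mdifferentiableAt_const.prodMk mdifferentiableAt_id)
  rw [← der_comp (g := C (c y)) (f := c) h4 h3]
  have h5 : MDifferentiableAt 𝓘(ℝ, E) 𝓘(ℝ, EG) (fun z => C (c y) (c z)) y := h4.comp y h3
  have h6 := h5.mfderiv
  simp only [mfld_simps, fderivWithin_univ] at h6
  refine Eq.trans h6 ?_
  simp only [mfld_simps, h1, Function.comp_def]
  rfl

end OneForms

/-! ### Slices for free and proper actions -/

section ImplicitFunction

variable {E₁ E₂ F : Type*} [NormedAddCommGroup E₁] [NormedSpace ℝ E₁] [CompleteSpace E₁]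
  [NormedAddCommGroup E₂] [NormedSpace ℝ E₂] [CompleteSpace E₂]
  [NormedAddCommGroup F] [NormedSpace ℝ F] [CompleteSpace F]

/-- The implicit function theorem, with smoothness of the implicit function near the base point. -/
theorem exists_smooth_implicitFunction {f : E₁ × E₂ → F} {u : E₁ × E₂}
    (hf : ∀ᶠ v in 𝓝 u, ContDiffAt ℝ ∞ f v)
    (hinv : (fderiv ℝ f u ∘L .inr ℝ E₁ E₂).IsInvertible) :
    ∃ ψ : E₁ → E₂, ψ u.1 = u.2 ∧ (∀ᶠ y in 𝓝 u.1, ContDiffAt ℝ ∞ ψ y) ∧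
      ∀ᶠ v in 𝓝 u, (f v = f u ↔ ψ v.1 = v.2) := by
  have hfu := hf.self_of_nhds
  have hne : (∞ : WithTop ℕ∞) ≠ 0 := by simp
  set ψ := hfu.implicitFunction hne hinv with hψ
  have hψu : ψ u.1 = u.2 := hfu.implicitFunction_apply_self hne hinv
  have hψs : ContDiffAt ℝ ∞ ψ u.1 := hfu.contDiffAt_implicitFunction hne hinv
  have hψiff : ∀ᶠ v in 𝓝 u, (f v = f u ↔ ψ v.1 = v.2) :=
    hfu.eventually_apply_eq_iff_implicitFunction hne hinv
  refine ⟨ψ, hψu, ?_, hψiff⟩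
  -- Smoothness of order `∞` at one point does not by itself spread to a neighbourhood. At a nearby
  -- point `(y, ψ y)` of the graph the partial derivative is still invertible, so the implicit
  -- function theorem applies there again, and uniqueness identifies its solution with `ψ` near `y`.
  have hψc : ∀ᶠ y in 𝓝 u.1, ContinuousAt ψ y := by
    have := (hψs.of_le (m := 1) (by exact_mod_cast le_top)).eventually (by simp)
    filter_upwards [this] with y hy using hy.continuousAt
  have hinv' : ∀ᶠ v in 𝓝 u, (fderiv ℝ f v ∘L .inr ℝ E₁ E₂).IsInvertible := by
    have hc : ContinuousAt (fun v => fderiv ℝ f v ∘L .inr ℝ E₁ E₂) u :=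
      (hfu.fderiv_right (m := 0) (by simp)).continuousAt.clm_comp continuousAt_const
    exact hc.eventually (ContinuousLinearEquiv.isOpen.mem_nhds hinv)
  have hgraph : Filter.Tendsto (fun y => (y, ψ y)) (𝓝 u.1) (𝓝 u) := by
    have h := (continuousAt_id (x := u.1)).prodMk hψs.continuousAt
    unfold ContinuousAt at h
    simpa [hψu] using h
  filter_upwards [hgraph.eventually hf, hgraph.eventually hinv', hψc,
    hgraph.eventually hψiff.eventually_nhds] with y h1 h2 h3 h4
  have h5 : f (y, ψ y) = f u := h4.self_of_nhds.2 rfl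
  refine (h1.contDiffAt_implicitFunction hne h2).congr_of_eventuallyEq ?_
  have h6 := h1.eventually_apply_eq_iff_implicitFunction hne h2
  have h7 : Filter.Tendsto (fun y => (y, ψ y)) (𝓝 y) (𝓝 (y, ψ y)) :=
    continuousAt_id.prodMk h3
  filter_upwards [h7.eventually h4, h7.eventually h6] with z h8 h9
  exact (h9.1 ((h8.2 rfl).trans h5.symm)).symm

end ImplicitFunction

/-! ### Curves with vanishing derivative. -/

section Curves

variable {E X : Type*} [NormedAddCommGroup E] [NormedSpace ℝ E] [TopologicalSpace X]
  [ChartedSpace E X]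

theorem der_eq_fderiv {E' Y : Type*} [NormedAddCommGroup E'] [NormedSpace ℝ E']
    [TopologicalSpace Y] [ChartedSpace E' Y] {f : X → Y} {x : X} {y : Y}
    (hf : MDifferentiableAt 𝓘(ℝ, E) 𝓘(ℝ, E') f x) (hy : f x = y) :
    der 𝓘(ℝ, E) 𝓘(ℝ, E') f x = fderiv ℝ (fun z => extChartAt 𝓘(ℝ, E') y
      (f ((extChartAt 𝓘(ℝ, E) x).symm z))) (extChartAt 𝓘(ℝ, E) x x) := by
  subst hy
  have h := hf.mfderiv
  simp only [mfld_simps, fderivWithin_univ] at h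
  exact h

/-- In the chart at `c t₀` the curve has zero derivative on a ball, which is connected, hence it is
constant there; injectivity of the chart carries this back. It serves to show that orbit maps are
immersions. -/
theorem eventually_eq_of_der_eq_zero [IsManifold 𝓘(ℝ, E) ∞ X] {c : ℝ → X} {t₀ : ℝ}
    (hc : ∀ᶠ t in 𝓝 t₀, MDifferentiableAt 𝓘(ℝ, ℝ) 𝓘(ℝ, E) c t ∧ der 𝓘(ℝ, ℝ) 𝓘(ℝ, E) c t = 0) :
    ∀ᶠ t in 𝓝 t₀, c t = c t₀ := by
  set e := extChartAt 𝓘(ℝ, E) (c t₀) with he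
  have hcont : ContinuousAt c t₀ := hc.self_of_nhds.1.continuousAt
  have hsrc : ∀ᶠ t in 𝓝 t₀, c t ∈ e.source :=
    hcont.eventually (extChartAt_source_mem_nhds (I := 𝓘(ℝ, E)) (c t₀))
  obtain ⟨ε, hε, hball⟩ := Metric.eventually_nhds_iff_ball.1 (hc.and hsrc)
  have hder : ∀ t ∈ Metric.ball t₀ ε, DifferentiableAt ℝ (fun t => e (c t)) t ∧
      fderiv ℝ (fun t => e (c t)) t = 0 := by
    intro t ht
    obtain ⟨⟨h1, h2⟩, h3⟩ := hball t ht
    have h4 : MDifferentiableAt 𝓘(ℝ, E) 𝓘(ℝ, E) e (c t) :=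
      mdifferentiableAt_extChartAt (by simpa [e] using h3)
    have h5 := der_comp (J' := 𝓘(ℝ, E)) h4 h1
    rw [h2, ContinuousLinearMap.comp_zero] at h5
    refine ⟨(h4.comp t h1).differentiableAt, ?_⟩
    rw [← mfderiv_eq_fderiv]
    exact h5
  filter_upwards [Metric.ball_mem_nhds t₀ hε] with t ht
  have h := Metric.isOpen_ball.is_const_of_fderiv_eq_zero (𝕜 := ℝ) (f := fun t => e (c t))
    (convex_ball t₀ ε).isPreconnected (fun t ht => (hder t ht).1.differentiableWithinAt)
    (fun t ht => (hder t ht).2) ht (Metric.mem_ball_self hε)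
  exact e.injOn (hball t ht).2 (hball t₀ (Metric.mem_ball_self hε)).2 h

end Curves

/-! ### Free and proper actions: slices and invariant bump functions. -/

section Actions

variable {E EG X G : Type*}
  [NormedAddCommGroup E] [NormedSpace ℝ E] [TopologicalSpace X] [ChartedSpace E X]
  [NormedAddCommGroup EG] [NormedSpace ℝ EG] [TopologicalSpace G] [ChartedSpace EG G] [Group G]

variable (E EG) in
/-- A free and proper smooth right action. -/
structure IsFreeProperAction (R : X × G → X) : Prop where
  smooth : ContMDiff (𝓘(ℝ, E).prod 𝓘(ℝ, EG)) 𝓘(ℝ, E) ∞ R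
  one : ∀ x, R (x, 1) = x
  mul : ∀ x g g', R (R (x, g), g') = R (x, g * g')
  free : ∀ x g, R (x, g) = x → g = 1
  proper : IsProperMap (fun z : X × G => (z.1, R z))

namespace IsFreeProperAction

variable {R : X × G → X}

theorem smooth_left (hR : IsFreeProperAction E EG R) (g : G) : ContMDiff 𝓘(ℝ, E) 𝓘(ℝ, E) ∞ (fun x => R (x, g)) :=
  hR.smooth.comp (contMDiff_id.prodMk contMDiff_const)

theorem smooth_orbit (hR : IsFreeProperAction E EG R) (x : X) : ContMDiff 𝓘(ℝ, EG) 𝓘(ℝ, E) ∞ (fun g => R (x, g)) :=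
  hR.smooth.comp (contMDiff_const.prodMk contMDiff_id)

theorem mul_inv_cancel (hR : IsFreeProperAction E EG R) (x : X) (g : G) : R (R (x, g), g⁻¹) = x := by
  rw [hR.mul, _root_.mul_inv_cancel, hR.one]

theorem inv_mul_cancel (hR : IsFreeProperAction E EG R) (x : X) (g : G) : R (R (x, g⁻¹), g) = x := by
  rw [hR.mul, _root_.inv_mul_cancel, hR.one]

/-- Small neighbourhoods only meet their translates by group elements close to the unit. -/
theorem exists_nhds_translate (hR : IsFreeProperAction E EG R) (x : X) {N : Set G} (hN : N ∈ 𝓝 (1 : G)) :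
    ∃ A ∈ 𝓝 x, ∀ y ∈ A, ∀ g, R (y, g) ∈ A → g ∈ N := by
  set θ : X × G → X × X := fun z => (z.1, R z)
  -- Properness makes the set of pairs related by an element outside the interior of `N` closed. By
  -- freeness it misses `(x, x)`, hence also some square `A ×ˢ A`.
  have hcl : IsClosed (θ '' {z | z.2 ∉ interior N}) :=
    hR.proper.isClosedMap _ (isOpen_interior.isClosed_compl.preimage continuous_snd)
  have hmem : (x, x) ∈ (θ '' {z | z.2 ∉ interior N})ᶜ := by
    rintro ⟨⟨y, g⟩, hg, hyg⟩
    simp only [θ, Prod.mk.injEq] at hyg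
    obtain ⟨rfl, h⟩ := hyg
    rw [hR.free _ _ h] at hg
    exact hg (mem_interior_iff_mem_nhds.2 hN)
  have hnhds := hcl.isOpen_compl.mem_nhds hmem
  rw [nhds_prod_eq, Filter.mem_prod_same_iff] at hnhds
  obtain ⟨A, hA, hsub⟩ := hnhds
  refine ⟨A, hA, fun y hy g hg => ?_⟩
  by_contra hgN
  exact hsub (Set.mk_mem_prod hy hg) ⟨(y, g), fun h => hgN (interior_subset h), rfl⟩

/-- The saturation of a compact set is closed. -/
theorem isClosed_saturation [T2Space X] (hR : IsFreeProperAction E EG R) {K : Set X} (hK : IsCompact K) :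
    IsClosed {y : X | ∃ x ∈ K, ∃ g, R (x, g) = y} := by
  set θ : X × G → X × X := fun z => (z.1, R z)
  have hcl : IsClosed (θ '' (K ×ˢ Set.univ)) :=
    hR.proper.isClosedMap _ (hK.isClosed.prod isClosed_univ)
  have : CompactSpace K := isCompact_iff_compactSpace.1 hK
  have hcl' : IsClosed ((fun z : K × X => ((z.1 : X), z.2)) ⁻¹' (θ '' (K ×ˢ Set.univ))) :=
    hcl.preimage (by fun_prop)
  -- The saturation is the projection of a closed subset of `K × X` along the compact factor.
  convert isClosedMap_snd_of_compactSpace _ hcl' using 1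
  ext y
  simp only [θ, Set.mem_ofPred_eq, Set.mem_image, Set.mem_preimage, Set.mem_prod, Set.mem_univ,
    and_true, Prod.exists, Prod.mk.injEq, exists_eq_right, Subtype.exists]
  constructor
  · rintro ⟨x, hx, g, rfl⟩
    exact ⟨x, hx, x, g, hx, rfl, rfl⟩
  · rintro ⟨_, _, x, g, hx, rfl, h⟩
    exact ⟨x, hx, g, h⟩

variable [IsManifold 𝓘(ℝ, E) ∞ X] [LieGroup 𝓘(ℝ, EG) ∞ G]

/-- The orbit maps of a free action are immersions. -/
theorem der_orbit_injective [CompleteSpace EG] (hR : IsFreeProperAction E EG R) (x : X) :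
    Function.Injective (der 𝓘(ℝ, EG) 𝓘(ℝ, E) (fun g => R (x, g)) 1) := by
  rw [injective_iff_map_eq_zero]
  intro v hv
  have : LieGroup 𝓘(ℝ, EG) (minSmoothness ℝ 3) G :=
    LieGroup.of_le (n := ∞) (by
      simp only [minSmoothness_of_isRCLikeNormedField]; exact WithTop.coe_le_coe.2 (le_top : (3 : ℕ∞) ≤ ⊤))
  have hvf := contMDiff_mulInvariantVectorField (I := 𝓘(ℝ, EG)) (G := G) v
  obtain ⟨γ, hγ0, hγ⟩ := exists_isMIntegralCurveAt_of_contMDiffAt_boundaryless (t₀ := 0)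
    (hvf.contMDiffAt (x := (1 : G)) |>.of_le (m := 1) (by
      simp [minSmoothness_of_isRCLikeNormedField]))
  -- The integral curve `γ` belongs to a left-invariant field, whereas `R` is a right action. With
  -- the inverse inserted, `R (x, (γ t * k)⁻¹)` is the translate by `(γ t)⁻¹` of `R (x, k⁻¹)`, so
  -- the derivative of `R (x, (γ t)⁻¹)` factors through the vanishing derivative at the unit. The
  -- curve is thus constant, freeness forces `γ = 1` near 0, and `v = 0`.
  have hφ : ContMDiff 𝓘(ℝ, EG) 𝓘(ℝ, E) ∞ (fun g : G => R (x, g⁻¹)) :=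
    (hR.smooth_orbit x).comp (contMDiff_inv 𝓘(ℝ, EG) ∞)
  have hφ1 : der 𝓘(ℝ, EG) 𝓘(ℝ, E) (fun g : G => R (x, g⁻¹)) 1 v = 0 := by
    rw [der_comp_of_eq (g := fun g : G => R (x, g)) (y := 1)
      (mdiffAt (hR.smooth_orbit x).contMDiffAt)
      (mdiffAt (contMDiff_inv 𝓘(ℝ, EG) ∞).contMDiffAt) inv_one,
      der_inv (u := fun g : G => g) mdifferentiableAt_id rfl, der_id]
    simp [hv]
  have hconst : ∀ᶠ t in 𝓝 (0 : ℝ), R (x, (γ t)⁻¹) = R (x, (γ 0)⁻¹) := by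
    refine eventually_eq_of_der_eq_zero (E := E) (c := fun t => R (x, (γ t)⁻¹)) ?_
    filter_upwards [hγ] with t ht
    have hd := ht.mdifferentiableAt
    refine ⟨(mdiffAt hφ.contMDiffAt).comp t hd, ?_⟩
    rw [der_comp (g := fun g : G => R (x, g⁻¹)) (mdiffAt hφ.contMDiffAt) hd]
    have hγt : der 𝓘(ℝ, ℝ) 𝓘(ℝ, EG) γ t = (1 : ℝ →L[ℝ] ℝ).smulRight
        (der 𝓘(ℝ, EG) 𝓘(ℝ, EG) (fun k : G => γ t * k) 1 v) := ht.mfderiv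
    rw [hγt]
    ext
    have h1 : der 𝓘(ℝ, EG) 𝓘(ℝ, E) (fun k : G => R (x, (γ t * k)⁻¹)) 1 =
        (der 𝓘(ℝ, EG) 𝓘(ℝ, E) (fun g : G => R (x, g⁻¹)) (γ t)).comp
          (der 𝓘(ℝ, EG) 𝓘(ℝ, EG) (fun k : G => γ t * k) 1) :=
      der_comp_of_eq (g := fun g : G => R (x, g⁻¹)) (mdiffAt hφ.contMDiffAt)
        (mdiffAt contMDiff_mul_left.contMDiffAt) (mul_one _)
    have h2 : der 𝓘(ℝ, EG) 𝓘(ℝ, E) (fun k : G => R (x, (γ t * k)⁻¹)) 1 =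
        (der 𝓘(ℝ, E) 𝓘(ℝ, E) (fun y => R (y, (γ t)⁻¹)) (R (x, 1⁻¹))).comp
          (der 𝓘(ℝ, EG) 𝓘(ℝ, E) (fun k : G => R (x, k⁻¹)) 1) := by
      rw [← der_comp (g := fun y => R (y, (γ t)⁻¹)) (f := fun k : G => R (x, k⁻¹))
        (mdiffAt (hR.smooth_left _).contMDiffAt) (mdiffAt hφ.contMDiffAt)]
      simp only [hR.mul, mul_inv_rev]
    have h3 := congrArg (fun A : EG →L[ℝ] E => A v) (h1.symm.trans h2)
    simp only [ContinuousLinearMap.comp_apply, hφ1, map_zero] at h3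
    simp [h3]
  have hγ1 : γ =ᶠ[𝓝 0] fun _ => 1 := by
    filter_upwards [hconst] with t ht
    rw [hγ0, inv_one, hR.one] at ht
    exact inv_eq_one.1 (hR.free _ _ ht)
  have h0 := hγ.self_of_nhds
  have h1 : der 𝓘(ℝ, ℝ) 𝓘(ℝ, EG) γ 0 = (1 : ℝ →L[ℝ] ℝ).smulRight
        (der 𝓘(ℝ, EG) 𝓘(ℝ, EG) (fun k : G => γ 0 * k) 1 v) := h0.mfderiv
  rw [der_congr hγ1, der_const, hγ0] at h1
  simp only [one_mul, der_id] at h1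
  simpa using (congrArg (fun A : ℝ →L[ℝ] EG => A 1) h1).symm

/-- Near a point `x₀` there is a function `k` moving points into the zero set of `f`. -/
theorem exists_local_slice [FiniteDimensional ℝ E] [FiniteDimensional ℝ EG]
    (hR : IsFreeProperAction E EG R) (x₀ : X) :
    ∃ (f : X → EG) (k : X → G) (N : Set G), N ∈ 𝓝 (1 : G) ∧ f x₀ = 0 ∧
      (∀ᶠ x in 𝓝 x₀, ContMDiffAt 𝓘(ℝ, E) 𝓘(ℝ, EG) ∞ k x) ∧ k x₀ = 1 ∧
      ∀ᶠ x in 𝓝 x₀, ∀ g ∈ N, (f (R (x, g)) = 0 ↔ k x = g) := by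
  have : CompleteSpace E := FiniteDimensional.complete ℝ E
  have : CompleteSpace EG := FiniteDimensional.complete ℝ EG
  set e := extChartAt 𝓘(ℝ, E) x₀ with he
  set c := extChartAt 𝓘(ℝ, EG) (1 : G) with hc
  have hA : Function.Injective (fderiv ℝ (fun z => e (R (x₀, c.symm z))) (c 1)) := by
    have h := hR.der_orbit_injective x₀
    rwa [der_eq_fderiv (mdiffAt (hR.smooth_orbit x₀).contMDiffAt) (hR.one x₀)] at h
  -- A left inverse of the derivative of the orbit map makes the zero set of `f` transverse to the
  -- orbit: in coordinates, `g ↦ f (R (x₀, g))` has the identity as its derivative at the unit. So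
  -- `f (R (x, g)) = 0` can be solved for `g`.
  obtain ⟨ℓ, hℓ⟩ := LinearMap.exists_leftInverse_of_injective
    (fderiv ℝ (fun z => e (R (x₀, c.symm z))) (c 1)).toLinearMap
    (LinearMap.ker_eq_bot.2 hA)
  set ℓ' : E →L[ℝ] EG := ℓ.toContinuousLinearMap with hℓ'
  set f : X → EG := fun x => ℓ' (e x - e x₀) with hf
  set F : E × EG → EG := fun z => f (R (e.symm z.1, c.symm z.2)) with hF
  have hx₀ : x₀ ∈ e.source := mem_extChartAt_source x₀
  have h1c : (1 : G) ∈ c.source := mem_extChartAt_source 1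
  have hex : e.symm (e x₀) = x₀ := e.left_inv hx₀
  have hc1 : c.symm (c 1) = 1 := c.left_inv h1c
  have hprod : ∀ z : E × EG, z.1 ∈ e.target → z.2 ∈ c.target →
      ContMDiffAt 𝓘(ℝ, E × EG) (𝓘(ℝ, E).prod 𝓘(ℝ, EG)) ∞
        (fun z : E × EG => (e.symm z.1, c.symm z.2)) z := by
    intro z h1 h2
    have h3 : ContMDiffAt 𝓘(ℝ, E) 𝓘(ℝ, E) ∞ e.symm z.1 :=
      (contMDiffOn_extChartAt_symm x₀).contMDiffAt ((isOpen_extChartAt_target x₀).mem_nhds h1)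
    have h4 : ContMDiffAt 𝓘(ℝ, EG) 𝓘(ℝ, EG) ∞ c.symm z.2 :=
      (contMDiffOn_extChartAt_symm (1 : G)).contMDiffAt
        ((isOpen_extChartAt_target (1 : G)).mem_nhds h2)
    exact (ContMDiffAt.comp z (g := e.symm) (f := Prod.fst) h3
        contDiff_fst.contDiffAt.contMDiffAt).prodMk
      (ContMDiffAt.comp z (g := c.symm) (f := Prod.snd) h4 contDiff_snd.contDiffAt.contMDiffAt)
  have hu1 : e x₀ ∈ e.target := e.map_source hx₀
  have hu2 : c 1 ∈ c.target := c.map_source h1c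
  have htar : ∀ᶠ z in 𝓝 ((e x₀, c 1) : E × EG), z.1 ∈ e.target ∧ z.2 ∈ c.target :=
    ((isOpen_extChartAt_target x₀).prod (isOpen_extChartAt_target (1 : G))).mem_nhds ⟨hu1, hu2⟩
  have hsrc : ∀ᶠ z in 𝓝 ((e x₀, c 1) : E × EG), R (e.symm z.1, c.symm z.2) ∈ e.source := by
    have h := (hR.smooth.continuous.continuousAt.comp
      (hprod (e x₀, c 1) hu1 hu2).continuousAt :
      ContinuousAt (fun z : E × EG => R (e.symm z.1, c.symm z.2)) (e x₀, c 1))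
    refine h.eventually_mem ?_
    change e.source ∈ 𝓝 (R (e.symm (e x₀), c.symm (c 1)))
    rw [hex, hc1, hR.one]
    exact extChartAt_source_mem_nhds (I := 𝓘(ℝ, E)) x₀
  have hFs : ∀ᶠ z in 𝓝 ((e x₀, c 1) : E × EG), ContDiffAt ℝ ∞ F z := by
    filter_upwards [htar, hsrc] with z h1 h2
    rw [← contMDiffAt_iff_contDiffAt]
    have h3 : ContMDiffAt 𝓘(ℝ, E × EG) 𝓘(ℝ, E) ∞
        (fun z : E × EG => e (R (e.symm z.1, c.symm z.2))) z :=
      ContMDiffAt.comp z (g := e) (contMDiffAt_extChartAt' (by simpa [e] using h2))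
        (hR.smooth.contMDiffAt.comp z (hprod z h1.1 h1.2))
    have h4 := h3.contDiffAt
    exact (ℓ'.contDiff.contDiffAt.comp z (h4.sub contDiffAt_const)).contMDiffAt
  have hder : fderiv ℝ F (e x₀, c 1) ∘L .inr ℝ E EG = ContinuousLinearMap.id ℝ EG := by
    have h1 : HasFDerivAt (fun z : EG => ((e x₀, z) : E × EG)) (.inr ℝ E EG) (c 1) :=
      hasFDerivAt_prodMk_right _ _
    have h2 := (hFs.self_of_nhds.differentiableAt (by simp)).hasFDerivAt.comp (c 1) h1
    rw [← h2.fderiv]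
    have h3 : DifferentiableAt ℝ (fun z => e (R (x₀, c.symm z))) (c 1) := by
      have h4 : ContMDiffAt 𝓘(ℝ, EG) 𝓘(ℝ, E) ∞ (fun z => e (R (x₀, c.symm z))) (c 1) := by
        refine ContMDiffAt.comp (c 1) (g := e) (contMDiffAt_extChartAt' ?_) ?_
        · rw [hc1, hR.one]; exact mem_chart_source E x₀
        · exact (hR.smooth_orbit x₀).contMDiffAt.comp (c 1) (contMDiffAt_symm h1c)
      exact h4.contDiffAt.differentiableAt (by simp)
    have h5 := ℓ'.hasFDerivAt.comp (c 1) (h3.hasFDerivAt.sub_const (e x₀))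
    have h6 : (F ∘ fun z : EG => ((e x₀, z) : E × EG)) =
        ℓ' ∘ fun z => e (R (x₀, c.symm z)) - e x₀ := by
      funext z
      simp only [hF, hf, Function.comp_apply, hex]
    rw [h6, h5.fderiv]
    ext v
    exact congrArg (fun A : EG →ₗ[ℝ] EG => A v) hℓ
  obtain ⟨ψ, hψ0, hψs, hψ⟩ := exists_smooth_implicitFunction hFs
    (by rw [hder]; exact ⟨ContinuousLinearEquiv.refl ℝ EG, rfl⟩)
  have hF0 : F (e x₀, c 1) = 0 := by simp [hF, hf, hex, hc1, hR.one]
  rw [hF0] at hψ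
  simp only at hψ0 hψs
  have hecont : Filter.Tendsto e (𝓝 x₀) (𝓝 (e x₀)) := continuousAt_extChartAt x₀
  have hccont : Filter.Tendsto c (𝓝 1) (𝓝 (c 1)) := continuousAt_extChartAt (1 : G)
  rw [nhds_prod_eq, Filter.eventually_prod_iff] at hψ
  obtain ⟨pa, hpa, pb, hpb, hab⟩ := hψ
  have hψt : ∀ᶠ y in 𝓝 (e x₀), ψ y ∈ c.target := by
    refine hψs.self_of_nhds.continuousAt.eventually_mem ?_
    rw [hψ0]; exact (isOpen_extChartAt_target (1 : G)).mem_nhds hu2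
  refine ⟨f, fun x => c.symm (ψ (e x)), {g | pb (c g)} ∩ c.source, ?_, by simp [hf], ?_, ?_, ?_⟩
  · exact Filter.inter_mem (hccont.eventually hpb)
      (extChartAt_source_mem_nhds (I := 𝓘(ℝ, EG)) (1 : G))
  · filter_upwards [hecont.eventually hψs, hecont.eventually hψt,
      extChartAt_source_mem_nhds (I := 𝓘(ℝ, E)) x₀] with x h1 h2 h3
    refine ContMDiffAt.comp x (I' := 𝓘(ℝ, EG)) (g := c.symm) ?_ ?_
    · exact (contMDiffOn_extChartAt_symm (1 : G)).contMDiffAt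
        ((isOpen_extChartAt_target (1 : G)).mem_nhds h2)
    · exact h1.contMDiffAt.comp x (contMDiffAt_extChartAt' (by simpa [e] using h3))
  · simp [hψ0, hc1]
  · filter_upwards [hecont.eventually hpa, hecont.eventually hψt,
      extChartAt_source_mem_nhds (I := 𝓘(ℝ, E)) x₀] with x h1 h2 h3 g hg
    have h4 := hab h1 hg.1
    simp only [hF, e.left_inv h3, c.left_inv hg.2] at h4
    rw [h4]
    constructor
    · intro h; rw [h, c.left_inv hg.2]
    · intro h; rw [← h, c.right_inv h2]

/-- A slice through `x₀`, described by an equivariant map `κ` into the group defined on an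
invariant open neighbourhood `V`, such that the slice `κ = 1` is contained in `W`. -/
theorem exists_slice [FiniteDimensional ℝ E] [FiniteDimensional ℝ EG]
    (hR : IsFreeProperAction E EG R) (x₀ : X) {W : Set X} (hW : W ∈ 𝓝 x₀) :
    ∃ (V : Set X) (κ : X → G), IsOpen V ∧ x₀ ∈ V ∧ (∀ x ∈ V, ∀ g, R (x, g) ∈ V) ∧
      ContMDiffOn 𝓘(ℝ, E) 𝓘(ℝ, EG) ∞ κ V ∧ (∀ x ∈ V, ∀ g, κ (R (x, g)) = κ x * g) ∧
      κ x₀ = 1 ∧ ∀ x ∈ V, R (x, (κ x)⁻¹) ∈ W := by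
  obtain ⟨f, k, N, hN, hf0, hks, hk0, hk⟩ := hR.exists_local_slice x₀
  obtain ⟨A, hA, hAN⟩ := hR.exists_nhds_translate x₀ hN
  obtain ⟨B, hBsub, hBo, hxB⟩ := mem_nhds_iff.1
    (Filter.inter_mem (Filter.inter_mem hA hW) (hks.and hk))
  set S : Set X := {x | x ∈ B ∧ f x = 0} with hS
  have h1N : (1 : G) ∈ N := mem_of_mem_nhds hN
  -- Two points of `S` on one orbit lie in `A`, so they differ by an element of `N`. Within `N` the
  -- equation `f (R (x, g)) = 0` forces `g = k x`, and both `g` and `1` solve it.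
  have hkS : ∀ x ∈ S, ∀ g, R (x, g) ∈ S → g = 1 := by
    intro x hx g hg
    have hgN := hAN x (hBsub hx.1).1.1 g (hBsub hg.1).1.1
    have h1 := ((hBsub hx.1).2.2 g hgN).1 hg.2
    have h2 := ((hBsub hx.1).2.2 1 h1N).1 (by rw [hR.one]; exact hx.2)
    rw [← h1, h2]
  have huniq : ∀ x g g', R (x, g⁻¹) ∈ S → R (x, g'⁻¹) ∈ S → g = g' := by
    intro x g g' h1 h2
    have h3 := hkS _ h1 (g * g'⁻¹) (by rw [hR.mul, inv_mul_cancel_left]; exact h2)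
    exact mul_inv_eq_one.1 h3
  -- The points which `k` moves into `S` without leaving `B`. This set is open, so its saturation
  -- `V` is open too, and every orbit in `V` meets `S` exactly once; `κ` records the group element
  -- that leads from there to the given point.
  set B' : Set X := {x | x ∈ B ∧ k x ∈ interior N ∧ R (x, k x) ∈ B} with hB'
  have hkcont : ContinuousOn k B := fun x hx =>
    (hBsub hx).2.1.continuousAt.continuousWithinAt
  have hB'o : IsOpen B' := by
    have h1 : ContinuousOn (fun x => (k x, R (x, k x))) B :=
      hkcont.prodMk (hR.smooth.continuous.comp_continuousOn (continuousOn_id.prodMk hkcont))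
    have h2 := h1.isOpen_inter_preimage hBo (isOpen_interior.prod hBo : IsOpen (interior N ×ˢ B))
    exact h2
  have hxB' : x₀ ∈ B' := by
    refine ⟨hxB, ?_, ?_⟩
    · rw [hk0]; exact mem_interior_iff_mem_nhds.2 hN
    · rw [hk0, hR.one]; exact hxB
  have hB'S : ∀ x ∈ B', R (x, k x) ∈ S := by
    intro x hx
    exact ⟨hx.2.2, ((hBsub hx.1).2.2 _ (interior_subset hx.2.1)).2 rfl⟩
  set V : Set X := {x | ∃ g, R (x, g) ∈ B'} with hV
  have hVS : ∀ x ∈ V, ∃ g : G, R (x, g⁻¹) ∈ S := by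
    rintro x ⟨g, hg⟩
    refine ⟨(g * k (R (x, g)))⁻¹, ?_⟩
    rw [inv_inv, ← hR.mul]
    exact hB'S _ hg
  choose! κ hκ using hVS
  have hVinv : ∀ x ∈ V, ∀ g, R (x, g) ∈ V := by
    rintro x ⟨g', hg'⟩ g
    exact ⟨g⁻¹ * g', by rwa [hR.mul, mul_inv_cancel_left]⟩
  have hVo : IsOpen V := by
    have : V = ⋃ g, (fun x => R (x, g)) ⁻¹' B' := by
      ext x; simp [hV]
    rw [this]
    exact isOpen_iUnion fun g => hB'o.preimage (hR.smooth_left g).continuous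
  have hx₀V : x₀ ∈ V := ⟨1, by rw [hR.one]; exact hxB'⟩
  refine ⟨V, κ, hVo, hx₀V, hVinv, ?_, ?_, ?_, fun x hx => (hBsub (hκ x hx).1).1.2⟩
  · rintro x hx
    obtain ⟨g, hg⟩ := id hx
    have hev : ∀ᶠ y in 𝓝 x, y ∈ V ∧ R (y, g) ∈ B' :=
      Filter.Eventually.and (hVo.mem_nhds hx)
        ((hR.smooth_left g).continuous.continuousAt.eventually_mem (hB'o.mem_nhds hg))
    -- With a fixed `g` moving `x` into `B'`, the uniqueness `huniq` identifies `κ` near `x` with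
    -- this visibly smooth expression.
    have hsm : ContMDiffAt 𝓘(ℝ, E) 𝓘(ℝ, EG) ∞ (fun y => (g * k (R (y, g)))⁻¹) x := by
      have h1 : ContMDiffAt 𝓘(ℝ, E) 𝓘(ℝ, EG) ∞ (fun y => k (R (y, g))) x :=
        ContMDiffAt.comp x (g := k) (hBsub hg.1).2.1 (hR.smooth_left g).contMDiffAt
      exact (contMDiffAt_const.mul h1).inv
    refine (hsm.congr_of_eventuallyEq ?_).contMDiffWithinAt
    filter_upwards [hev] with y hy
    refine huniq y _ _ (hκ y hy.1) ?_
    rw [inv_inv, ← hR.mul]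
    exact hB'S _ hy.2
  · intro x hx g
    refine huniq (R (x, g)) _ _ (hκ _ (hVinv x hx g)) ?_
    rw [hR.mul, mul_inv_rev, mul_inv_cancel_left]
    exact hκ x hx
  · refine huniq x₀ _ _ (hκ _ hx₀V) ?_
    rw [inv_one, hR.one]
    exact ⟨hxB, hf0⟩

/-- Slices together with an invariant bump function. -/
theorem exists_slice_bump [FiniteDimensional ℝ E] [FiniteDimensional ℝ EG] [T2Space X]
    (hR : IsFreeProperAction E EG R) (x₀ : X) {W : Set X} (hW : W ∈ 𝓝 x₀) :
    ∃ (V : Set X) (κ : X → G) (f : X → ℝ), IsOpen V ∧ (∀ x ∈ V, ∀ g, R (x, g) ∈ V) ∧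
      ContMDiffOn 𝓘(ℝ, E) 𝓘(ℝ, EG) ∞ κ V ∧ (∀ x ∈ V, ∀ g, κ (R (x, g)) = κ x * g) ∧
      (∀ x ∈ V, R (x, (κ x)⁻¹) ∈ W) ∧ ContMDiff 𝓘(ℝ, E) 𝓘(ℝ, ℝ) ∞ f ∧ (∀ x, 0 ≤ f x) ∧
      (∀ x g, f (R (x, g)) = f x) ∧ 0 < f x₀ ∧ ∀ x ∉ V, ∀ᶠ y in 𝓝 x, f y = 0 := by
  classical
  obtain ⟨V, κ, hVo, hxV, hVinv, hκs, hκ, hκ0, hκW⟩ := hR.exists_slice x₀ hW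
  obtain ⟨b, -, hb⟩ := (SmoothBumpFunction.nhds_basis_tsupport (I := 𝓘(ℝ, E)) x₀).mem_iff.1
    (hVo.mem_nhds hxV)
  -- The function defined next vanishes off the saturation of the support of `b`, which is closed by
  -- properness and contained in `V`. Hence its extension by zero is smooth also at the boundary of
  -- `V`.
  have hKcl := hR.isClosed_saturation b.hasCompactSupport.isCompact
  set f : X → ℝ := fun x => if x ∈ V then b (R (x, (κ x)⁻¹)) else 0 with hf
  have hf0 : ∀ x, x ∉ {y : X | ∃ x ∈ tsupport b, ∃ g, R (x, g) = y} → f x = 0 := by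
    intro x hx
    simp only [hf]
    split_ifs with hxV
    · by_contra h
      exact hx ⟨_, subset_tsupport _ h, κ x, hR.inv_mul_cancel x (κ x)⟩
    · rfl
  have hKV : {y : X | ∃ x ∈ tsupport b, ∃ g, R (x, g) = y} ⊆ V := by
    rintro _ ⟨x, hx, g, rfl⟩
    exact hVinv x (hb hx) g
  have hfV : ∀ x ∉ V, ∀ᶠ y in 𝓝 x, f y = 0 := by
    intro x hx
    filter_upwards [hKcl.isOpen_compl.mem_nhds fun h => hx (hKV h)] with y hy using hf0 y hy
  refine ⟨V, κ, f, hVo, hVinv, hκs, hκ, hκW, ?_, ?_, ?_, ?_, hfV⟩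
  · intro x
    by_cases hx : x ∈ V
    · have hκx : ContMDiffAt 𝓘(ℝ, E) 𝓘(ℝ, EG) ∞ κ x := hκs.contMDiffAt (hVo.mem_nhds hx)
      have h1 : ContMDiffAt 𝓘(ℝ, E) 𝓘(ℝ, ℝ) ∞ (fun x => b (R (x, (κ x)⁻¹))) x :=
        ContMDiffAt.comp x (g := b) b.contMDiffAt
          (hR.smooth.contMDiffAt.comp x (contMDiffAt_id.prodMk hκx.inv))
      refine h1.congr_of_eventuallyEq ?_
      filter_upwards [hVo.mem_nhds hx] with y hy
      simp [hf, hy]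
    · exact contMDiffAt_const.congr_of_eventuallyEq (hfV x hx)
  · intro x
    simp only [hf]
    split_ifs
    · exact b.nonneg
    · exact le_rfl
  · intro x g
    by_cases hx : x ∈ V
    · simp only [hf, hx, hVinv x hx g, if_true, hκ x hx g]
      rw [hR.mul, mul_inv_rev, mul_inv_cancel_left]
    · have hx' : R (x, g) ∉ V := fun h => hx (by
        simpa only [hR.mul_inv_cancel] using hVinv _ h g⁻¹)
      simp [hf, hx, hx']
  · simp only [hf, hxV, if_true, hκ0, inv_one, hR.one, b.eq_one, zero_lt_one]

end IsFreeProperAction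

end Actions

/-! ### Partitions of unity built from countably many functions -/

section Weights

variable {E X : Type*} [NormedAddCommGroup E] [NormedSpace ℝ E] [TopologicalSpace X]
  [ChartedSpace E X]

/-- Smooth nonnegative functions `f n` without common zero on `O` give rise to a smooth locally
finite partition of unity on `O`, whose members are functions of the `f n`. -/
theorem exists_weights {f : ℕ → X → ℝ} (hf : ∀ n, ContMDiff 𝓘(ℝ, E) 𝓘(ℝ, ℝ) ∞ (f n))
    (hf0 : ∀ n x, 0 ≤ f n x) {O : Set X} (hO : ∀ x ∈ O, ∃ n, 0 < f n x) :
    ∃ χ : ℕ → X → ℝ, (∀ x ∈ O, ∀ n, ContMDiffAt 𝓘(ℝ, E) 𝓘(ℝ, ℝ) ∞ (χ n) x) ∧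
      (∀ x ∈ O, ∃ N : ℕ, ∀ᶠ y in 𝓝 x, ∀ n, N ≤ n → χ n y = 0) ∧
      (∀ x ∈ O, ∑ᶠ n, χ n x = 1) ∧ (∀ n x, f n x = 0 → χ n x = 0) ∧
      ∀ x y, (∀ n, f n x = f n y) → ∀ n, χ n x = χ n y := by
  classical
  -- The weight `w n` is positive exactly where `f n > 0` and `f k < 1 / (n + 1)` for all `k < n`.
  -- Near a point with `f m > 0` this fails for all large `n`, which is local finiteness. Being
  -- built from the `f k` alone, the weights inherit any invariance of these functions.
  set w : ℕ → X → ℝ := fun n x => expNegInvGlue (f n x) *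
    ∏ k ∈ Finset.range n, expNegInvGlue (1 / ((n : ℝ) + 1) - f k x) with hw
  have hws : ∀ n, ContMDiff 𝓘(ℝ, E) 𝓘(ℝ, ℝ) ∞ (w n) := by
    intro n
    have h1 : ContMDiff 𝓘(ℝ, ℝ) 𝓘(ℝ, ℝ) ∞ expNegInvGlue := expNegInvGlue.contDiff.contMDiff
    have h2 : ContMDiff 𝓘(ℝ, E) 𝓘(ℝ, ℝ) ∞ (fun x => ∏ k ∈ Finset.range n,
        expNegInvGlue (1 / ((n : ℝ) + 1) - f k x)) :=
      contMDiff_finsetProd fun k _ => h1.comp (contMDiff_const.sub (hf k))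
    exact (h1.comp (hf n)).mul h2
  have hw0 : ∀ n x, 0 ≤ w n x := fun n x =>
    mul_nonneg (expNegInvGlue.nonneg _) (Finset.prod_nonneg fun k _ => expNegInvGlue.nonneg _)
  have hwfin : ∀ x ∈ O, ∃ N : ℕ, ∀ᶠ y in 𝓝 x, ∀ n, N ≤ n → w n y = 0 := by
    intro x hx
    obtain ⟨m, hm⟩ := hO x hx
    obtain ⟨N, hN⟩ := exists_nat_one_div_lt (half_pos hm)
    refine ⟨max N (m + 1), ?_⟩
    filter_upwards [(hf m).continuous.continuousAt.eventually
      (lt_mem_nhds (half_lt_self hm))] with y hy n hn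
    have h1 : (1 : ℝ) / ((n : ℝ) + 1) ≤ 1 / ((N : ℝ) + 1) := by
      apply one_div_le_one_div_of_le (by positivity)
      have : (N : ℝ) ≤ n := by exact_mod_cast (le_max_left _ _).trans hn
      linarith
    have h2 : ∏ k ∈ Finset.range n, expNegInvGlue (1 / ((n : ℝ) + 1) - f k y) = 0 := by
      refine Finset.prod_eq_zero (i := m) ?_ (expNegInvGlue.zero_of_nonpos (by linarith))
      exact Finset.mem_range.2 (lt_of_lt_of_le (Nat.lt_succ_self m) ((le_max_right _ _).trans hn))
    simp only [hw, h2, mul_zero]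
  have hwpos : ∀ x ∈ O, ∃ n, 0 < w n x := by
    intro x hx
    -- At the first index with `f n x > 0` all earlier functions vanish, so every factor of `w n x`
    -- is positive.
    refine ⟨Nat.find (hO x hx), mul_pos (expNegInvGlue.pos_of_pos (Nat.find_spec (hO x hx)))
      (Finset.prod_pos fun k hk => expNegInvGlue.pos_of_pos ?_)⟩
    have h1 := Nat.find_min (hO x hx) (Finset.mem_range.1 hk)
    have h2 : f k x = 0 := le_antisymm (not_lt.1 h1) (hf0 k x)
    rw [h2, sub_zero]
    positivity
  have hsum : ∀ {x : X} {N : ℕ}, (∀ n, N ≤ n → w n x = 0) →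
      ∑ᶠ n, w n x = ∑ n ∈ Finset.range N, w n x := by
    intro x N h
    refine finsum_eq_sum_of_support_subset _ fun n hn => ?_
    by_contra hn'
    exact hn (h n (by simpa using hn'))
  have hsumpos : ∀ x ∈ O, 0 < ∑ᶠ n, w n x := by
    intro x hx
    obtain ⟨N, hN⟩ := hwfin x hx
    obtain ⟨n, hn⟩ := hwpos x hx
    rw [hsum hN.self_of_nhds]
    refine Finset.sum_pos' (fun n _ => hw0 n x) ⟨n, ?_, hn⟩
    by_contra h
    exact hn.ne' (hN.self_of_nhds n (by simpa using h))
  refine ⟨fun n x => w n x / ∑ᶠ m, w m x, ?_, ?_, ?_, ?_, ?_⟩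
  · intro x hx n
    obtain ⟨N, hN⟩ := hwfin x hx
    have h1 : ContMDiffAt 𝓘(ℝ, E) 𝓘(ℝ, ℝ) ∞ (fun y => ∑ᶠ m, w m y) x := by
      have h2 : ContMDiffAt 𝓘(ℝ, E) 𝓘(ℝ, ℝ) ∞ (fun y => ∑ m ∈ Finset.range N, w m y) x :=
        contMDiffAt_finsetSum fun m _ => (hws m).contMDiffAt
      refine h2.congr_of_eventuallyEq ?_
      filter_upwards [hN] with y hy using hsum hy
    exact (hws n).contMDiffAt.div₀ h1 (hsumpos x hx).ne'
  · intro x hx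
    obtain ⟨N, hN⟩ := hwfin x hx
    refine ⟨N, ?_⟩
    filter_upwards [hN] with y hy n hn
    rw [hy n hn, zero_div]
  · intro x hx
    simp only [div_eq_mul_inv]
    rw [← finsum_mul', mul_inv_cancel₀ (hsumpos x hx).ne']
    obtain ⟨N, hN⟩ := hwfin x hx
    refine (Finset.range N).finite_toSet.subset fun n hn => ?_
    by_contra hn'
    exact hn (hN.self_of_nhds n (by simpa using hn'))
  · intro n x h
    simp [hw, h]
  · intro x y h n
    simp only [hw, h]

end Weights

/-! ### Lifting along submersions -/

section Submersions

variable {E EY X Y : Type*} [NormedAddCommGroup E] [NormedSpace ℝ E] [TopologicalSpace X]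
  [ChartedSpace E X] [NormedAddCommGroup EY] [NormedSpace ℝ EY]
  [TopologicalSpace Y] [ChartedSpace EY Y]

/-- Near a point `x`, a submersion `f` has a smooth map `Λ` which moves `x'` into the fibre of `f`
over `y`, and which fixes `x'` if it already lies in that fibre. -/
theorem exists_submersion_lift {f : X → Y} (hf : Manifold.IsSubmersion 𝓘(ℝ, E) 𝓘(ℝ, EY) ∞ f)
    (x : X) : ∃ (Λ : Y × X → X) (O : Set (Y × X)), IsOpen O ∧ (f x, x) ∈ O ∧
      ContMDiffOn (𝓘(ℝ, EY).prod 𝓘(ℝ, E)) 𝓘(ℝ, E) ∞ Λ O ∧ (∀ z ∈ O, f (Λ z) = z.1) ∧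
      ∀ x', (f x', x') ∈ O → Λ (f x', x') = x' := by
  have hfs := hf.contMDiff
  obtain ⟨F, _, _, hF⟩ := hf
  have h := hF x
  set φ := h.domChart
  set ψ := h.codChart
  set A := h.equiv
  have hφs := contMDiffOn_of_mem_maximalAtlas h.domChart_mem_maximalAtlas
  have hψs := contMDiffOn_of_mem_maximalAtlas h.codChart_mem_maximalAtlas
  have hφi := contMDiffOn_symm_of_mem_maximalAtlas h.domChart_mem_maximalAtlas
  have hwr : ∀ z ∈ φ.target, ψ (f (φ.symm z)) = (A z).1 := by
    intro z hz
    have := h.writtenInCharts (show z ∈ (φ.extend 𝓘(ℝ, E)).target by simpa using hz)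
    simpa using this
  have hfx : ∀ x' ∈ φ.source, ψ (f x') = (A (φ x')).1 := by
    intro x' hx'
    rw [← hwr _ (φ.map_source hx'), φ.left_inv hx']
  have hmap : ∀ x' ∈ φ.source, f x' ∈ ψ.source := fun x' hx' =>
    h.source_subset_preimage_source hx'
  set S : Set (Y × X) := ψ.source ×ˢ φ.source with hS
  have hSo : IsOpen S := ψ.open_source.prod φ.open_source
  -- In the submersion charts `f` is the first component of `A`. The lift replaces this component by
  -- the coordinate of `y` and keeps the complementary one.
  set m : Y × X → E := fun z => A.symm (ψ z.1, (A (φ z.2)).2) with hm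
  have hms : ContMDiffOn (𝓘(ℝ, EY).prod 𝓘(ℝ, E)) 𝓘(ℝ, E) ∞ m S := by
    have h1 : ContMDiffOn (𝓘(ℝ, EY).prod 𝓘(ℝ, E)) 𝓘(ℝ, EY) ∞ (fun z : Y × X => ψ z.1) S :=
      hψs.comp contMDiffOn_fst fun z hz => hz.1
    have h2 : ContMDiffOn (𝓘(ℝ, EY).prod 𝓘(ℝ, E)) 𝓘(ℝ, E) ∞ (fun z : Y × X => φ z.2) S :=
      hφs.comp contMDiffOn_snd fun z hz => hz.2
    have h3 : ContMDiff 𝓘(ℝ, E) 𝓘(ℝ, F) ∞ (fun e : E => (A e).2) :=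
      (contDiff_snd.comp A.contDiff).contMDiff
    exact A.symm.contDiff.contMDiff.comp_contMDiffOn (h1.prodMk_space (h3.comp_contMDiffOn h2))
  have hmfix : ∀ x' ∈ φ.source, m (f x', x') = φ x' := by
    intro x' hx'
    simp only [hm, hfx x' hx', Prod.mk.eta, ContinuousLinearEquiv.symm_apply_apply]
  refine ⟨fun z => φ.symm (m z), S ∩ m ⁻¹' φ.target,
    hms.continuousOn.isOpen_inter_preimage hSo φ.open_target, ?_, ?_, ?_, ?_⟩
  · refine ⟨⟨h.mem_codChart_source, h.mem_domChart_source⟩, ?_⟩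
    rw [Set.mem_preimage, hmfix x h.mem_domChart_source]
    exact φ.map_source h.mem_domChart_source
  · exact hφi.comp (hms.mono Set.inter_subset_left) fun z hz => hz.2
  · rintro z ⟨hz1, hz2⟩
    refine ψ.injOn (hmap _ (φ.map_target hz2)) hz1.1 ?_
    rw [hwr _ hz2]
    simp [hm]
  · rintro x' ⟨hx', -⟩
    simp only [hmfix x' hx'.2, φ.left_inv hx'.2]

end Submersions

/-! ### Cancellation in a Lie groupoid. -/

namespace GroupoidData.IsLieGroupoid

variable {X₀ X₁ E₀ E₁ : Type*}
  [NormedAddCommGroup E₀] [NormedSpace ℝ E₀] [NormedAddCommGroup E₁] [NormedSpace ℝ E₁]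
  [TopologicalSpace X₀] [ChartedSpace E₀ X₀] [TopologicalSpace X₁] [ChartedSpace E₁ X₁]
  {P : GroupoidData X₀ X₁}

theorem eq_comp_inv (hP : P.IsLieGroupoid 𝓘(ℝ, E₀) 𝓘(ℝ, E₁)) {a b c : X₁}
    (hab : P.src a = P.tgt b) (h : P.comp a b = c) : a = P.comp c (P.inv b) := by
  rw [← h, hP.comp_assoc _ _ _ hab (hP.tgt_inv b).symm, hP.comp_inv, ← hab, hP.comp_ident]

theorem comp_inv_comp (hP : P.IsLieGroupoid 𝓘(ℝ, E₀) 𝓘(ℝ, E₁)) {b c : X₁}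
    (h : P.src c = P.src b) : P.comp (P.comp c (P.inv b)) b = c := by
  rw [hP.comp_assoc _ _ _ (h.trans (hP.tgt_inv b).symm) (hP.src_inv b), hP.inv_comp, ← h,
    hP.comp_ident]

end GroupoidData.IsLieGroupoid

/-! ### Equivariant lifts and their transition functions. -/

section Bundles

variable {EG EH G H EM E₀ E₁ M P₀ P₁ : Type*}
  [NormedAddCommGroup EG] [NormedSpace ℝ EG] [NormedAddCommGroup EH] [NormedSpace ℝ EH]
  [TopologicalSpace G] [ChartedSpace EG G] [Group G]
  [TopologicalSpace H] [ChartedSpace EH H] [Group H]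
  [NormedAddCommGroup EM] [NormedSpace ℝ EM] [TopologicalSpace M] [ChartedSpace EM M]
  [NormedAddCommGroup E₀] [NormedSpace ℝ E₀] [TopologicalSpace P₀] [ChartedSpace E₀ P₀]
  [NormedAddCommGroup E₁] [NormedSpace ℝ E₁] [TopologicalSpace P₁] [ChartedSpace E₁ P₁]
  {Γ : CrossedModule EG EH G H}

namespace PrincipalTwoBundle

variable (B : PrincipalTwoBundle EM E₀ E₁ M P₀ P₁ Γ)

theorem π_src_eq_π_tgt (ρ : P₁) : B.π (B.P.src ρ) = B.π (B.P.tgt ρ) := B.π_functor.map_tgt ρ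

theorem src_R (ρ : P₁) (h : H) (g : G) : B.P.src (B.R₁ (ρ, (h, g))) = B.R₀ (B.P.src ρ, g) :=
  B.action.smooth_functor.map_src (ρ, (h, g))

theorem tgt_R (ρ : P₁) (h : H) (g : G) :
    B.P.tgt (B.R₁ (ρ, (h, g))) = B.R₀ (B.P.tgt ρ, Γ.t h * g) :=
  B.action.smooth_functor.map_tgt (ρ, (h, g))

theorem comp_R (a b : P₁) (h k : H) (g : G) (hab : B.P.src a = B.P.tgt b) :
    B.P.comp (B.R₁ (a, (h, Γ.t k * g))) (B.R₁ (b, (k, g))) =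
      B.R₁ (B.P.comp a b, (h * k, g)) :=
  (B.action.smooth_functor.map_comp (a, (h, Γ.t k * g)) (b, (k, g)) (Prod.ext hab rfl)).symm

/-- A smooth family `q` of morphisms from the objects in an invariant open set `V` to translates
of the points of a section `σ`, together with the elements `g` by which one translates. -/
structure Lift (σ : M → P₀) (U : Set M) where
  V : Set P₀
  g : P₀ → G
  q : P₀ → P₁
  isOpen : IsOpen V
  π_mem : ∀ p ∈ V, B.π p ∈ U
  invariant : ∀ p ∈ V, ∀ k, B.R₀ (p, k) ∈ V
  smooth_g : ContMDiffOn 𝓘(ℝ, E₀) 𝓘(ℝ, EG) ∞ g V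
  smooth_q : ContMDiffOn 𝓘(ℝ, E₀) 𝓘(ℝ, E₁) ∞ q V
  src_q : ∀ p ∈ V, B.P.src (q p) = p
  tgt_q : ∀ p ∈ V, B.P.tgt (q p) = B.R₀ (σ (B.π p), g p)
  g_mul : ∀ p ∈ V, ∀ k, g (B.R₀ (p, k)) = g p * k
  q_mul : ∀ p ∈ V, ∀ k, q (B.R₀ (p, k)) = B.R₁ (q p, (1, k))

variable {B} {σ : M → P₀} {U : Set M}

/-- `h` relates the lifts `L` and `L'` along the morphism `ρ`. -/
def IsTransition (L L' : B.Lift σ U) (ρ : P₁) (h : H) : Prop :=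
  Γ.t h * L.g (B.P.src ρ) = L'.g (B.P.tgt ρ) ∧
    B.P.comp (L'.q (B.P.tgt ρ)) ρ =
      B.P.comp (B.R₁ (B.P.ident (σ (B.π (B.P.src ρ))), (h, L.g (B.P.src ρ)))) (L.q (B.P.src ρ))

/-- The morphism of `P` between the endpoints of two lifts which is induced by `ρ`. -/
def conj (L L' : B.Lift σ U) (ρ : P₁) : P₁ :=
  B.P.compPair (B.P.compPair (L'.q (B.P.tgt ρ), ρ), B.P.inv (L.q (B.P.src ρ)))

/-- The point of the fibre product describing the morphisms of `P × Γ` to which `conj` belongs. -/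
def conjPoint (L L' : B.Lift σ U) (ρ : P₁) : ((P₀ × G) × (P₀ × G)) × (P₁ × P₁) :=
  (((σ (B.π (B.P.src ρ)), L.g (B.P.src ρ)), (σ (B.π (B.P.src ρ)), L'.g (B.P.tgt ρ))),
    (B.P.ident (σ (B.π (B.P.src ρ))), conj L L' ρ))

variable (B) in
/-- A smooth inverse of the map expressing that the action is fully faithful. -/
def ffInv : ((P₀ × G) × (P₀ × G)) × (P₁ × P₁) → P₁ × (H × G) :=
  Classical.choose B.weak_equivalence.fully_faithful.exists_inverse

/-- The transition function between two lifts. -/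
def transition (L L' : B.Lift σ U) (ρ : P₁) : H := (B.ffInv (conjPoint L L' ρ)).2.1

section Transition

variable {L L' L'' : B.Lift σ U} {ρ : P₁}

theorem src_q_inv (hs : B.P.src ρ ∈ L.V) :
    B.P.tgt (B.P.inv (L.q (B.P.src ρ))) = B.P.src ρ := by
  rw [B.isLieGroupoid.tgt_inv, L.src_q _ hs]

theorem src_comp_q (ht : B.P.tgt ρ ∈ L'.V) :
    B.P.src (B.P.comp (L'.q (B.P.tgt ρ)) ρ) = B.P.src ρ :=
  B.isLieGroupoid.src_comp _ _ (L'.src_q _ ht)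

theorem src_conj (hs : B.P.src ρ ∈ L.V) (ht : B.P.tgt ρ ∈ L'.V) :
    B.P.src (conj L L' ρ) = B.R₀ (σ (B.π (B.P.src ρ)), L.g (B.P.src ρ)) := by
  have h1 : B.P.src (B.P.comp (L'.q (B.P.tgt ρ)) ρ) = B.P.tgt (B.P.inv (L.q (B.P.src ρ))) := by
    rw [src_comp_q ht, src_q_inv hs]
  change B.P.src (B.P.comp (B.P.comp _ _) _) = _
  rw [B.isLieGroupoid.src_comp _ _ h1, B.isLieGroupoid.src_inv, L.tgt_q _ hs]

theorem tgt_conj (hs : B.P.src ρ ∈ L.V) (ht : B.P.tgt ρ ∈ L'.V) :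
    B.P.tgt (conj L L' ρ) = B.R₀ (σ (B.π (B.P.src ρ)), L'.g (B.P.tgt ρ)) := by
  have h1 : B.P.src (B.P.comp (L'.q (B.P.tgt ρ)) ρ) = B.P.tgt (B.P.inv (L.q (B.P.src ρ))) := by
    rw [src_comp_q ht, src_q_inv hs]
  change B.P.tgt (B.P.comp (B.P.comp _ _) _) = _
  rw [B.isLieGroupoid.tgt_comp _ _ h1, B.isLieGroupoid.tgt_comp _ _ (L'.src_q _ ht),
    L'.tgt_q _ ht, B.π_src_eq_π_tgt]

theorem conjPoint_mem (hs : B.P.src ρ ∈ L.V) (ht : B.P.tgt ρ ∈ L'.V) :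
    conjPoint L L' ρ ∈ {z : ((P₀ × G) × (P₀ × G)) × (P₁ × P₁) |
      (B.P.prod B.P).src z.2 = (z.1.1.1, B.R₀ z.1.1) ∧
        (B.P.prod B.P).tgt z.2 = (z.1.2.1, B.R₀ z.1.2)} :=
  ⟨Prod.ext (B.isLieGroupoid.src_ident _) (src_conj hs ht),
    Prod.ext (B.isLieGroupoid.tgt_ident _) (tgt_conj hs ht)⟩

/-- By full faithfulness `conjPoint` is the image of a morphism `(a, (h, g))` of `P × Γ`. Its
components force `a` to be the identity of the point of the section and `g` to be the value of
`L.g`; the remaining ones are the two clauses of `IsTransition`. -/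
theorem transition_spec (hs : B.P.src ρ ∈ L.V) (ht : B.P.tgt ρ ∈ L'.V) :
    IsTransition L L' ρ (transition L L' ρ) := by
  have hmem := conjPoint_mem hs ht
  have hinv := (Classical.choose_spec B.weak_equivalence.fully_faithful.exists_inverse).2
  have hrange := B.weak_equivalence.fully_faithful.range_eq
  rw [← hrange] at hmem
  obtain ⟨⟨a, h, g⟩, ha⟩ := hmem
  have h1 : B.ffInv (conjPoint L L' ρ) = (a, (h, g)) := by
    rw [← ha]; exact hinv _
  have h2 : transition L L' ρ = h := by rw [transition, h1]
  rw [h2]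
  simp only [GroupoidData.prod, CrossedModule.groupoid, conjPoint, Prod.mk.injEq] at ha
  obtain ⟨⟨⟨-, rfl⟩, -, h3⟩, rfl, h4⟩ := ha
  refine ⟨h3, ?_⟩
  rw [h4]
  exact (B.isLieGroupoid.comp_inv_comp ((src_comp_q ht).trans (L.src_q _ hs).symm)).symm

/-- The relation expresses `conjPoint` as the image of `(ident, (h, L.g))`, which `ffInv` recovers.
Formulas for `transition` can thus be proved by checking `IsTransition` for the proposed value. -/
theorem IsTransition.unique {h : H} (hs : B.P.src ρ ∈ L.V)
    (hh : IsTransition L L' ρ h) : transition L L' ρ = h := by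
  have hinv := (Classical.choose_spec B.weak_equivalence.fully_faithful.exists_inverse).2
  have h1 : B.P.src (B.R₁ (B.P.ident (σ (B.π (B.P.src ρ))), (h, L.g (B.P.src ρ)))) =
      B.P.tgt (L.q (B.P.src ρ)) := by
    rw [B.src_R, B.isLieGroupoid.src_ident, L.tgt_q _ hs]
  have h2 := B.isLieGroupoid.eq_comp_inv h1 hh.2.symm
  have h3 := hinv (B.P.ident (σ (B.π (B.P.src ρ))), (h, L.g (B.P.src ρ)))
  have h4 : conjPoint L L' ρ = (fun a => (((B.P.prod Γ.groupoid).src a,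
      (B.P.prod Γ.groupoid).tgt a), (a.1, B.R₁ a)))
        (B.P.ident (σ (B.π (B.P.src ρ))), (h, L.g (B.P.src ρ))) := by
    simp only [GroupoidData.prod, CrossedModule.groupoid, conjPoint, conj,
      GroupoidData.compPair, B.isLieGroupoid.src_ident, B.isLieGroupoid.tgt_ident, hh.1, ← h2]
  rw [transition, h4]
  exact congrArg (fun a => a.2.1) h3

theorem t_transition (hs : B.P.src ρ ∈ L.V) (ht : B.P.tgt ρ ∈ L'.V) :
    Γ.t (transition L L' ρ) * L.g (B.P.src ρ) = L'.g (B.P.tgt ρ) := (transition_spec hs ht).1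

/-- The middle lift cancels when the two conjugated morphisms are composed, and functoriality of the
action turns the composition in `Γ` into the product in `H`. -/
theorem transition_comp {ξ η : P₁} (hξη : B.P.src ξ = B.P.tgt η) (h₁ : B.P.src η ∈ L.V)
    (h₂ : B.P.tgt η ∈ L'.V) (h₃ : B.P.tgt ξ ∈ L''.V) :
    transition L L'' (B.P.comp ξ η) = transition L' L'' ξ * transition L L' η := by
  have hsrc := B.isLieGroupoid.src_comp ξ η hξη
  have htgt := B.isLieGroupoid.tgt_comp ξ η hξη
  refine IsTransition.unique (by rwa [hsrc]) ?_
  have hη := transition_spec h₁ h₂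
  have hξ := transition_spec (L := L') (L' := L'') (by rwa [hξη]) h₃
  have hπ : B.π (B.P.src ξ) = B.π (B.P.src η) := by rw [hξη, B.π_src_eq_π_tgt]
  refine ⟨?_, ?_⟩
  · rw [hsrc, htgt, map_mul, mul_assoc, hη.1, ← hξη, hξ.1]
  · rw [hsrc, htgt, ← B.isLieGroupoid.comp_assoc _ _ _ (L''.src_q _ h₃) hξη, hξ.2, hπ,
      B.isLieGroupoid.comp_assoc _ _ _ _ _, hξη, hη.2, ← B.isLieGroupoid.comp_assoc, ← hη.1,
      B.comp_R _ _ _ _ _ (by rw [B.isLieGroupoid.src_ident, B.isLieGroupoid.tgt_ident])]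
    · have := B.isLieGroupoid.comp_ident (B.P.ident (σ (B.π (B.P.src η))))
      rw [B.isLieGroupoid.src_ident] at this
      rw [this]
    · rw [B.src_R, B.tgt_R, B.isLieGroupoid.src_ident, B.isLieGroupoid.tgt_ident, hη.1]
    · rw [B.src_R, B.isLieGroupoid.src_ident, L.tgt_q _ h₁]
    · rw [B.src_R, B.isLieGroupoid.src_ident, hξη, L'.tgt_q _ h₂, ← B.π_src_eq_π_tgt]
    · rw [hξη, L'.src_q _ h₂]

/-- Equivariance of the lifts lets the translation by `(h, g)` pass through `q`. The factor `α`
comes from the semi-direct product of `(transition L L' ρ, L.g)` with `(h, 1)`. -/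
theorem transition_R (hs : B.P.src ρ ∈ L.V) (ht : B.P.tgt ρ ∈ L'.V) (h : H) (g : G) :
    transition L L' (B.R₁ (ρ, (h, g))) = transition L L' ρ * Γ.α (L.g (B.P.src ρ)) h := by
  have hρ := transition_spec hs ht
  have hone : ∀ x : P₀, B.P.comp (B.P.ident x) (B.P.ident x) = B.P.ident x := fun x => by
    have := B.isLieGroupoid.comp_ident (B.P.ident x)
    rwa [B.isLieGroupoid.src_ident] at this
  refine IsTransition.unique (by rw [B.src_R]; exact L.invariant _ hs _) ⟨?_, ?_⟩
  · rw [B.src_R, B.tgt_R, L.g_mul _ hs, L'.g_mul _ ht, map_mul, Γ.t_α, ← hρ.1]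
    group
  · rw [B.src_R, B.tgt_R, L.q_mul _ hs, L'.q_mul _ ht, B.comp_R _ _ _ _ _ (L'.src_q _ ht),
      B.π_action, L.g_mul _ hs, hρ.2, one_mul]
    have h1 := B.comp_R (B.R₁ (B.P.ident (σ (B.π (B.P.src ρ))),
      (transition L L' ρ, L.g (B.P.src ρ)))) (L.q (B.P.src ρ)) h 1 g
      (by rw [B.src_R, B.isLieGroupoid.src_ident, L.tgt_q _ hs])
    rw [map_one, one_mul, mul_one] at h1
    rw [← h1, B.action.mor_mul]
    rfl

theorem smooth_conj (L L' : B.Lift σ U) :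
    ContMDiffOn 𝓘(ℝ, E₁) 𝓘(ℝ, E₁) ∞ (conj L L') {ρ | B.P.src ρ ∈ L.V ∧ B.P.tgt ρ ∈ L'.V} := by
  have hsrc := B.isLieGroupoid.submersion_src.contMDiff
  have htgt := B.isLieGroupoid.submersion_tgt.contMDiff
  have h1 : ContMDiffOn 𝓘(ℝ, E₁) 𝓘(ℝ, E₁) ∞ (fun ρ => L'.q (B.P.tgt ρ))
      {ρ | B.P.src ρ ∈ L.V ∧ B.P.tgt ρ ∈ L'.V} :=
    L'.smooth_q.comp htgt.contMDiffOn fun ρ hρ => hρ.2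
  have h2 : ContMDiffOn 𝓘(ℝ, E₁) 𝓘(ℝ, E₁) ∞ (fun ρ => B.P.inv (L.q (B.P.src ρ)))
      {ρ | B.P.src ρ ∈ L.V ∧ B.P.tgt ρ ∈ L'.V} :=
    B.isLieGroupoid.smooth_inv.comp_contMDiffOn
      (L.smooth_q.comp hsrc.contMDiffOn fun ρ hρ => hρ.1)
  have h3 : ContMDiffOn 𝓘(ℝ, E₁) 𝓘(ℝ, E₁) ∞ (fun ρ => B.P.compPair (L'.q (B.P.tgt ρ), ρ))
      {ρ | B.P.src ρ ∈ L.V ∧ B.P.tgt ρ ∈ L'.V} :=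
    B.isLieGroupoid.smooth_comp.comp (h1.prodMk contMDiffOn_id) fun ρ hρ => L'.src_q _ hρ.2
  refine B.isLieGroupoid.smooth_comp.comp (h3.prodMk h2) fun ρ hρ => ?_
  exact (src_comp_q hρ.2).trans (src_q_inv hρ.1).symm

/-- Smoothness rests on the smooth inverse in full faithfulness: `conjPoint` is smooth with values
in the fibre product on which that inverse is smooth. -/
theorem smooth_transition (hσ : ContMDiffOn 𝓘(ℝ, EM) 𝓘(ℝ, E₀) ∞ σ U) (L L' : B.Lift σ U) :
    ContMDiffOn 𝓘(ℝ, E₁) 𝓘(ℝ, EH) ∞ (transition L L')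
      {ρ | B.P.src ρ ∈ L.V ∧ B.P.tgt ρ ∈ L'.V} := by
  have hsrc := B.isLieGroupoid.submersion_src.contMDiff
  have htgt := B.isLieGroupoid.submersion_tgt.contMDiff
  have h0 : ContMDiffOn 𝓘(ℝ, E₁) 𝓘(ℝ, E₀) ∞ (fun ρ => σ (B.π (B.P.src ρ)))
      {ρ | B.P.src ρ ∈ L.V ∧ B.P.tgt ρ ∈ L'.V} :=
    hσ.comp (B.π_functor.smooth_obj.comp hsrc).contMDiffOn fun ρ hρ => L.π_mem _ hρ.1
  have h1 : ContMDiffOn 𝓘(ℝ, E₁) 𝓘(ℝ, EG) ∞ (fun ρ => L.g (B.P.src ρ))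
      {ρ | B.P.src ρ ∈ L.V ∧ B.P.tgt ρ ∈ L'.V} :=
    L.smooth_g.comp hsrc.contMDiffOn fun ρ hρ => hρ.1
  have h2 : ContMDiffOn 𝓘(ℝ, E₁) 𝓘(ℝ, EG) ∞ (fun ρ => L'.g (B.P.tgt ρ))
      {ρ | B.P.src ρ ∈ L.V ∧ B.P.tgt ρ ∈ L'.V} :=
    L'.smooth_g.comp htgt.contMDiffOn fun ρ hρ => hρ.2
  have h3 := ((h0.prodMk h1).prodMk (h0.prodMk h2)).prodMk
    ((B.isLieGroupoid.smooth_ident.comp_contMDiffOn h0).prodMk (smooth_conj L L'))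
  have h4 := (Classical.choose_spec B.weak_equivalence.fully_faithful.exists_inverse).1
  have h5 := h4.comp h3 fun ρ hρ => conjPoint_mem hρ.1 hρ.2
  exact contMDiff_fst.comp_contMDiffOn (contMDiff_snd.comp_contMDiffOn h5)

end Transition

/-! ### Existence of equivariant lifts and of local sections. -/

variable (B) in
/-- Smooth local choices of morphisms to translates of the points of a section. -/
theorem exists_local_lift (hU : IsOpen U) (hσ : ContMDiffOn 𝓘(ℝ, EM) 𝓘(ℝ, E₀) ∞ σ U)
    (hσπ : ∀ y ∈ U, B.π (σ y) = y) {p₀ : P₀} (hp₀ : B.π p₀ ∈ U) :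
    ∃ W ∈ 𝓝 p₀, ∃ (g : P₀ → G) (q : P₀ → P₁),
      ContMDiffOn 𝓘(ℝ, E₀) 𝓘(ℝ, EG) ∞ g W ∧ ContMDiffOn 𝓘(ℝ, E₀) 𝓘(ℝ, E₁) ∞ q W ∧
      ∀ p ∈ W, B.π p ∈ U ∧ B.P.src (q p) = p ∧ B.P.tgt (q p) = B.R₀ (σ (B.π p), g p) := by
  have ess := B.weak_equivalence.essentially_surjective
  have hmem : (σ (B.π p₀), p₀) ∈ {z : P₀ × P₀ | B.π z.1 = B.π z.2} := hσπ _ hp₀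
  rw [← ess.image_eq] at hmem
  obtain ⟨z, hz, hz'⟩ := hmem
  obtain ⟨N, hN, τ, hτ, -, hτA⟩ := ess.exists_section z hz
  simp only at hz'
  rw [hz'] at hN
  have hπ := B.π_functor.smooth_obj
  have hj : ContMDiffOn 𝓘(ℝ, E₀) (𝓘(ℝ, E₀).prod 𝓘(ℝ, E₀)) ∞ (fun p => (σ (B.π p), p))
      (B.π ⁻¹' U) :=
    (hσ.comp hπ.contMDiffOn fun p hp => hp).prodMk contMDiffOn_id
  have hO : IsOpen (B.π ⁻¹' U) := hU.preimage hπ.continuous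
  have hW : (B.π ⁻¹' U) ∩ (fun p => (σ (B.π p), p)) ⁻¹' N ∈ 𝓝 p₀ :=
    Filter.inter_mem (hO.mem_nhds hp₀)
      ((hj.contMDiffAt (hO.mem_nhds hp₀)).continuousAt.preimage_mem_nhds hN)
  have hmaps : Set.MapsTo (fun p => (σ (B.π p), p)) ((B.π ⁻¹' U) ∩
      (fun p => (σ (B.π p), p)) ⁻¹' N) (N ∩ {z : P₀ × P₀ | B.π z.1 = B.π z.2}) :=
    fun p hp => ⟨hp.2, hσπ _ hp.1⟩
  have hs := hτ.comp (hj.mono Set.inter_subset_left) hmaps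
  have hg := contMDiff_snd.comp_contMDiffOn (contMDiff_fst.comp_contMDiffOn hs)
  have hξ₁ := contMDiff_fst.comp_contMDiffOn (contMDiff_snd.comp_contMDiffOn hs)
  have hξ₂ := contMDiff_snd.comp_contMDiffOn (contMDiff_snd.comp_contMDiffOn hs)
  have hspec : ∀ p ∈ (B.π ⁻¹' U) ∩ (fun p => (σ (B.π p), p)) ⁻¹' N,
      B.P.src (B.R₁ (B.P.inv (τ (σ (B.π p), p)).2.1, ((1 : H), (τ (σ (B.π p), p)).1.2))) =
        B.P.tgt (τ (σ (B.π p), p)).2.2 ∧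
      B.P.src (τ (σ (B.π p), p)).2.1 = σ (B.π p) ∧ B.P.src (τ (σ (B.π p), p)).2.2 = p := by
    intro p hp
    obtain ⟨⟨h1, -⟩, h2⟩ := hτA _ (hmaps hp)
    simp only [GroupoidData.prod, Prod.mk.injEq] at h1 h2
    refine ⟨?_, h2.1, h2.2⟩
    rw [B.src_R, B.isLieGroupoid.src_inv, ← h1.1, ← h1.2]
  -- Essential surjectivity at `(σ (π p), p)` gives an object `x`, an element `g` and morphisms `σ
  -- (π p) → x` and `p → R₀ (x, g)`. Translating the inverse of the first by `g` and composing with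
  -- the second gives `p → R₀ (σ (π p), g)`.
  refine ⟨_, hW, fun p => (τ (σ (B.π p), p)).1.2, fun p => B.P.compPair
    (B.R₁ (B.P.inv (τ (σ (B.π p), p)).2.1, (1, (τ (σ (B.π p), p)).1.2)),
      (τ (σ (B.π p), p)).2.2), hg, ?_, ?_⟩
  · refine B.isLieGroupoid.smooth_comp.comp (ContMDiffOn.prodMk ?_ hξ₂) fun p hp => (hspec p hp).1
    exact B.action.smooth_functor.smooth_mor.comp_contMDiffOn
      ((B.isLieGroupoid.smooth_inv.comp_contMDiffOn hξ₁).prodMk (contMDiffOn_const.prodMk hg))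
  · intro p hp
    obtain ⟨h1, h2, h3⟩ := hspec p hp
    refine ⟨hp.1, ?_, ?_⟩
    · exact (B.isLieGroupoid.src_comp _ _ h1).trans h3
    · refine (B.isLieGroupoid.tgt_comp _ _ h1).trans ?_
      rw [B.tgt_R, B.isLieGroupoid.tgt_inv, h2, map_one, one_mul]

variable (B) in
/-- Through every point there is an equivariant lift, together with an invariant bump function. -/
theorem exists_lift [FiniteDimensional ℝ E₀] [FiniteDimensional ℝ EG] [T2Space P₀]
    [IsManifold 𝓘(ℝ, E₀) ∞ P₀] [LieGroup 𝓘(ℝ, EG) ∞ G]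
    (hR : IsFreeProperAction E₀ EG B.R₀) (hU : IsOpen U)
    (hσ : ContMDiffOn 𝓘(ℝ, EM) 𝓘(ℝ, E₀) ∞ σ U) (hσπ : ∀ y ∈ U, B.π (σ y) = y)
    {p₀ : P₀} (hp₀ : B.π p₀ ∈ U) :
    ∃ (L : B.Lift σ U) (f : P₀ → ℝ), ContMDiff 𝓘(ℝ, E₀) 𝓘(ℝ, ℝ) ∞ f ∧ (∀ p, 0 ≤ f p) ∧
      (∀ p k, f (B.R₀ (p, k)) = f p) ∧ 0 < f p₀ ∧ ∀ p ∉ L.V, ∀ᶠ y in 𝓝 p, f y = 0 := by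
  obtain ⟨W, hW, g, q, hg, hq, hspec⟩ := B.exists_local_lift hU hσ hσπ hp₀
  obtain ⟨V, κ, f, hVo, hVinv, hκs, hκ, hκW, hf⟩ := hR.exists_slice_bump p₀ hW
  have hr : ContMDiffOn 𝓘(ℝ, E₀) 𝓘(ℝ, E₀) ∞ (fun p => B.R₀ (p, (κ p)⁻¹)) V :=
    hR.smooth.comp_contMDiffOn (contMDiffOn_id.prodMk hκs.inv)
  -- The point `R₀ (p, (κ p)⁻¹)` of the slice depends only on the orbit of `p`. Evaluating the local
  -- lift there and translating back by `κ p` therefore makes it equivariant.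
  have hrinv : ∀ p ∈ V, ∀ k, B.R₀ (B.R₀ (p, k), (κ (B.R₀ (p, k)))⁻¹) = B.R₀ (p, (κ p)⁻¹) := by
    intro p hp k
    rw [hκ p hp, hR.mul, mul_inv_rev, mul_inv_cancel_left]
  refine ⟨{ V := V
            g := fun p => g (B.R₀ (p, (κ p)⁻¹)) * κ p
            q := fun p => B.R₁ (q (B.R₀ (p, (κ p)⁻¹)), (1, κ p))
            isOpen := hVo
            π_mem := fun p hp => ?_
            invariant := hVinv
            smooth_g := (hg.comp hr hκW).mul hκs
            smooth_q := B.action.smooth_functor.smooth_mor.comp_contMDiffOn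
              ((hq.comp hr hκW).prodMk (contMDiffOn_const.prodMk hκs))
            src_q := fun p hp => ?_
            tgt_q := fun p hp => ?_
            g_mul := fun p hp k => ?_
            q_mul := fun p hp k => ?_ }, f, hf⟩
  · have h := (hspec _ (hκW p hp)).1
    rwa [B.π_action] at h
  · rw [B.src_R, (hspec _ (hκW p hp)).2.1, hR.inv_mul_cancel]
  · rw [B.tgt_R, (hspec _ (hκW p hp)).2.2, B.π_action, map_one, one_mul, hR.mul]
  · rw [hrinv p hp, hκ p hp, mul_assoc]
  · rw [hrinv p hp, hκ p hp, B.action.mor_mul]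
    simp [CrossedModule.mulMor]

variable (B) in
theorem exists_local_section (x : M) :
    ∃ (U : Set M) (σ : M → P₀), IsOpen U ∧ x ∈ U ∧ ContMDiffOn 𝓘(ℝ, EM) 𝓘(ℝ, E₀) ∞ σ U ∧
      ∀ y ∈ U, B.π (σ y) = y := by
  obtain ⟨p, rfl⟩ := B.π_surjective x
  obtain ⟨Λ, O, hO, hmem, hΛ, hsec, -⟩ := exists_submersion_lift B.π_submersion p
  have hi : ContMDiff 𝓘(ℝ, EM) (𝓘(ℝ, EM).prod 𝓘(ℝ, E₀)) ∞ (fun y : M => (y, p)) :=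
    contMDiff_id.prodMk contMDiff_const
  exact ⟨(fun y => (y, p)) ⁻¹' O, fun y => Λ (y, p), hO.preimage hi.continuous, hmem,
    hΛ.comp hi.contMDiffOn fun y hy => hy, fun y hy => hsec _ hy⟩

end PrincipalTwoBundle

end Bundles

/-! ### Elementary identities in the crossed module. -/

namespace CrossedModule

variable {EG EH G H : Type*}
  [NormedAddCommGroup EG] [NormedSpace ℝ EG] [NormedAddCommGroup EH] [NormedSpace ℝ EH]
  [TopologicalSpace G] [ChartedSpace EG G] [Group G]
  [TopologicalSpace H] [ChartedSpace EH H] [Group H]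
  (Γ : CrossedModule EG EH G H)

theorem smooth_α_right (g : G) : ContMDiff 𝓘(ℝ, EH) 𝓘(ℝ, EH) ∞ (fun h : H => Γ.α g h) :=
  Γ.smooth_α.comp (contMDiff_const.prodMk contMDiff_id)

theorem smooth_α_left (h : H) : ContMDiff 𝓘(ℝ, EG) 𝓘(ℝ, EH) ∞ (fun g : G => Γ.α g h) :=
  Γ.smooth_α.comp (contMDiff_id.prodMk contMDiff_const)

theorem α_mul_apply (g g' : G) (h : H) : Γ.α (g * g') h = Γ.α g (Γ.α g' h) := by
  rw [map_mul, MulAut.mul_apply]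

/-- A form of the Peiffer identity. In `formB_comp` it trades conjugation by a transition function
for a change of the twisting element `g`. -/
theorem α_inv_conj (h x : H) : h⁻¹ * x * h = Γ.α (Γ.t h)⁻¹ x := by
  rw [← map_inv, Γ.α_t, inv_inv]

end CrossedModule

/-! ### The forms defined by lifts -/

namespace PrincipalTwoBundle

variable {EG EH G H EM E₀ E₁ M P₀ P₁ : Type*}
  [NormedAddCommGroup EG] [NormedSpace ℝ EG] [NormedAddCommGroup EH] [NormedSpace ℝ EH]
  [TopologicalSpace G] [ChartedSpace EG G] [Group G]
  [TopologicalSpace H] [ChartedSpace EH H] [Group H]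
  [NormedAddCommGroup EM] [NormedSpace ℝ EM] [TopologicalSpace M] [ChartedSpace EM M]
  [NormedAddCommGroup E₀] [NormedSpace ℝ E₀] [TopologicalSpace P₀] [ChartedSpace E₀ P₀]
  [NormedAddCommGroup E₁] [NormedSpace ℝ E₁] [TopologicalSpace P₁] [ChartedSpace E₁ P₁]
  {Γ : CrossedModule EG EH G H} {B : PrincipalTwoBundle EM E₀ E₁ M P₀ P₁ Γ}
  {σ : M → P₀} {U : Set M}

/-- The pullback of the Maurer-Cartan form of `G` along the map `g` of a lift. -/
def formA (L : B.Lift σ U) (p : P₀) : E₀ →L[ℝ] EG :=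
  der 𝓘(ℝ, E₀) 𝓘(ℝ, EG) (fun q => (L.g p)⁻¹ * L.g q) p

/-- The pullback of the Maurer-Cartan form of `H` along a transition function, twisted by `g`. -/
def formB (L L' : B.Lift σ U) (ρ : P₁) : E₁ →L[ℝ] EH :=
  der 𝓘(ℝ, E₁) 𝓘(ℝ, EH) (fun ρ' => Γ.α (L.g (B.P.src ρ))⁻¹
    ((transition L L' ρ)⁻¹ * transition L L' ρ')) ρ

theorem smooth_src (B : PrincipalTwoBundle EM E₀ E₁ M P₀ P₁ Γ) :
    ContMDiff 𝓘(ℝ, E₁) 𝓘(ℝ, E₀) ∞ B.P.src := B.isLieGroupoid.submersion_src.contMDiff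

theorem smooth_tgt (B : PrincipalTwoBundle EM E₀ E₁ M P₀ P₁ Γ) :
    ContMDiff 𝓘(ℝ, E₁) 𝓘(ℝ, E₀) ∞ B.P.tgt := B.isLieGroupoid.submersion_tgt.contMDiff

theorem smoothAt_g (L : B.Lift σ U) {p : P₀} (hp : p ∈ L.V) :
    ContMDiffAt 𝓘(ℝ, E₀) 𝓘(ℝ, EG) ∞ L.g p := L.smooth_g.contMDiffAt (L.isOpen.mem_nhds hp)

theorem isOpen_transition (L L' : B.Lift σ U) :
    IsOpen {ρ | B.P.src ρ ∈ L.V ∧ B.P.tgt ρ ∈ L'.V} :=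
  (L.isOpen.preimage B.smooth_src.continuous).inter (L'.isOpen.preimage B.smooth_tgt.continuous)

theorem smoothAt_transition (hσ : ContMDiffOn 𝓘(ℝ, EM) 𝓘(ℝ, E₀) ∞ σ U) {L L' : B.Lift σ U} {ρ : P₁}
    (hs : B.P.src ρ ∈ L.V) (ht : B.P.tgt ρ ∈ L'.V) :
    ContMDiffAt 𝓘(ℝ, E₁) 𝓘(ℝ, EH) ∞ (transition L L') ρ :=
  (smooth_transition hσ L L').contMDiffAt ((isOpen_transition L L').mem_nhds ⟨hs, ht⟩)

/-- Used with `g` the inverse of the value at a frozen point. The resulting two-point functions are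
1 when the points coincide, so identities of forms follow by `der_mul` from identities of such
functions. -/
theorem mdiffAt_twoPoint_g [LieGroup 𝓘(ℝ, EG) ∞ G] (L : B.Lift σ U) {p : P₀} (hp : p ∈ L.V) (g : G) :
    MDifferentiableAt 𝓘(ℝ, E₀) 𝓘(ℝ, EG) (fun p' => g * L.g p') p :=
  mdiffAt (contMDiffAt_const.mul (smoothAt_g L hp))

theorem mdiffAt_twoPoint_transition [LieGroup 𝓘(ℝ, EH) ∞ H]
    (hσ : ContMDiffOn 𝓘(ℝ, EM) 𝓘(ℝ, E₀) ∞ σ U)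
    {L L' : B.Lift σ U} {ρ : P₁} (hs : B.P.src ρ ∈ L.V) (ht : B.P.tgt ρ ∈ L'.V) (g : G) (h : H) :
    MDifferentiableAt 𝓘(ℝ, E₁) 𝓘(ℝ, EH) (fun ρ' => Γ.α g (h * transition L L' ρ')) ρ :=
  mdiffAt ((Γ.smooth_α_right g).contMDiffAt.comp ρ
    (contMDiffAt_const.mul (smoothAt_transition hσ hs ht)))

theorem smoothFormAt_formA [LieGroup 𝓘(ℝ, EG) ∞ G] [IsManifold 𝓘(ℝ, E₀) ∞ P₀]
    (L : B.Lift σ U) {p : P₀} (hp : p ∈ L.V) :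
    SmoothFormAt (formA L) p := by
  refine smoothFormAt_der_snd (C := fun p p' => (L.g p)⁻¹ * L.g p') (e := 1) ?_
    (Filter.Eventually.of_forall fun p => inv_mul_cancel _)
  have h := smoothAt_g L hp
  have h1 : ContMDiffAt (𝓘(ℝ, E₀).prod 𝓘(ℝ, E₀)) 𝓘(ℝ, EG) ∞ (fun z : P₀ × P₀ => L.g z.1) (p, p) :=
    ContMDiffAt.comp (p, p) (g := L.g) h contMDiffAt_fst
  have h2 : ContMDiffAt (𝓘(ℝ, E₀).prod 𝓘(ℝ, E₀)) 𝓘(ℝ, EG) ∞ (fun z : P₀ × P₀ => L.g z.2) (p, p) :=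
    ContMDiffAt.comp (p, p) (g := L.g) h contMDiffAt_snd
  exact h1.inv.mul h2

theorem smoothFormAt_formB [LieGroup 𝓘(ℝ, EG) ∞ G] [LieGroup 𝓘(ℝ, EH) ∞ H] [IsManifold 𝓘(ℝ, E₁) ∞ P₁]
    (hσ : ContMDiffOn 𝓘(ℝ, EM) 𝓘(ℝ, E₀) ∞ σ U) {L L' : B.Lift σ U} {ρ : P₁}
    (hs : B.P.src ρ ∈ L.V) (ht : B.P.tgt ρ ∈ L'.V) : SmoothFormAt (formB L L') ρ := by
  refine smoothFormAt_der_snd (C := fun ρ ρ' => Γ.α (L.g (B.P.src ρ))⁻¹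
    ((transition L L' ρ)⁻¹ * transition L L' ρ')) (e := 1) ?_
    (Filter.Eventually.of_forall fun p => by simp)
  have h := smoothAt_transition hσ hs ht
  have hg : ContMDiffAt 𝓘(ℝ, E₁) 𝓘(ℝ, EG) ∞ (fun ρ => L.g (B.P.src ρ)) ρ :=
    ContMDiffAt.comp ρ (g := L.g) (smoothAt_g L hs) B.smooth_src.contMDiffAt
  have h0 : ContMDiffAt (𝓘(ℝ, E₁).prod 𝓘(ℝ, E₁)) 𝓘(ℝ, EG) ∞
      (fun z : P₁ × P₁ => L.g (B.P.src z.1)) (ρ, ρ) :=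
    ContMDiffAt.comp (ρ, ρ) (g := fun ρ => L.g (B.P.src ρ)) hg contMDiffAt_fst
  have h1 : ContMDiffAt (𝓘(ℝ, E₁).prod 𝓘(ℝ, E₁)) 𝓘(ℝ, EH) ∞
      (fun z : P₁ × P₁ => transition L L' z.1) (ρ, ρ) :=
    ContMDiffAt.comp (ρ, ρ) (g := transition L L') h contMDiffAt_fst
  have h2 : ContMDiffAt (𝓘(ℝ, E₁).prod 𝓘(ℝ, E₁)) 𝓘(ℝ, EH) ∞
      (fun z : P₁ × P₁ => transition L L' z.2) (ρ, ρ) :=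
    ContMDiffAt.comp (ρ, ρ) (g := transition L L') h contMDiffAt_snd
  exact Γ.smooth_α.contMDiffAt.comp (ρ, ρ) (h0.inv.prodMk (h1.inv.mul h2))

/-- The relation `Δ a = t_* b` for the forms defined by lifts. -/
theorem tStar_formB [LieGroup 𝓘(ℝ, EG) ∞ G] [LieGroup 𝓘(ℝ, EH) ∞ H]
    (hσ : ContMDiffOn 𝓘(ℝ, EM) 𝓘(ℝ, E₀) ∞ σ U) {L L' : B.Lift σ U} {ρ : P₁}
    (hs : B.P.src ρ ∈ L.V) (ht : B.P.tgt ρ ∈ L'.V) :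
    Γ.tStar.comp (formB L L' ρ) =
      (formA L' (B.P.tgt ρ)).comp (der 𝓘(ℝ, E₁) 𝓘(ℝ, E₀) B.P.tgt ρ) -
        (formA L (B.P.src ρ)).comp (der 𝓘(ℝ, E₁) 𝓘(ℝ, E₀) B.P.src ρ) := by
  have hsrc := mdiffAt (B.smooth_src.contMDiffAt (x := ρ))
  have htgt := mdiffAt (B.smooth_tgt.contMDiffAt (x := ρ))
  have h1 := der_comp_of_eq (g := Γ.t) (y := 1) (mdiffAt Γ.smooth_t.contMDiffAt)
    (mdiffAt_twoPoint_transition hσ hs ht (L.g (B.P.src ρ))⁻¹ (transition L L' ρ)⁻¹) (by simp)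
  have h2 := mdiffAt_twoPoint_g L' ht (L'.g (B.P.tgt ρ))⁻¹
  have h3 := mdiffAt_twoPoint_g L hs (L.g (B.P.src ρ))⁻¹
  have h2' := h2.comp ρ htgt
  have h3' := h3.comp ρ hsrc
  have h4 := der_inv h3' (by simp)
  have h5 := der_mul h2' ((mdiffAt (contMDiff_inv 𝓘(ℝ, EG) ∞).contMDiffAt).comp ρ h3')
    (by simp) (by simp)
  refine (h1.symm.trans ?_).trans (h5.trans ?_)
  -- With `h = transition L L' ρ`, `h'` its value at `ρ'`, and `g, g₁` and `g', g₁'` the values of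
  -- `L.g` at the source and `L'.g` at the target of `ρ` and `ρ'`, the identity is `t(α(g⁻¹, h⁻¹h'))
  -- = (g₁⁻¹g₁')(g⁻¹g')⁻¹`.
  · refine der_congr ?_
    filter_upwards [(isOpen_transition L L').mem_nhds ⟨hs, ht⟩] with ρ' hρ'
    have e1 := t_transition hs ht
    have e2 := t_transition hρ'.1 hρ'.2
    simp only [Function.comp_apply]
    rw [Γ.t_α, map_mul, map_inv, ← e1, ← e2]
    group
  · rw [sub_eq_add_neg]
    refine congrArg₂ (· + ·) (der_comp h2 htgt) (h4.trans ?_)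
    exact congrArg _ (der_comp h3 hsrc)

/-- Equivariance of the form `formA`. -/
theorem formA_R [LieGroup 𝓘(ℝ, EG) ∞ G] (hR₀ : ContMDiff (𝓘(ℝ, E₀).prod 𝓘(ℝ, EG)) 𝓘(ℝ, E₀) ∞ B.R₀)
    (L : B.Lift σ U) {p : P₀} (hp : p ∈ L.V) (k : G) :
    (formA L (B.R₀ (p, k))).comp (der (𝓘(ℝ, E₀).prod 𝓘(ℝ, EG)) 𝓘(ℝ, E₀) B.R₀ (p, k)) =
      ((Ad EG k⁻¹).comp (formA L p)).comp (ContinuousLinearMap.fst ℝ E₀ EG) +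
        (der 𝓘(ℝ, EG) 𝓘(ℝ, EG) (fun x : G => k⁻¹ * x) k).comp
          (ContinuousLinearMap.snd ℝ E₀ EG) := by
  have h0 := mdiffAt_twoPoint_g L (L.invariant p hp k) (L.g (B.R₀ (p, k)))⁻¹
  have h1 := der_comp (x := (p, k)) h0 (mdiffAt hR₀.contMDiffAt)
  have h2 := mdiffAt_twoPoint_g L hp (L.g p)⁻¹
  have hfst : MDifferentiableAt (𝓘(ℝ, E₀).prod 𝓘(ℝ, EG)) 𝓘(ℝ, E₀) Prod.fst (p, k) :=
    mdifferentiableAt_fst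
  have hsnd : MDifferentiableAt (𝓘(ℝ, E₀).prod 𝓘(ℝ, EG)) 𝓘(ℝ, EG) Prod.snd (p, k) :=
    mdifferentiableAt_snd
  have hc : MDifferentiableAt 𝓘(ℝ, EG) 𝓘(ℝ, EG) (fun x : G => k⁻¹ * x * k⁻¹⁻¹) 1 :=
    mdiffAt ((contMDiff_const.mul contMDiff_id).mul contMDiff_const).contMDiffAt
  have hl : MDifferentiableAt 𝓘(ℝ, EG) 𝓘(ℝ, EG) (fun x : G => k⁻¹ * x) k :=
    mdiffAt contMDiff_mul_left.contMDiffAt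
  have h3 := h2.comp (p, k) hfst
  have h4 := der_comp_of_eq hc h3 (by simp)
  have hc3 : MDifferentiableAt (𝓘(ℝ, E₀).prod 𝓘(ℝ, EG)) 𝓘(ℝ, EG)
      (fun z : P₀ × G => k⁻¹ * ((L.g p)⁻¹ * L.g z.1) * k⁻¹⁻¹) (p, k) :=
    MDifferentiableAt.comp_of_eq (p, k) (g := fun x : G => k⁻¹ * x * k⁻¹⁻¹) hc h3 (by simp)
  have h5 := der_mul hc3 (hl.comp (p, k) hsnd) (by simp) (by simp)
  refine (h1.symm.trans ?_).trans (h5.trans ?_)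
  -- The two-point function splits as `k⁻¹(g(p)⁻¹g(p'))k · k⁻¹k'`: the first factor yields the
  -- adjoint term and the second the Maurer-Cartan form.
  · refine der_congr ?_
    filter_upwards [(L.isOpen.preimage continuous_fst).mem_nhds (show (p, k) ∈ _ from hp)]
      with z hz
    obtain ⟨p', k'⟩ := z
    simp only [Function.comp_apply]
    rw [L.g_mul _ hp, L.g_mul _ hz]
    group
  · refine congrArg₂ (· + ·) (h4.trans ?_) ((der_comp hl hsnd).trans ?_)
    · rw [ContinuousLinearMap.comp_assoc]
      refine congrArg (ContinuousLinearMap.comp (Ad EG k⁻¹)) ((der_comp h2 hfst).trans ?_)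
      rw [der_fst]; rfl
    · rw [der_snd]

/-- Equivariance of the form `formB`. -/
theorem formB_R [LieGroup 𝓘(ℝ, EG) ∞ G] [LieGroup 𝓘(ℝ, EH) ∞ H]
    (hσ : ContMDiffOn 𝓘(ℝ, EM) 𝓘(ℝ, E₀) ∞ σ U) {L L' : B.Lift σ U} {ρ : P₁}
    (hs : B.P.src ρ ∈ L.V) (ht : B.P.tgt ρ ∈ L'.V) (h : H) (k : G) (v : E₁ × (EH × EG)) :
    formB L L' (B.R₁ (ρ, (h, k)))
      (der (𝓘(ℝ, E₁).prod (𝓘(ℝ, EH).prod 𝓘(ℝ, EG))) 𝓘(ℝ, E₁) B.R₁ (ρ, (h, k)) v) =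
      Ad EH (Γ.invMor (h, k)).1 (Γ.αStar (Γ.invMor (h, k)).2 (formB L L' ρ v.1)) +
      Γ.αTildeStar (Γ.invMor (h, k)).1⁻¹ (Ad EG (Γ.invMor (h, k)).2
        (formA L (B.P.src ρ) (der 𝓘(ℝ, E₁) 𝓘(ℝ, E₀) B.P.src ρ v.1))) +
      Γ.αStar k⁻¹ (der 𝓘(ℝ, EH) 𝓘(ℝ, EH) (fun x : H => h⁻¹ * x) h v.2.1) := by
  simp only [CrossedModule.invMor]
  set J := 𝓘(ℝ, E₁).prod (𝓘(ℝ, EH).prod 𝓘(ℝ, EG)) with hJ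
  set z₀ : P₁ × (H × G) := (ρ, (h, k)) with hz₀
  have hR₁ := B.action.smooth_functor.smooth_mor
  have hs' : B.P.src (B.R₁ z₀) ∈ L.V := by rw [B.src_R]; exact L.invariant _ hs _
  have ht' : B.P.tgt (B.R₁ z₀) ∈ L'.V := by rw [B.tgt_R]; exact L'.invariant _ ht _
  have hfst : MDifferentiableAt J 𝓘(ℝ, E₁) Prod.fst z₀ := mdifferentiableAt_fst
  have hsnd : MDifferentiableAt J 𝓘(ℝ, EH) (fun z : P₁ × (H × G) => z.2.1) z₀ :=
    mdifferentiableAt_snd.fst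
  have hdsnd : der J 𝓘(ℝ, EH) (fun z : P₁ × (H × G) => z.2.1) z₀ =
      (ContinuousLinearMap.fst ℝ EH EG).comp (ContinuousLinearMap.snd ℝ E₁ (EH × EG)) := by
    have := der_comp (J := 𝓘(ℝ, EH).prod 𝓘(ℝ, EG)) (J' := 𝓘(ℝ, EH)) (x := z₀) (I := J)
      (g := (Prod.fst : H × G → H)) (f := (Prod.snd : P₁ × (H × G) → H × G))
      mdifferentiableAt_fst mdifferentiableAt_snd
    rw [der_fst, der_snd] at this
    exact this
  have hdfst : der J 𝓘(ℝ, E₁) (Prod.fst : P₁ × (H × G) → P₁) z₀ =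
      ContinuousLinearMap.fst ℝ E₁ (EH × EG) := der_fst z₀
  -- the factor depending on the transition function
  have hC := mdiffAt_twoPoint_transition hσ hs ht (L.g (B.P.src ρ))⁻¹ (transition L L' ρ)⁻¹
  have hC1 := hC.comp z₀ hfst
  have hαk : ∀ g x, MDifferentiableAt 𝓘(ℝ, EH) 𝓘(ℝ, EH) (fun h : H => Γ.α g h) x :=
    fun g x => mdiffAt (Γ.smooth_α_right g).contMDiffAt
  have hαC : MDifferentiableAt J 𝓘(ℝ, EH) (fun z : P₁ × (H × G) => Γ.α k⁻¹
      (Γ.α (L.g (B.P.src ρ))⁻¹ ((transition L L' ρ)⁻¹ * transition L L' z.1))) z₀ :=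
    (hαk k⁻¹ _).comp z₀ hC1
  have hconj : MDifferentiableAt 𝓘(ℝ, EH) 𝓘(ℝ, EH)
      (fun x : H => Γ.α k⁻¹ h⁻¹ * x * (Γ.α k⁻¹ h⁻¹)⁻¹) 1 :=
    mdiffAt ((contMDiff_const.mul contMDiff_id).mul contMDiff_const).contMDiffAt
  have hT1 : MDifferentiableAt J 𝓘(ℝ, EH) (fun z : P₁ × (H × G) => Γ.α k⁻¹ h⁻¹ * Γ.α k⁻¹
      (Γ.α (L.g (B.P.src ρ))⁻¹ ((transition L L' ρ)⁻¹ * transition L L' z.1)) *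
        (Γ.α k⁻¹ h⁻¹)⁻¹) z₀ :=
    MDifferentiableAt.comp_of_eq z₀ (g := fun x : H => Γ.α k⁻¹ h⁻¹ * x * (Γ.α k⁻¹ h⁻¹)⁻¹)
      hconj hαC (by simp [hz₀])
  have hD1 := der_comp_of_eq hconj hαC (by simp [hz₀])
  have hD1' := der_comp_of_eq (y := 1) (hαk k⁻¹ 1) hC1 (by simp [hz₀])
  have hD1'' := der_comp hC hfst
  -- the factor depending on the map `g` of the lift
  have hK := mdiffAt_twoPoint_g L hs (L.g (B.P.src ρ))⁻¹
  have hsrc := mdiffAt (B.smooth_src.contMDiffAt (x := ρ))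
  have hKs := hK.comp ρ hsrc
  have hK1 := hKs.comp z₀ hfst
  have hconjG : MDifferentiableAt 𝓘(ℝ, EG) 𝓘(ℝ, EG) (fun x : G => k⁻¹ * x * k⁻¹⁻¹) 1 :=
    mdiffAt ((contMDiff_const.mul contMDiff_id).mul contMDiff_const).contMDiffAt
  have hcK : MDifferentiableAt J 𝓘(ℝ, EG) (fun z : P₁ × (H × G) =>
      k⁻¹ * ((L.g (B.P.src ρ))⁻¹ * L.g (B.P.src z.1)) * k⁻¹⁻¹) z₀ :=
    MDifferentiableAt.comp_of_eq z₀ (g := fun x : G => k⁻¹ * x * k⁻¹⁻¹) hconjG hK1 (by simp [hz₀])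
  have htil : MDifferentiableAt 𝓘(ℝ, EG) 𝓘(ℝ, EH)
      (fun g : G => (Γ.α k⁻¹ h⁻¹)⁻¹⁻¹ * Γ.α g (Γ.α k⁻¹ h⁻¹)⁻¹) 1 :=
    mdiffAt (contMDiff_const.mul (Γ.smooth_α_left _)).contMDiffAt
  have hT2 : MDifferentiableAt J 𝓘(ℝ, EH) (fun z : P₁ × (H × G) => (Γ.α k⁻¹ h⁻¹)⁻¹⁻¹ *
      Γ.α (k⁻¹ * ((L.g (B.P.src ρ))⁻¹ * L.g (B.P.src z.1)) * k⁻¹⁻¹) (Γ.α k⁻¹ h⁻¹)⁻¹) z₀ :=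
    MDifferentiableAt.comp_of_eq z₀
      (g := fun g : G => (Γ.α k⁻¹ h⁻¹)⁻¹⁻¹ * Γ.α g (Γ.α k⁻¹ h⁻¹)⁻¹) htil hcK (by simp [hz₀])
  have hD2 := der_comp_of_eq (y := 1) htil hcK (by simp [hz₀])
  have hD2' := der_comp_of_eq (y := 1) hconjG hK1 (by simp [hz₀])
  have hD2'' := (der_comp hKs hfst).trans (congrArg (fun A => ContinuousLinearMap.comp A
    (der J 𝓘(ℝ, E₁) Prod.fst z₀)) (der_comp hK hsrc))
  -- the factor depending on the group element
  have hl : MDifferentiableAt 𝓘(ℝ, EH) 𝓘(ℝ, EH) (fun x : H => h⁻¹ * x) h :=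
    mdiffAt contMDiff_mul_left.contMDiffAt
  have hl1 : MDifferentiableAt J 𝓘(ℝ, EH) (fun z : P₁ × (H × G) => h⁻¹ * z.2.1) z₀ :=
    hl.comp z₀ hsnd
  have hD3'' := der_comp hl hsnd
  -- Since `α(y, 1) = 1` for every `y`, the first variable contributes nothing at the unit, and only
  -- the derivative of `h⁻¹ * z.2.1` remains.
  have hD3' := der_two (μ := fun x : G × H => Γ.α x.1 x.2) (L := 𝓘(ℝ, EH)) (y := 1) (z := 1)
    (by simp [hz₀]) (by simp [hz₀]) (mdiffAt Γ.smooth_α.contMDiffAt) hK1 hl1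
  simp only [map_one, MulAut.one_apply, der_const, der_id, ContinuousLinearMap.zero_comp, zero_add,
    ContinuousLinearMap.id_comp] at hD3'
  have hα1 : MDifferentiableAt J 𝓘(ℝ, EH) (fun z : P₁ × (H × G) =>
      Γ.α ((L.g (B.P.src ρ))⁻¹ * L.g (B.P.src z.1)) (h⁻¹ * z.2.1)) z₀ :=
    MDifferentiableAt.comp z₀ (g := fun x : G × H => Γ.α x.1 x.2)
      (mdiffAt Γ.smooth_α.contMDiffAt) (hK1.prodMk hl1)
  have hT3 : MDifferentiableAt J 𝓘(ℝ, EH) (fun z : P₁ × (H × G) =>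
      Γ.α k⁻¹ (Γ.α ((L.g (B.P.src ρ))⁻¹ * L.g (B.P.src z.1)) (h⁻¹ * z.2.1))) z₀ :=
    (hαk k⁻¹ _).comp z₀ hα1
  have hD3 := der_comp_of_eq (y := 1) (hαk k⁻¹ 1) hα1 (by simp [hz₀])
  -- assembling the factors
  have hT12 : MDifferentiableAt J 𝓘(ℝ, EH) _ z₀ :=
    MDifferentiableAt.comp z₀ (g := fun z : H × H => z.1 * z.2)
      (mdiffAt (contMDiff_mul 𝓘(ℝ, EH) ∞).contMDiffAt) (hT1.prodMk hT2)
  have hsum := der_mul hT12 hT3 (by simp [hz₀]) (by simp [hz₀])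
  have hsum' := der_mul hT1 hT2 (by simp [hz₀]) (by simp [hz₀])
  have hL := der_comp (x := z₀) (mdiffAt_twoPoint_transition hσ hs' ht'
    (L.g (B.P.src (B.R₁ z₀)))⁻¹ (transition L L' (B.R₁ z₀))⁻¹) (mdiffAt hR₁.contMDiffAt)
  have hmain : (formB L L' (B.R₁ z₀)).comp (der J 𝓘(ℝ, E₁) B.R₁ z₀) =
      (Ad EH (Γ.α k⁻¹ h⁻¹)).comp ((Γ.αStar k⁻¹).comp ((formB L L' ρ).comp
        (ContinuousLinearMap.fst ℝ E₁ (EH × EG)))) +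
      (Γ.αTildeStar (Γ.α k⁻¹ h⁻¹)⁻¹).comp ((Ad EG k⁻¹).comp (((formA L (B.P.src ρ)).comp
        (der 𝓘(ℝ, E₁) 𝓘(ℝ, E₀) B.P.src ρ)).comp (ContinuousLinearMap.fst ℝ E₁ (EH × EG)))) +
      (Γ.αStar k⁻¹).comp ((der 𝓘(ℝ, EH) 𝓘(ℝ, EH) (fun x : H => h⁻¹ * x) h).comp
        ((ContinuousLinearMap.fst ℝ EH EG).comp (ContinuousLinearMap.snd ℝ E₁ (EH × EG)))) := by
    rw [← hdsnd, ← hdfst]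
    refine (hL.symm.trans ?_).trans (hsum.trans (congrArg₂ (· + ·) (hsum'.trans
      (congrArg₂ (· + ·) (hD1.trans (congrArg _ (hD1'.trans (congrArg _ hD1''))))
        (hD2.trans (congrArg _ (hD2'.trans (congrArg _ hD2''))))))
        (hD3.trans (congrArg _ (hD3'.trans hD3'')))))
    -- Write `C` for the two-point function of `formB L L' ρ` and `K` for that of `formA L` along
    -- the source. By `transition_R` the translated two-point function is `α(k⁻¹, h⁻¹ C α(K, h'))`,
    -- and `h⁻¹ C α(K, h') = (h⁻¹Ch)(h⁻¹α(K, h)) α(K, h⁻¹h')`. All three factors are 1 at the base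
    -- point, and they produce the three summands.
    refine der_congr ?_
    have hopen := ((isOpen_transition L L').preimage (continuous_fst (Y := H × G))).mem_nhds
      (show z₀ ∈ _ from ⟨hs, ht⟩)
    filter_upwards [hopen] with z hz
    obtain ⟨ρ', h', k'⟩ := z
    simp only [Function.comp_apply, hz₀]
    rw [B.src_R, L.g_mul _ hs, transition_R hs ht, transition_R hz.1 hz.2]
    simp [mul_assoc]
  simpa using congrArg (fun A : E₁ × (EH × EG) →L[ℝ] EH => A v) hmain

/-- The relation `Δ b = 0` for the forms defined by lifts. -/
theorem formB_comp [LieGroup 𝓘(ℝ, EH) ∞ H]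
    (hσ : ContMDiffOn 𝓘(ℝ, EM) 𝓘(ℝ, E₀) ∞ σ U) {L L' L'' : B.Lift σ U} {ξ η : P₁}
    (hξη : B.P.src ξ = B.P.tgt η) (h₁ : B.P.src η ∈ L.V)
    (h₂ : B.P.tgt η ∈ L'.V) (h₃ : B.P.tgt ξ ∈ L''.V) {v w : E₁}
    (hvw : der 𝓘(ℝ, E₁) 𝓘(ℝ, E₀) B.P.src ξ v = der 𝓘(ℝ, E₁) 𝓘(ℝ, E₀) B.P.tgt η w)
    {D : E₁ × E₁ →L[ℝ] E₁} (hD : HasMFDerivWithinAt (𝓘(ℝ, E₁).prod 𝓘(ℝ, E₁)) 𝓘(ℝ, E₁)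
      B.P.compPair B.P.composable (ξ, η) D) :
    formB L L'' (B.P.comp ξ η) (D (v, w)) = formB L' L'' ξ v + formB L L' η w := by
  -- Composition is differentiable only within the composable pairs, in general not a neighbourhood.
  -- Moving the first morphism by `Λ` into the source fibre over the target of the second maps a
  -- neighbourhood of `(ξ, η)` into that set. The derivative of this map fixes `(v, w)` because
  -- `ds(v) = dt(w)`, so the unrestricted chain rule becomes available.
  obtain ⟨Λ, O, hO, hmem, hΛ, hΛs, hΛfix⟩ :=
    exists_submersion_lift B.isLieGroupoid.submersion_src ξ
  set J := 𝓘(ℝ, E₁).prod 𝓘(ℝ, E₁) with hJ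
  have hΛξ : Λ (B.P.tgt η, ξ) = ξ := by rw [← hξη]; exact hΛfix ξ hmem
  have hfst : MDifferentiableAt J 𝓘(ℝ, E₁) Prod.fst (ξ, η) := mdifferentiableAt_fst
  have hsnd : MDifferentiableAt J 𝓘(ℝ, E₁) Prod.snd (ξ, η) := mdifferentiableAt_snd
  have hsrc := mdiffAt (B.smooth_src.contMDiffAt (x := ξ))
  have htgt := mdiffAt (B.smooth_tgt.contMDiffAt (x := η))
  have hΛd : MDifferentiableAt (𝓘(ℝ, E₀).prod 𝓘(ℝ, E₁)) 𝓘(ℝ, E₁) Λ (B.P.src ξ, ξ) :=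
    mdiffAt (hΛ.contMDiffAt (hO.mem_nhds hmem))
  have hpt : MDifferentiableAt J (𝓘(ℝ, E₀).prod 𝓘(ℝ, E₁))
      (fun z : P₁ × P₁ => (B.P.tgt z.2, z.1)) (ξ, η) :=
    (MDifferentiableAt.comp (ξ, η) (g := B.P.tgt) (f := Prod.snd) htgt hsnd).prodMk hfst
  have hps : MDifferentiableAt 𝓘(ℝ, E₁) (𝓘(ℝ, E₀).prod 𝓘(ℝ, E₁))
      (fun x : P₁ => (B.P.src x, x)) ξ := hsrc.prodMk mdifferentiableAt_id
  -- the first component of the map into the composable pairs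
  set Ψ : P₁ × P₁ → P₁ := fun z => Λ (B.P.tgt z.2, z.1) with hΨ
  have hΨξ : Ψ (ξ, η) = ξ := hΛξ
  have hΨd : MDifferentiableAt J 𝓘(ℝ, E₁) Ψ (ξ, η) :=
    MDifferentiableAt.comp_of_eq (ξ, η) (g := Λ) hΛd hpt (by simp [hξη])
  have hΨv : der J 𝓘(ℝ, E₁) Ψ (ξ, η) (v, w) = v := by
    have e1 : der J 𝓘(ℝ, E₁) Ψ (ξ, η) = _ := der_comp_of_eq hΛd hpt (by simp [hξη])
    have e2 := der_comp (g := Λ) (f := fun x : P₁ => (B.P.src x, x)) hΛd hps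
    have e3 : der 𝓘(ℝ, E₁) 𝓘(ℝ, E₁) (fun x => Λ (B.P.src x, x)) ξ =
        ContinuousLinearMap.id ℝ E₁ := by
      rw [← der_id (I := 𝓘(ℝ, E₁)) ξ]
      refine der_congr ?_
      have hc : Continuous (fun x : P₁ => (B.P.src x, x)) :=
        B.smooth_src.continuous.prodMk continuous_id
      filter_upwards [(hO.preimage hc).mem_nhds hmem] with x hx using hΛfix x hx
    have e4 : der J (𝓘(ℝ, E₀).prod 𝓘(ℝ, E₁)) (fun z : P₁ × P₁ => (B.P.tgt z.2, z.1)) (ξ, η)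
        (v, w) = der 𝓘(ℝ, E₁) (𝓘(ℝ, E₀).prod 𝓘(ℝ, E₁)) (fun x : P₁ => (B.P.src x, x)) ξ v := by
      rw [der_prodMk (J := 𝓘(ℝ, E₀)) (J' := 𝓘(ℝ, E₁)) (f := fun z : P₁ × P₁ => B.P.tgt z.2)
        (MDifferentiableAt.comp (ξ, η) (g := B.P.tgt) (f := Prod.snd) htgt hsnd) hfst,
        der_prodMk (g := fun x : P₁ => x) hsrc mdifferentiableAt_id, der_id, der_comp (x := (ξ, η)) htgt hsnd, der_fst,
        der_snd]
      exact Prod.ext hvw.symm rfl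
    have e5 := congrArg (fun A : E₁ →L[ℝ] E₁ => A v) (e2.symm.trans e3)
    rw [e1]
    simp only [ContinuousLinearMap.comp_apply, ContinuousLinearMap.id_apply] at e5 ⊢
    rw [e4, e5]
  have hcont : ContinuousAt (fun z : P₁ × P₁ => (B.P.tgt z.2, z.1)) (ξ, η) := hpt.continuousAt
  have hevO : ∀ᶠ z in 𝓝 (ξ, η), (B.P.tgt z.2, z.1) ∈ O :=
    hcont.eventually_mem (by simpa [← hξη] using hO.mem_nhds hmem)
  have hcomposable : ∀ᶠ z in 𝓝 (ξ, η), (Ψ z, z.2) ∈ B.P.composable := by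
    filter_upwards [hevO] with z hz using hΛs _ hz
  -- the derivative of the composition
  have hpair := hΨd.prodMk hsnd
  have hcompd : HasMFDerivAt J 𝓘(ℝ, E₁) (fun z => B.P.compPair (Ψ z, z.2)) (ξ, η)
      (D.comp (der J J (fun z : P₁ × P₁ => (Ψ z, z.2)) (ξ, η))) := by
    have e1 : HasMFDerivWithinAt J 𝓘(ℝ, E₁) B.P.compPair B.P.composable
        ((fun z : P₁ × P₁ => (Ψ z, z.2)) (ξ, η)) D := by
      change HasMFDerivWithinAt J 𝓘(ℝ, E₁) B.P.compPair B.P.composable (Ψ (ξ, η), η) D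
      rw [hΨξ]; exact hD
    exact (HasMFDerivWithinAt.comp (ξ, η) e1 hpair.hasMFDerivAt.hasMFDerivWithinAt
      subset_rfl).hasMFDerivAt hcomposable
  have hderpair : der J J (fun z : P₁ × P₁ => (Ψ z, z.2)) (ξ, η) (v, w) = (v, w) := by
    rw [der_prodMk hΨd hsnd, der_snd]
    exact Prod.ext hΨv rfl
  have hcompv : der J 𝓘(ℝ, E₁) (fun z => B.P.compPair (Ψ z, z.2)) (ξ, η) (v, w) = D (v, w) := by
    have e1 : der J 𝓘(ℝ, E₁) (fun z => B.P.compPair (Ψ z, z.2)) (ξ, η) =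
        D.comp (der J J (fun z : P₁ × P₁ => (Ψ z, z.2)) (ξ, η)) := hcompd.mfderiv
    rw [e1, ContinuousLinearMap.comp_apply, hderpair]
  -- the two-point functions
  have hs₃ : B.P.src (B.P.comp ξ η) ∈ L.V := by rwa [B.isLieGroupoid.src_comp _ _ hξη]
  have ht₃ : B.P.tgt (B.P.comp ξ η) ∈ L''.V := by rwa [B.isLieGroupoid.tgt_comp _ _ hξη]
  have h₂' : B.P.src ξ ∈ L'.V := by rwa [hξη]
  have hA := mdiffAt_twoPoint_transition hσ hs₃ ht₃ (L.g (B.P.src (B.P.comp ξ η)))⁻¹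
    (transition L L'' (B.P.comp ξ η))⁻¹
  have hB := mdiffAt_twoPoint_transition hσ h₂' h₃ (L'.g (B.P.src ξ))⁻¹ (transition L' L'' ξ)⁻¹
  have hC := mdiffAt_twoPoint_transition hσ h₁ h₂ (L.g (B.P.src η))⁻¹ (transition L L' η)⁻¹
  have hcp : B.P.compPair (Ψ (ξ, η), η) = B.P.comp ξ η := by rw [hΨξ]; rfl
  have eA := der_comp_of_eq hA hcompd.mdifferentiableAt hcp
  have eB := der_comp_of_eq hB hΨd hΨξ
  have eC := der_comp (x := (ξ, η)) hC hsnd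
  have hB' : MDifferentiableAt J 𝓘(ℝ, EH) (fun z => Γ.α (L'.g (B.P.src ξ))⁻¹
      ((transition L' L'' ξ)⁻¹ * transition L' L'' (Ψ z))) (ξ, η) :=
    MDifferentiableAt.comp_of_eq (ξ, η) (f := Ψ) (g := fun ρ' => Γ.α (L'.g (B.P.src ξ))⁻¹
      ((transition L' L'' ξ)⁻¹ * transition L' L'' ρ')) hB hΨd hΨξ
  have hmul := der_mul hB' (hC.comp (ξ, η) hsnd) (by simp [hΨξ]) (by simp)
  have hevL : ∀ᶠ z in 𝓝 (ξ, η), B.P.src z.2 ∈ L.V ∧ B.P.tgt z.2 ∈ L'.V :=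
    ((isOpen_transition L L').preimage continuous_snd).mem_nhds (show (ξ, η) ∈ _ from ⟨h₁, h₂⟩)
  have hevL'' : ∀ᶠ z in 𝓝 (ξ, η), B.P.tgt (Ψ z) ∈ L''.V := by
    refine hΨd.continuousAt.eventually
      ((L''.isOpen.preimage B.smooth_tgt.continuous).mem_nhds ?_)
    rw [hΨξ]; exact h₃
  have hfun : der J 𝓘(ℝ, EH) (fun z => Γ.α (L.g (B.P.src (B.P.comp ξ η)))⁻¹
      ((transition L L'' (B.P.comp ξ η))⁻¹ * transition L L'' (B.P.compPair (Ψ z, z.2)))) (ξ, η) =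
      (formB L' L'' ξ).comp (der J 𝓘(ℝ, E₁) Ψ (ξ, η)) +
        (formB L L' η).comp (ContinuousLinearMap.snd ℝ E₁ E₁) := by
    rw [← der_snd (I := 𝓘(ℝ, E₁)) (J := 𝓘(ℝ, E₁)) (ξ, η)]
    refine Eq.trans (der_congr ?_) (hmul.trans (congrArg₂ (· + ·) eB eC))
    -- By multiplicativity the two-point function of the composite is `α(g⁻¹, k⁻¹ x k) α(g⁻¹, k⁻¹
    -- k')`, where `k, k'` are the transitions of `η` and of the varying second morphism, and `x` is
    -- the untwisted two-point function for `ξ`. The Peiffer identity rewrites the first factor as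
    -- `α((t(k) g)⁻¹, x)`, and `t(k) g` is the value of `L'.g` at the source of `ξ`.
    filter_upwards [hcomposable, hevL, hevL''] with z hz hzL hzL''
    have e1 := t_transition h₁ h₂
    change Γ.α _ (_ * transition L L'' (B.P.comp (Ψ z) z.2)) = _
    rw [transition_comp hξη h₁ h₂ h₃, transition_comp hz hzL.1 hzL.2 hzL'',
      B.isLieGroupoid.src_comp _ _ hξη, hξη, ← e1]
    simp only [Function.comp_apply]
    rw [mul_inv_rev, mul_inv_rev, Γ.α_mul_apply, ← Γ.α_inv_conj, ← map_mul]
    congr 1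
    group
  have hfin := congrArg (fun A : E₁ × E₁ →L[ℝ] EH => A (v, w)) (eA.symm.trans hfun)
  simp only [ContinuousLinearMap.comp_apply, _root_.add_apply, hcompv, hΨv] at hfin
  exact hfin

end PrincipalTwoBundle

/-! ### Rearranging weighted sums. -/

section Sums

variable {V : Type*} [AddCommGroup V] [Module ℝ V]

/-- Inserting the total weight of the missing index allows terms with one index to be compared
summand by summand with the double sum defining the form on morphisms. -/
theorem sum_mul_smul_left {s : Finset ℕ} {c d : ℕ → ℝ} (hd : ∑ m ∈ s, d m = 1) (X : ℕ → V) :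
    ∑ n ∈ s, ∑ m ∈ s, (c n * d m) • X n = ∑ n ∈ s, c n • X n := by
  refine Finset.sum_congr rfl fun n _ => ?_
  rw [← Finset.sum_smul, ← Finset.mul_sum, hd, mul_one]

theorem sum_mul_smul_right {s : Finset ℕ} {c d : ℕ → ℝ} (hc : ∑ m ∈ s, c m = 1) (X : ℕ → V) :
    ∑ n ∈ s, ∑ m ∈ s, (c n * d m) • X m = ∑ n ∈ s, d n • X n := by
  rw [Finset.sum_comm]
  simpa only [mul_comm] using sum_mul_smul_left hc X

/-- Inserting the total weight of the index absent from each term turns all three into triple sums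
with the common weight `c n * d m * e l`. The cocycle relation is needed only where this weight is
nonzero, that is, where the transition functions are controlled. -/
theorem sum_mul_smul_cocycle {s : Finset ℕ} {c d e : ℕ → ℝ} (hc : ∑ n ∈ s, c n = 1)
    (hd : ∑ n ∈ s, d n = 1) (he : ∑ n ∈ s, e n = 1) {X Y Z : ℕ → ℕ → V}
    (h : ∀ n m l, c n ≠ 0 → d m ≠ 0 → e l ≠ 0 → X n l = Y m l + Z n m) :
    ∑ n ∈ s, ∑ l ∈ s, (c n * e l) • X n l =
      ∑ m ∈ s, ∑ l ∈ s, (d m * e l) • Y m l + ∑ n ∈ s, ∑ m ∈ s, (c n * d m) • Z n m := by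
  have h1 : ∑ n ∈ s, ∑ l ∈ s, (c n * e l) • X n l =
      ∑ n ∈ s, ∑ m ∈ s, ∑ l ∈ s, (c n * d m * e l) • X n l := by
    refine Finset.sum_congr rfl fun n _ => ?_
    rw [Finset.sum_comm]
    refine Finset.sum_congr rfl fun l _ => ?_
    rw [← Finset.sum_smul, ← Finset.sum_mul, ← Finset.mul_sum, hd, mul_one]
  have h2 : ∑ m ∈ s, ∑ l ∈ s, (d m * e l) • Y m l =
      ∑ n ∈ s, ∑ m ∈ s, ∑ l ∈ s, (c n * d m * e l) • Y m l := by
    symm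
    rw [Finset.sum_comm]
    refine Finset.sum_congr rfl fun m _ => ?_
    rw [Finset.sum_comm]
    refine Finset.sum_congr rfl fun l _ => ?_
    rw [← Finset.sum_smul]
    simp only [mul_assoc]
    rw [← Finset.sum_mul, hc, one_mul]
  have h3 : ∑ n ∈ s, ∑ m ∈ s, (c n * d m) • Z n m =
      ∑ n ∈ s, ∑ m ∈ s, ∑ l ∈ s, (c n * d m * e l) • Z n m := by
    refine Finset.sum_congr rfl fun n _ => Finset.sum_congr rfl fun m _ => ?_
    rw [← Finset.sum_smul, ← Finset.mul_sum, he, mul_one]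
  rw [h1, h2, h3]
  simp only [← Finset.sum_add_distrib, ← smul_add]
  refine Finset.sum_congr rfl fun n _ => Finset.sum_congr rfl fun m _ =>
    Finset.sum_congr rfl fun l _ => ?_
  by_cases hn : c n = 0
  · simp [hn]
  by_cases hm : d m = 0
  · simp [hm]
  by_cases hl : e l = 0
  · simp [hl]
  rw [h n m l hn hm hl]

end Sums

/-! ### Averaging and gluing connection forms. -/

section Connections

variable {EG EH G H EM E₀ E₁ M P₀ P₁ : Type*}
  [NormedAddCommGroup EG] [NormedSpace ℝ EG] [NormedAddCommGroup EH] [NormedSpace ℝ EH]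
  [TopologicalSpace G] [ChartedSpace EG G] [Group G]
  [TopologicalSpace H] [ChartedSpace EH H] [Group H]
  [NormedAddCommGroup EM] [NormedSpace ℝ EM] [TopologicalSpace M] [ChartedSpace EM M]
  [NormedAddCommGroup E₀] [NormedSpace ℝ E₀] [TopologicalSpace P₀] [ChartedSpace E₀ P₀]
  [NormedAddCommGroup E₁] [NormedSpace ℝ E₁] [TopologicalSpace P₁] [ChartedSpace E₁ P₁]
  {Γ : CrossedModule EG EH G H}

/-- The one-forms `a` and `b` satisfy, over the subset `U` of the base, the conditions on the first
two components of a connection. -/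
structure IsConnectionOver (B : PrincipalTwoBundle EM E₀ E₁ M P₀ P₁ Γ) (U : Set M)
    (a : P₀ → E₀ →L[ℝ] EG) (b : P₁ → E₁ →L[ℝ] EH) : Prop where
  smooth_a : ∀ p, B.π p ∈ U → SmoothFormAt a p
  smooth_b : ∀ ρ, B.π (B.P.src ρ) ∈ U → SmoothFormAt b ρ
  delta_a : ∀ ρ, B.π (B.P.src ρ) ∈ U → ∀ v,
    a (B.P.tgt ρ) (der 𝓘(ℝ, E₁) 𝓘(ℝ, E₀) B.P.tgt ρ v) -
      a (B.P.src ρ) (der 𝓘(ℝ, E₁) 𝓘(ℝ, E₀) B.P.src ρ v) = Γ.tStar (b ρ v)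
  delta_b : ∀ ξ η, B.P.src ξ = B.P.tgt η → B.π (B.P.src η) ∈ U → ∀ v w,
    der 𝓘(ℝ, E₁) 𝓘(ℝ, E₀) B.P.src ξ v = der 𝓘(ℝ, E₁) 𝓘(ℝ, E₀) B.P.tgt η w →
    ∀ D : E₁ × E₁ →L[ℝ] E₁, HasMFDerivWithinAt (𝓘(ℝ, E₁).prod 𝓘(ℝ, E₁)) 𝓘(ℝ, E₁)
      B.P.compPair B.P.composable (ξ, η) D → b (B.P.comp ξ η) (D (v, w)) = b ξ v + b η w
  equivariance_a : ∀ p k, B.π p ∈ U → ∀ v : E₀ × EG,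
    a (B.R₀ (p, k)) (der (𝓘(ℝ, E₀).prod 𝓘(ℝ, EG)) 𝓘(ℝ, E₀) B.R₀ (p, k) v) =
      Ad EG k⁻¹ (a p v.1) + der 𝓘(ℝ, EG) 𝓘(ℝ, EG) (fun x : G => k⁻¹ * x) k v.2
  equivariance_b : ∀ ρ h k, B.π (B.P.src ρ) ∈ U → ∀ v : E₁ × (EH × EG),
    b (B.R₁ (ρ, (h, k)))
      (der (𝓘(ℝ, E₁).prod (𝓘(ℝ, EH).prod 𝓘(ℝ, EG))) 𝓘(ℝ, E₁) B.R₁ (ρ, (h, k)) v) =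
      Ad EH (Γ.invMor (h, k)).1 (Γ.αStar (Γ.invMor (h, k)).2 (b ρ v.1)) +
      Γ.αTildeStar (Γ.invMor (h, k)).1⁻¹ (Ad EG (Γ.invMor (h, k)).2
        (a (B.P.src ρ) (der 𝓘(ℝ, E₁) 𝓘(ℝ, E₀) B.P.src ρ v.1))) +
      Γ.αStar k⁻¹ (der 𝓘(ℝ, EH) 𝓘(ℝ, EH) (fun x : H => h⁻¹ * x) h v.2.1)

/-- Weighted sums of the forms defined by lifts form a connection over the domain of a section. -/
theorem isConnectionOver_sum [LieGroup 𝓘(ℝ, EG) ∞ G] [LieGroup 𝓘(ℝ, EH) ∞ H]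
    [IsManifold 𝓘(ℝ, E₀) ∞ P₀] [IsManifold 𝓘(ℝ, E₁) ∞ P₁]
    {B : PrincipalTwoBundle EM E₀ E₁ M P₀ P₁ Γ} {σ : M → P₀} {U : Set M}
    (hσ : ContMDiffOn 𝓘(ℝ, EM) 𝓘(ℝ, E₀) ∞ σ U) (L : ℕ → B.Lift σ U) {χ : ℕ → P₀ → ℝ}
    (hχ : ∀ p, B.π p ∈ U → ∀ n, ContMDiffAt 𝓘(ℝ, E₀) 𝓘(ℝ, ℝ) ∞ (χ n) p)
    (hfin : ∀ p, B.π p ∈ U → ∃ N : ℕ, ∀ᶠ y in 𝓝 p, ∀ n, N ≤ n → χ n y = 0)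
    (hsum : ∀ p, B.π p ∈ U → ∑ᶠ n, χ n p = 1)
    (hsupp : ∀ n, ∀ p ∉ (L n).V, ∀ᶠ y in 𝓝 p, χ n y = 0)
    (hinv : ∀ n p k, χ n (B.R₀ (p, k)) = χ n p) :
    IsConnectionOver B U (fun p => ∑ᶠ n, χ n p • PrincipalTwoBundle.formA (L n) p)
      (fun ρ => ∑ᶠ i : ℕ × ℕ, (χ i.1 (B.P.src ρ) * χ i.2 (B.P.tgt ρ)) •
        PrincipalTwoBundle.formB (L i.1) (L i.2) ρ) := by
  have hmem : ∀ {n p}, χ n p ≠ 0 → p ∈ (L n).V := by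
    intro n p h
    by_contra hp
    exact h (hsupp n p hp).self_of_nhds
  have hval : ∀ {p : P₀} {N : ℕ}, (∀ n, N ≤ n → χ n p = 0) →
      ∑ᶠ n, χ n p • PrincipalTwoBundle.formA (L n) p =
        ∑ n ∈ Finset.range N, χ n p • PrincipalTwoBundle.formA (L n) p := by
    intro p N h
    refine finsum_eq_sum_of_support_subset _ fun n hn => ?_
    by_contra hn'
    exact hn (by simp [h n (by simpa using hn')])
  have hone : ∀ {p : P₀} {N : ℕ}, B.π p ∈ U → (∀ n, N ≤ n → χ n p = 0) →
      ∑ n ∈ Finset.range N, χ n p = 1 := by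
    intro p N hp h
    rw [← hsum p hp]
    refine (finsum_eq_sum_of_support_subset _ fun n hn => ?_).symm
    by_contra hn'
    exact hn (h n (by simpa using hn'))
  have hval' : ∀ {ρ : P₁} {N : ℕ}, (∀ n, N ≤ n → χ n (B.P.src ρ) = 0) →
      (∀ n, N ≤ n → χ n (B.P.tgt ρ) = 0) →
      ∑ᶠ i : ℕ × ℕ, (χ i.1 (B.P.src ρ) * χ i.2 (B.P.tgt ρ)) •
          PrincipalTwoBundle.formB (L i.1) (L i.2) ρ =
        ∑ n ∈ Finset.range N, ∑ m ∈ Finset.range N, (χ n (B.P.src ρ) * χ m (B.P.tgt ρ)) •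
          PrincipalTwoBundle.formB (L n) (L m) ρ := by
    intro ρ N h h'
    rw [← Finset.sum_product' (f := fun n m => (χ n (B.P.src ρ) * χ m (B.P.tgt ρ)) •
          PrincipalTwoBundle.formB (L n) (L m) ρ)]
    refine finsum_eq_sum_of_support_subset _ fun i hi => ?_
    by_contra hi'
    simp only [Finset.coe_product, Set.mem_prod, Finset.mem_coe, Finset.mem_range, not_and_or,
      not_lt] at hi'
    rcases hi' with hi' | hi'
    · exact hi (by simp [h _ hi'])
    · exact hi (by simp [h' _ hi'])
  -- The bound holds for every larger `N` as well, so that several objects can share one range of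
  -- summation.
  have hN : ∀ {p : P₀}, B.π p ∈ U → ∃ N₀ : ℕ, ∀ N, N₀ ≤ N → ∀ n, N ≤ n → χ n p = 0 := by
    intro p hp
    obtain ⟨N, hN⟩ := hfin p hp
    exact ⟨N, fun N' hN' n hn => hN.self_of_nhds n (hN'.trans hn)⟩
  have hπt : ∀ {ρ : P₁}, B.π (B.P.src ρ) ∈ U → B.π (B.P.tgt ρ) ∈ U := by
    intro ρ h
    rwa [← B.π_src_eq_π_tgt]
  have hsrcs := B.smooth_src
  have htgts := B.smooth_tgt
  refine ⟨?_, ?_, ?_, ?_, ?_, ?_⟩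
  · intro p hp
    obtain ⟨N, hN⟩ := hfin p hp
    refine SmoothFormAt.finsum (Finset.range N) ?_ (hχ p hp) fun n => ?_
    · filter_upwards [hN] with y hy n hn using hy n (by simpa using hn)
    · by_cases hpn : p ∈ (L n).V
      · exact Or.inl (PrincipalTwoBundle.smoothFormAt_formA (L n) hpn)
      · exact Or.inr (hsupp n p hpn)
  · intro ρ hρ
    obtain ⟨N, hN⟩ := hfin _ hρ
    obtain ⟨N', hN'⟩ := hfin _ (hπt hρ)
    have hs := hsrcs.continuous.continuousAt (x := ρ)
    have ht := htgts.continuous.continuousAt (x := ρ)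
    refine SmoothFormAt.finsum (Finset.range N ×ˢ Finset.range N') ?_ (fun i => ?_) fun i => ?_
    · filter_upwards [hs.eventually hN, ht.eventually hN'] with y hy hy' i hi
      simp only [Finset.mem_product, Finset.mem_range, not_and_or, not_lt] at hi
      rcases hi with hi | hi
      · rw [hy _ hi, zero_mul]
      · rw [hy' _ hi, mul_zero]
    · exact ContMDiffAt.mul
        (ContMDiffAt.comp ρ (g := χ i.1) (hχ _ hρ i.1) hsrcs.contMDiffAt)
        (ContMDiffAt.comp ρ (g := χ i.2) (hχ _ (hπt hρ) i.2) htgts.contMDiffAt)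
    · by_cases h1 : B.P.src ρ ∈ (L i.1).V
      · by_cases h2 : B.P.tgt ρ ∈ (L i.2).V
        · exact Or.inl (PrincipalTwoBundle.smoothFormAt_formB hσ h1 h2)
        · right
          filter_upwards [ht.eventually (hsupp i.2 _ h2)] with y hy
          rw [hy, mul_zero]
      · right
        filter_upwards [hs.eventually (hsupp i.1 _ h1)] with y hy
        rw [hy, zero_mul]
  · intro ρ hρ v
    obtain ⟨N₁, h₁⟩ := hN hρ
    obtain ⟨N₂, h₂⟩ := hN (hπt hρ)
    have h₁ := h₁ (max N₁ N₂) (le_max_left _ _)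
    have h₂ := h₂ (max N₁ N₂) (le_max_right _ _)
    simp only [hval h₁, hval h₂, hval' h₁ h₂, sum_apply,
      smul_apply, map_sum, map_smul]
    -- The form at the source is padded with the weights at the target and conversely, which reduces
    -- the claim to `tStar_formB` for each pair of lifts.
    rw [← sum_mul_smul_left (c := fun n => χ n (B.P.src ρ)) (hone (hπt hρ) h₂),
      ← sum_mul_smul_right (d := fun n => χ n (B.P.tgt ρ)) (hone hρ h₁), ← Finset.sum_sub_distrib]
    refine Finset.sum_congr rfl fun n _ => ?_
    rw [← Finset.sum_sub_distrib]
    refine Finset.sum_congr rfl fun m _ => ?_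
    rw [← smul_sub]
    by_cases hn : χ n (B.P.src ρ) = 0
    · simp [hn]
    by_cases hm : χ m (B.P.tgt ρ) = 0
    · simp [hm]
    have h := PrincipalTwoBundle.tStar_formB hσ (hmem hn) (hmem hm)
    exact congrArg _ (congrArg (fun A : E₁ →L[ℝ] EG => A v) h).symm
  · intro ξ η hξη hη v w hvw D hD
    have hsrc := B.isLieGroupoid.src_comp ξ η hξη
    have htgt := B.isLieGroupoid.tgt_comp ξ η hξη
    have hπ2 := hπt hη
    have hπ3 : B.π (B.P.tgt ξ) ∈ U := hπt (by rwa [hξη])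
    obtain ⟨N₁, h₁⟩ := hN hη
    obtain ⟨N₂, h₂⟩ := hN hπ2
    obtain ⟨N₃, h₃⟩ := hN hπ3
    have h₁ := h₁ (max N₁ (max N₂ N₃)) (le_max_left _ _)
    have h₂ := h₂ (max N₁ (max N₂ N₃)) ((le_max_left _ _).trans (le_max_right _ _))
    have h₃ := h₃ (max N₁ (max N₂ N₃)) ((le_max_right _ _).trans (le_max_right _ _))
    simp only [hval' (ρ := B.P.comp ξ η) (by rwa [hsrc]) (by rwa [htgt]), hval' h₁ h₂,
      hval' (ρ := ξ) (by rwa [hξη]) h₃, sum_apply,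
      smul_apply]
    simp only [hsrc, htgt, hξη]
    refine sum_mul_smul_cocycle (hone hη h₁) (hone hπ2 h₂) (hone hπ3 h₃) fun n m l hn hm hl => ?_
    exact PrincipalTwoBundle.formB_comp hσ hξη (hmem hn) (hmem hm) (hmem hl) hvw hD
  · intro p k hp v
    obtain ⟨N, h⟩ := hN hp
    have h := h N le_rfl
    have h' : ∀ n, N ≤ n → χ n (B.R₀ (p, k)) = 0 := fun n hn => by rw [hinv, h n hn]
    simp only [hval h, hval h', sum_apply, smul_apply, map_sum, map_smul]
    simp only [hinv]
    have h1 : der 𝓘(ℝ, EG) 𝓘(ℝ, EG) (fun x : G => k⁻¹ * x) k v.2 =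
        ∑ n ∈ Finset.range N, χ n p • der 𝓘(ℝ, EG) 𝓘(ℝ, EG) (fun x : G => k⁻¹ * x) k v.2 := by
      rw [← Finset.sum_smul, hone hp h, one_smul]
    rw [h1, ← Finset.sum_add_distrib]
    refine Finset.sum_congr rfl fun n _ => ?_
    rw [← smul_add]
    by_cases hn : χ n p = 0
    · simp [hn]
    have h2 := PrincipalTwoBundle.formA_R B.action.smooth_functor.smooth_obj (L n) (hmem hn) k
    exact congrArg _ (congrArg (fun A : E₀ × EG →L[ℝ] EG => A v) h2)
  · intro ρ h k hρ v
    obtain ⟨N₁, h₁⟩ := hN hρ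
    obtain ⟨N₂, h₂⟩ := hN (hπt hρ)
    have h₁ := h₁ (max N₁ N₂) (le_max_left _ _)
    have h₂ := h₂ (max N₁ N₂) (le_max_right _ _)
    simp only [hval h₁, hval' h₁ h₂, hval' (ρ := B.R₁ (ρ, (h, k)))
      (N := max N₁ N₂) (fun n hn => by rw [B.src_R, hinv, h₁ n hn])
      (fun n hn => by rw [B.tgt_R, hinv, h₂ n hn]), sum_apply, smul_apply, map_sum, map_smul]
    simp only [B.src_R, B.tgt_R, hinv]
    -- The Maurer-Cartan term is not multiplied by weights; it is its own average because the
    -- weights sum to 1.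
    have hw : ∀ x : EH, x = ∑ n ∈ Finset.range (max N₁ N₂), ∑ m ∈ Finset.range (max N₁ N₂),
        (χ n (B.P.src ρ) * χ m (B.P.tgt ρ)) • x := by
      intro x
      rw [sum_mul_smul_left (c := fun n => χ n (B.P.src ρ)) (hone (hπt hρ) h₂) (fun _ => x),
        ← Finset.sum_smul, hone hρ h₁, one_smul]
    rw [hw (Γ.αStar k⁻¹ (der 𝓘(ℝ, EH) 𝓘(ℝ, EH) (fun x : H => h⁻¹ * x) h v.2.1)),
      ← sum_mul_smul_left (c := fun n => χ n (B.P.src ρ)) (hone (hπt hρ) h₂),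
      ← Finset.sum_add_distrib, ← Finset.sum_add_distrib]
    refine Finset.sum_congr rfl fun n _ => ?_
    rw [← Finset.sum_add_distrib, ← Finset.sum_add_distrib]
    refine Finset.sum_congr rfl fun m _ => ?_
    rw [← smul_add, ← smul_add]
    by_cases hn : χ n (B.P.src ρ) = 0
    · simp [hn]
    by_cases hm : χ m (B.P.tgt ρ) = 0
    · simp [hm]
    exact congrArg _ (PrincipalTwoBundle.formB_R hσ (hmem hn) (hmem hm) h k v)

/-- Connections exist locally over the base. -/
theorem exists_isConnectionOver [FiniteDimensional ℝ EG] [LieGroup 𝓘(ℝ, EG) ∞ G]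
    [LieGroup 𝓘(ℝ, EH) ∞ H] [FiniteDimensional ℝ E₀] [IsManifold 𝓘(ℝ, E₀) ∞ P₀] [T2Space P₀]
    [SecondCountableTopology P₀] [IsManifold 𝓘(ℝ, E₁) ∞ P₁]
    (B : PrincipalTwoBundle EM E₀ E₁ M P₀ P₁ Γ) (hR : IsFreeProperAction E₀ EG B.R₀) (x : M) :
    ∃ (U : Set M) (a : P₀ → E₀ →L[ℝ] EG) (b : P₁ → E₁ →L[ℝ] EH), IsOpen U ∧ x ∈ U ∧
      IsConnectionOver B U a b := by
  obtain ⟨U, σ, hU, hxU, hσ, hσπ⟩ := B.exists_local_section x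
  have hlift : ∀ p : {p : P₀ // B.π p ∈ U}, _ := fun p => B.exists_lift hR hU hσ hσπ p.2
  choose L f hfs hf0 hfinv hfpos hfsupp using hlift
  -- Second countability reduces the cover by positivity sets of the bump functions to a countable
  -- one.
  obtain ⟨T, hTc, hT⟩ := TopologicalSpace.isOpen_iUnion_countable (fun p => {y | 0 < f p y})
    fun p => isOpen_lt continuous_const (hfs p).continuous
  have hcov : ∀ y, B.π y ∈ U → ∃ p ∈ T, 0 < f p y := by
    intro y hy
    have h : y ∈ ⋃ p, {y | 0 < f p y} := Set.mem_iUnion.2 ⟨⟨y, hy⟩, hfpos ⟨y, hy⟩⟩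
    rw [← hT] at h
    simpa using h
  -- A point over `x` shows that `T` is nonempty, as its enumeration by `ℕ` requires.
  obtain ⟨y, rfl⟩ := B.π_surjective x
  obtain ⟨p, hp, -⟩ := hcov y hxU
  obtain ⟨s, hs⟩ := hTc.exists_eq_range ⟨p, hp⟩
  obtain ⟨χ, hχ, hχfin, hχsum, hχ0, hχinv⟩ := exists_weights (f := fun n => f (s n))
    (O := B.π ⁻¹' U) (fun n => hfs (s n)) (fun n => hf0 (s n)) (fun y hy => by
      obtain ⟨p, hp, hpy⟩ := hcov y hy
      rw [hs] at hp
      obtain ⟨n, rfl⟩ := hp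
      exact ⟨n, hpy⟩)
  refine ⟨U, _, _, hU, hxU, isConnectionOver_sum hσ (fun n => L (s n)) (χ := χ) hχ hχfin hχsum
    (fun n p hp => ?_) fun n p k => hχinv _ _ (fun m => hfinv (s m) p k) n⟩
  filter_upwards [hfsupp (s n) p hp] with y hy using hχ0 n y hy

theorem finsum_smul_eq_sum {ι V : Type*} [AddCommGroup V] [Module ℝ V] {s : Finset ι} {c : ι → ℝ}
    (X : ι → V) (h : ∀ i ∉ s, c i = 0) : ∑ᶠ i, c i • X i = ∑ i ∈ s, c i • X i := by
  refine finsum_eq_sum_of_support_subset _ fun i hi => ?_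
  by_contra hin
  exact hi (by simp [h i hin])

/-- Connections over the members of an open cover of the base can be glued. -/
theorem exists_isConnectionOver_univ [FiniteDimensional ℝ EM] [IsManifold 𝓘(ℝ, EM) ∞ M]
    [T2Space M] [SecondCountableTopology M] [IsManifold 𝓘(ℝ, E₀) ∞ P₀] [IsManifold 𝓘(ℝ, E₁) ∞ P₁]
    (B : PrincipalTwoBundle EM E₀ E₁ M P₀ P₁ Γ)
    (hloc : ∀ x : M, ∃ (U : Set M) (a : P₀ → E₀ →L[ℝ] EG) (b : P₁ → E₁ →L[ℝ] EH),
      IsOpen U ∧ x ∈ U ∧ IsConnectionOver B U a b) :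
    ∃ (a : P₀ → E₀ →L[ℝ] EG) (b : P₁ → E₁ →L[ℝ] EH), IsConnectionOver B Set.univ a b := by
  have : LocallyCompactSpace M := Manifold.locallyCompact_of_finiteDimensional 𝓘(ℝ, EM)
  choose U a b hU hxU hab using hloc
  obtain ⟨ψ, hψ⟩ := SmoothPartitionOfUnity.exists_isSubordinate 𝓘(ℝ, EM) isClosed_univ U hU
    fun x _ => Set.mem_iUnion.2 ⟨x, hxU x⟩
  have hfin : ∀ y : M, ∃ s : Finset M, ∀ᶠ z in 𝓝 y, ∀ i ∉ s, ψ i z = 0 := by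
    intro y
    obtain ⟨s, hs⟩ := ψ.toPartitionOfUnity.exists_finset_nhds y
    refine ⟨s, ?_⟩
    filter_upwards [hs] with z hz i hi
    by_contra h
    exact hi (hz.2 h)
  have hmem : ∀ {i y}, ψ i y ≠ 0 → y ∈ U i := fun {i y} h => hψ i (subset_tsupport _ h)
  have hval : ∀ {s : Finset M} {y : M} (X : M → E₀ →L[ℝ] EG),
      (∀ i ∉ s, ψ i y = 0) → ∑ᶠ i, ψ i y • X i = ∑ i ∈ s, ψ i y • X i :=
    fun X h => finsum_smul_eq_sum X h
  have hval' : ∀ {s : Finset M} {y : M} (X : M → E₁ →L[ℝ] EH),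
      (∀ i ∉ s, ψ i y = 0) → ∑ᶠ i, ψ i y • X i = ∑ i ∈ s, ψ i y • X i :=
    fun X h => finsum_smul_eq_sum X h
  have hone : ∀ {s : Finset M} {y : M}, (∀ i ∉ s, ψ i y = 0) → ∑ i ∈ s, ψ i y = 1 := by
    intro s y h
    rw [← ψ.sum_eq_one (Set.mem_univ y)]
    refine (finsum_eq_sum_of_support_subset _ fun i hi => ?_).symm
    by_contra hi'
    exact hi (h i hi')
  have hπs : ContMDiff 𝓘(ℝ, E₀) 𝓘(ℝ, EM) ∞ B.π := B.π_functor.smooth_obj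
  have hπs' : ContMDiff 𝓘(ℝ, E₁) 𝓘(ℝ, EM) ∞ (fun ρ => B.π (B.P.src ρ)) := hπs.comp B.smooth_src
  have hzero : ∀ i y, y ∉ U i → ∀ᶠ z in 𝓝 y, ψ i z = 0 := fun i y hy =>
    notMem_tsupport_iff_eventuallyEq.1 fun h => hy (hψ i h)
  -- Weights pulled back from the base agree at source and target and are invariant under the
  -- action, so single sums suffice here.
  refine ⟨fun p => ∑ᶠ i, ψ i (B.π p) • a i p, fun ρ => ∑ᶠ i, ψ i (B.π (B.P.src ρ)) • b i ρ,
    ?_, ?_, ?_, ?_, ?_, ?_⟩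
  · intro p _
    obtain ⟨s, hs⟩ := hfin (B.π p)
    refine SmoothFormAt.finsum s (hπs.continuous.continuousAt.eventually hs)
      (fun i => (ψ i).contMDiff.contMDiffAt.comp p hπs.contMDiffAt) fun i => ?_
    by_cases hp : B.π p ∈ U i
    · exact Or.inl ((hab i).smooth_a p hp)
    · exact Or.inr (hπs.continuous.continuousAt.eventually (hzero i _ hp))
  · intro ρ _
    obtain ⟨s, hs⟩ := hfin (B.π (B.P.src ρ))
    refine SmoothFormAt.finsum s (hπs'.continuous.continuousAt.eventually hs)
      (fun i => (ψ i).contMDiff.contMDiffAt.comp ρ hπs'.contMDiffAt) fun i => ?_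
    by_cases hp : B.π (B.P.src ρ) ∈ U i
    · exact Or.inl ((hab i).smooth_b ρ hp)
    · exact Or.inr (hπs'.continuous.continuousAt.eventually (hzero i _ hp))
  · intro ρ _ v
    obtain ⟨s, hs⟩ := hfin (B.π (B.P.src ρ))
    have hs := hs.self_of_nhds
    simp only [← B.π_src_eq_π_tgt, hval _ hs, hval' _ hs, sum_apply, smul_apply, map_sum, map_smul]
    rw [← Finset.sum_sub_distrib]
    refine Finset.sum_congr rfl fun i _ => ?_
    rw [← smul_sub]
    by_cases hi : ψ i (B.π (B.P.src ρ)) = 0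
    · simp [hi]
    rw [(hab i).delta_a ρ (hmem hi)]
  · intro ξ η hξη _ v w hvw D hD
    obtain ⟨s, hs⟩ := hfin (B.π (B.P.src η))
    have hs := hs.self_of_nhds
    have hπ : B.π (B.P.src ξ) = B.π (B.P.src η) := by rw [hξη, B.π_src_eq_π_tgt]
    simp only [B.isLieGroupoid.src_comp _ _ hξη, hπ, hval' _ hs, sum_apply, smul_apply]
    rw [← Finset.sum_add_distrib]
    refine Finset.sum_congr rfl fun i _ => ?_
    rw [← smul_add]
    by_cases hi : ψ i (B.π (B.P.src η)) = 0
    · simp [hi]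
    rw [(hab i).delta_b ξ η hξη (hmem hi) v w hvw D hD]
  · intro p k _ v
    obtain ⟨s, hs⟩ := hfin (B.π p)
    have hs := hs.self_of_nhds
    simp only [B.π_action, hval _ hs, sum_apply, smul_apply, map_sum, map_smul]
    have h1 : der 𝓘(ℝ, EG) 𝓘(ℝ, EG) (fun x : G => k⁻¹ * x) k v.2 =
        ∑ i ∈ s, ψ i (B.π p) • der 𝓘(ℝ, EG) 𝓘(ℝ, EG) (fun x : G => k⁻¹ * x) k v.2 := by
      rw [← Finset.sum_smul, hone hs, one_smul]
    rw [h1, ← Finset.sum_add_distrib]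
    refine Finset.sum_congr rfl fun i _ => ?_
    rw [← smul_add]
    by_cases hi : ψ i (B.π p) = 0
    · simp [hi]
    rw [(hab i).equivariance_a p k (hmem hi)]
  · intro ρ h k _ v
    obtain ⟨s, hs⟩ := hfin (B.π (B.P.src ρ))
    have hs := hs.self_of_nhds
    simp only [B.src_R, B.π_action, hval _ hs, hval' _ hs, sum_apply, smul_apply, map_sum, map_smul]
    have h1 : Γ.αStar k⁻¹ (der 𝓘(ℝ, EH) 𝓘(ℝ, EH) (fun x : H => h⁻¹ * x) h v.2.1) =
        ∑ i ∈ s, ψ i (B.π (B.P.src ρ)) •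
          Γ.αStar k⁻¹ (der 𝓘(ℝ, EH) 𝓘(ℝ, EH) (fun x : H => h⁻¹ * x) h v.2.1) := by
      rw [← Finset.sum_smul, hone hs, one_smul]
    rw [h1, ← Finset.sum_add_distrib, ← Finset.sum_add_distrib]
    refine Finset.sum_congr rfl fun i _ => ?_
    rw [← smul_add, ← smul_add]
    by_cases hi : ψ i (B.π (B.P.src ρ)) = 0
    · simp [hi]
    rw [(hab i).equivariance_b ρ h k (hmem hi)]

/-- The forms of a connection over the whole base, completed by the zero two-form, are a
connection. -/
theorem IsConnectionOver.isConnection {B : PrincipalTwoBundle EM E₀ E₁ M P₀ P₁ Γ}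
    {a : P₀ → E₀ →L[ℝ] EG} {b : P₁ → E₁ →L[ℝ] EH} (h : IsConnectionOver B Set.univ a b) :
    IsConnection B ⟨toForm a, toForm b, 0⟩ := by
  constructor
  · refine ⟨isSmooth_toForm fun p => h.smooth_a p trivial,
      isSmooth_toForm fun ρ => h.smooth_b ρ trivial, ?_, ?_, ?_⟩
    · intro x₀
      have : Form.inChart (0 : Form P₀ 𝓘(ℝ, E₀) EH 2) x₀ = fun _ => 0 := by
        funext y
        ext v
        rfl
      rw [this]
      exact contDiffOn_const
    · funext ρ
      ext v
      exact h.delta_a ρ trivial (v 0)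
    · intro ξ η hξη v w hvw
      have hD : MDifferentiableWithinAt (𝓘(ℝ, E₁).prod 𝓘(ℝ, E₁)) 𝓘(ℝ, E₁)
          B.P.compPair B.P.composable (ξ, η) :=
        (B.isLieGroupoid.smooth_comp (ξ, η) hξη).mdifferentiableWithinAt (by simp)
      have h1 := h.delta_b ξ η hξη trivial (v 0) (w 0) (hvw 0) _ hD.hasMFDerivWithinAt
      have h2 : b ξ (v 0) - b (B.P.comp ξ η) (mfderivWithin (𝓘(ℝ, E₁).prod 𝓘(ℝ, E₁)) 𝓘(ℝ, E₁)
          B.P.compPair B.P.composable (ξ, η) (v 0, w 0)) + b η (w 0) = 0 := by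
        exact (congrArg (fun x => b ξ (v 0) - x + b η (w 0)) h1).trans (by abel)
      exact h2
  · refine GammaForm.ext ?_ ?_ ?_
    · funext z
      ext v
      -- The goal restated over the model spaces, to which it is definitionally equal, so that the
      -- derivatives of the projections can be rewritten.
      have key : ∀ w : E₀ × EG,
          a (B.R₀ z) (der (𝓘(ℝ, E₀).prod 𝓘(ℝ, EG)) 𝓘(ℝ, E₀) B.R₀ z w) =
          Ad EG z.2⁻¹ (a z.1 (der (𝓘(ℝ, E₀).prod 𝓘(ℝ, EG)) 𝓘(ℝ, E₀) Prod.fst z w)) +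
          der 𝓘(ℝ, EG) 𝓘(ℝ, EG) (fun x : G => z.2⁻¹ * x) z.2
            (der (𝓘(ℝ, E₀).prod 𝓘(ℝ, EG)) 𝓘(ℝ, EG) Prod.snd z w) := by
        intro w
        rw [der_fst, der_snd]
        exact h.equivariance_a z.1 z.2 trivial w
      exact key (v 0)
    · funext z
      ext v
      have hsrc : ∀ w : E₁ × (EH × EG), der (𝓘(ℝ, E₀).prod 𝓘(ℝ, EG)) 𝓘(ℝ, E₀) Prod.fst
          ((B.P.prod Γ.groupoid).src z) (der (𝓘(ℝ, E₁).prod (𝓘(ℝ, EH).prod 𝓘(ℝ, EG)))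
            (𝓘(ℝ, E₀).prod 𝓘(ℝ, EG)) (B.P.prod Γ.groupoid).src z w) =
          der 𝓘(ℝ, E₁) 𝓘(ℝ, E₀) B.P.src z.1 w.1 := by
        intro w
        have h1 : der (𝓘(ℝ, E₁).prod (𝓘(ℝ, EH).prod 𝓘(ℝ, EG))) (𝓘(ℝ, E₀).prod 𝓘(ℝ, EG))
            (B.P.prod Γ.groupoid).src z = _ :=
          der_prodMk (f := fun z : P₁ × (H × G) => B.P.src z.1) (g := fun z => z.2.2)
            (mdiffAt (B.smooth_src.comp contMDiff_fst).contMDiffAt)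
            (mdiffAt (contMDiff_snd.comp contMDiff_snd).contMDiffAt)
        rw [der_fst, h1, der_comp (f := Prod.fst) (g := B.P.src) (mdiffAt B.smooth_src.contMDiffAt)
          (mdiffAt contMDiff_fst.contMDiffAt), der_fst]
        rfl
      have key : ∀ w : E₁ × (EH × EG),
          b (B.R₁ z) (der (𝓘(ℝ, E₁).prod (𝓘(ℝ, EH).prod 𝓘(ℝ, EG))) 𝓘(ℝ, E₁) B.R₁ z w) =
          Ad EH (Γ.invMor z.2).1 (Γ.αStar (Γ.invMor z.2).2 (b z.1
            (der (𝓘(ℝ, E₁).prod (𝓘(ℝ, EH).prod 𝓘(ℝ, EG))) 𝓘(ℝ, E₁) Prod.fst z w))) +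
          Γ.αTildeStar (Γ.invMor z.2).1⁻¹ (Ad EG (Γ.invMor z.2).2
            (a (B.P.src z.1) (der (𝓘(ℝ, E₀).prod 𝓘(ℝ, EG)) 𝓘(ℝ, E₀) Prod.fst
              ((B.P.prod Γ.groupoid).src z) (der (𝓘(ℝ, E₁).prod (𝓘(ℝ, EH).prod 𝓘(ℝ, EG)))
                (𝓘(ℝ, E₀).prod 𝓘(ℝ, EG)) (B.P.prod Γ.groupoid).src z w)))) +
          Γ.αStar z.2.2⁻¹ (der 𝓘(ℝ, EH) 𝓘(ℝ, EH) (fun x : H => z.2.1⁻¹ * x) z.2.1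
            (der (𝓘(ℝ, EH).prod 𝓘(ℝ, EG)) 𝓘(ℝ, EH) Prod.fst z.2
              (der (𝓘(ℝ, E₁).prod (𝓘(ℝ, EH).prod 𝓘(ℝ, EG))) (𝓘(ℝ, EH).prod 𝓘(ℝ, EG))
                Prod.snd z w))) := by
        intro w
        rw [hsrc, der_fst, der_fst, der_snd]
        exact h.equivariance_b z.1 z.2.1 z.2.2 trivial w
      exact key (v 0)
    · funext z
      ext v
      -- Equivariance of the 2-form has no inhomogeneous term, so the zero form satisfies it.
      have key : (0 : EH) = Γ.αStar z.2⁻¹ 0 + 0 := by simp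
      exact key

end Connections

end TwoBundle

end

open TwoBundle in
theorem mainTheorem2 {EG EH EM E₀ E₁ G H M P₀ P₁ : Type*}
    -- the Lie groups `G` and `H` of the Lie 2-group
    [NormedAddCommGroup EG] [NormedSpace ℝ EG] [FiniteDimensional ℝ EG]
    [TopologicalSpace G] [ChartedSpace EG G] [Group G] [LieGroup 𝓘(ℝ, EG) ∞ G]
    [T2Space G] [SecondCountableTopology G]
    [NormedAddCommGroup EH] [NormedSpace ℝ EH] [FiniteDimensional ℝ EH]
    [TopologicalSpace H] [ChartedSpace EH H] [Group H] [LieGroup 𝓘(ℝ, EH) ∞ H]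
    [T2Space H] [SecondCountableTopology H]
    -- the base manifold
    [NormedAddCommGroup EM] [NormedSpace ℝ EM] [FiniteDimensional ℝ EM]
    [TopologicalSpace M] [ChartedSpace EM M] [IsManifold 𝓘(ℝ, EM) ∞ M]
    [T2Space M] [SecondCountableTopology M]
    -- the manifolds of objects and morphisms of the total space
    [NormedAddCommGroup E₀] [NormedSpace ℝ E₀] [FiniteDimensional ℝ E₀]
    [TopologicalSpace P₀] [ChartedSpace E₀ P₀] [IsManifold 𝓘(ℝ, E₀) ∞ P₀]
    [T2Space P₀] [SecondCountableTopology P₀]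
    [NormedAddCommGroup E₁] [NormedSpace ℝ E₁] [FiniteDimensional ℝ E₁]
    [TopologicalSpace P₁] [ChartedSpace E₁ P₁] [IsManifold 𝓘(ℝ, E₁) ∞ P₁]
    [T2Space P₁] [SecondCountableTopology P₁]
    (Γ : CrossedModule EG EH G H) (B : PrincipalTwoBundle EM E₀ E₁ M P₀ P₁ Γ)
    (hfree : ∀ (x : P₀) (g : G), B.R₀ (x, g) = x → g = 1)
    (hproper : IsProperMap (fun z : P₀ × G => (z.1, B.R₀ z))) :
    ∃ Ω : GammaForm EG EH P₀ P₁ 𝓘(ℝ, E₀) 𝓘(ℝ, E₁) 1, IsConnection B Ω := by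
  have hR : IsFreeProperAction E₀ EG B.R₀ :=
    ⟨B.action.smooth_functor.smooth_obj, B.action.obj_one, B.action.obj_mul, hfree, hproper⟩
  obtain ⟨a, b, h⟩ := exists_isConnectionOver_univ B (exists_isConnectionOver B hR)
  exact ⟨_, h.isConnection⟩
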